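/- Let $\mathbf k$ be a field of characteristic zero, let $r,n\ge 0$, let $T=(\mathbf k^\times)^n$, $G_r=\mathrm{GL}_r(\mathbf k)\times T$, and $R_r=\mathbf k[x_{ij}: 1\le i\le r,\ 1\le j\le n]$, on which $G_r$ acts by $((g,t)\cdot f)(v)=f(g^{-1}vt)$. A $G_r$-equivariant $R_r$-module is graded by $\mathbb Z^r\times\mathbb Z^n$: its piece of degree $(\mathbf a,\mathbf b)$ consists of the vectors of weight $-\mathbf a$ for the diagonal torus of $\mathrm{GL}_r(\mathbf k)$ and of weight $\mathbf b$ for $T$ (so $x_{ij}$ has degree $(\epsilon_i,\epsilon_j)$, where $\epsilon_i$ and $\epsilon_j$ are standard basis vectors). The $K$-polynomial $\mathcal K(M)$ of such a module $M$ with finite-dimensional graded pieces is the Laurent polynomial, if it exists, with $$\sum_{\mathbf a,\mathbf b}\dim_{\mathbf k}(M_{(\mathbf a,\mathbf b)})\,u^{\mathbf a}t^{\mathbf b}=\frac{\mathcal K(M)}{\prod_{i=1}^r\prod_{j=1}^n(1-u_it_j)} .$$ For $\alpha\in\mathbb Z_{\ge0}^m$, weakly decreasing or not, put $s_\alpha(u_1,\dots,u_m)=\det(u_i^{\alpha_j+m-j})_{i,j}/\det(u_i^{m-j})_{i,j}$.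 Let $\rho_k$ be the $\mathbb Z[t^{\pm1}]$-linear operator from $\mathbb Z[u_1,\dots,u_r,t^{\pm1}]^{\mathfrak S_r}$ to $\mathbb Z[u_1,\dots,u_{r+1},t^{\pm1}]^{\mathfrak S_{r+1}}$ with $$\rho_k\,s_\lambda(u_1,\dots,u_r)=s_{(\lambda_1,\dots,\lambda_r,k)}(u_1,\dots,u_{r+1})$$ for every partition $\lambda=(\lambda_1\ge\dots\ge\lambda_r\ge0)$, and let $\rho=\sum_{k=0}^n(-1)^ke_k(t_1,\dots,t_n)\,\rho_k$. Let $V$ be a finite-dimensional rational representation of $T$, on which $\mathrm{GL}_r(\mathbf k)$ acts trivially, and let $M$ be a $G_r$-equivariant $R_r$-module with an equivariant presentation $0\to N_r\to R_r\otimes V\to M\to0$. Let $N_{r+1}$ be the smallest $G_{r+1}$-stable $R_{r+1}$-submodule of $R_{r+1}\otimes V$ that contains $N_r$, and let $J_{r+1}\subseteq R_{r+1}$ be the ideal generated by the minors of size $r+1$ of the matrix $(x_{ij})$. A stabilization of $M$ is a $G_{r+1}$-equivariant $R_{r+1}$-module $\rho(M)$ with an equivariant exact sequence $$0\to N_{r+1}+(J_{r+1}\otimes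 V)\to R_{r+1}\otimes V\to\rho(M)\to0.$$ Then $M$ has a $K$-polynomial, which lies in $\mathbb Z[u_1,\dots,u_r,t^{\pm1}]^{\mathfrak S_r}$, and every stabilization $\rho(M)$ has a $K$-polynomial, namely $$\mathcal K(\rho(M))=\rho\,\mathcal K(M).$$ In particular, let $X\subseteq\mathbb A^{r\times n}$ be a $G_r$-stable closed subset with its reduced structure (for example, a $G_r$-stable closed subvariety), and regard it as a subset of $\mathbb A^{(r+1)\times n}$ by adding a last row of zeros. Writing $\mathcal K$ of a closed set for the $K$-polynomial of its coordinate ring, we have $\mathcal K(X)\in\mathbb Z[u_1,\dots,u_r,t^{\pm1}]^{\mathfrak S_r}$ and $$\mathcal K\bigl(\overline{\mathrm{GL}_{r+1}(\mathbf k)X}\bigr)=\rho\,\mathcal K(X).$$ -/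

import Mathlib

open scoped TensorProduct

noncomputable section

namespace RowStabilization

/-! ### Schur polynomials and the operators `ρ_k`, `ρ` -/

section Schur

variable (A : Type*) [CommRing A]

/-- The alternant `det (u_i ^ m_j)` in the variables `u_i`, `i : Fin r`. -/
def alternant {r : ℕ} (m : Fin r → ℕ) : MvPolynomial (Fin r) A :=
  Matrix.det (Matrix.of fun i j => (MvPolynomial.X i : MvPolynomial (Fin r) A) ^ m j)

/-- The staircase `δ = (r - 1, r - 2, …, 0)`. -/
def stair (r : ℕ) : Fin r → ℕ := fun j => r - 1 - j

theorem alternant_stair_dvd {r : ℕ} (m : Fin r → ℕ) :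
    alternant A (stair r) ∣ alternant A m := by
  classical
  nontriviality MvPolynomial (Fin r) A
  set B := MvPolynomial (Fin r) A with hB
  let P : Polynomial B := ∏ i : Fin r, (Polynomial.X - Polynomial.C (MvPolynomial.X i))
  have hP : P.Monic := Polynomial.monic_prod_of_monic _ _ fun i _ => Polynomial.monic_X_sub_C _
  have hdeg : P.natDegree = r := by
    simp [P]
  let c : ℕ → Polynomial B := fun e => (Polynomial.X ^ e) %ₘ P
  have hc : ∀ (e : ℕ) (i : Fin r),
      (MvPolynomial.X i : B) ^ e = ∑ l : Fin r, (MvPolynomial.X i) ^ (l : ℕ) * (c e).coeff l := by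
    intro e i
    have h0 : P.eval (MvPolynomial.X i : B) = 0 := by
      simp only [P, Polynomial.eval_prod]
      exact Finset.prod_eq_zero (Finset.mem_univ i) (by simp)
    have h1 := congrArg (Polynomial.eval (MvPolynomial.X i : B))
      (Polynomial.modByMonic_add_div (Polynomial.X ^ e : Polynomial B) P)
    simp only [Polynomial.eval_add, Polynomial.eval_mul, h0, zero_mul, add_zero,
      Polynomial.eval_pow, Polynomial.eval_X] at h1
    rw [← h1]
    change (c e).eval _ = _
    have hr : (c e).degree < r := by
      have := Polynomial.degree_modByMonic_lt (Polynomial.X ^ e : Polynomial B) hP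
      rwa [Polynomial.degree_eq_natDegree hP.ne_zero, hdeg] at this
    rw [Polynomial.eval_eq_sum_range' (n := r), Finset.sum_range]
    · exact Finset.sum_congr rfl fun l _ => mul_comm _ _
    · by_cases hz : c e = 0
      · rcases Nat.eq_zero_or_pos r with h | h
        · subst h; exact i.elim0
        · simpa [hz] using h
      · exact (Polynomial.natDegree_lt_iff_degree_lt hz).2 hr
  refine ⟨Matrix.det (Matrix.of fun l j : Fin r => (c (m j)).coeff (stair r l)), ?_⟩
  rw [alternant, alternant, ← Matrix.det_mul]
  congr 1
  ext1 i j
  rw [Matrix.mul_apply]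
  simp only [Matrix.of_apply]
  rw [hc (m j) i, ← Equiv.sum_comp Fin.revPerm]
  refine Finset.sum_congr rfl fun l _ => ?_
  have : ((Fin.revPerm l : Fin r) : ℕ) = stair r l := by
    simp [stair, Fin.val_rev]; omega
  rw [this]

/-- The Schur polynomial `s_α(u_1, …, u_r) = det (u_i ^ (α_j + r - j)) / det (u_i ^ (r - j))`
of an `r`-tuple `α` of natural numbers, not necessarily weakly decreasing. -/
def schur {r : ℕ} (α : Fin r → ℕ) : MvPolynomial (Fin r) A :=
  Classical.choose (alternant_stair_dvd A fun j => α j + stair r j)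

theorem alternant_stair_mul_schur {r : ℕ} (α : Fin r → ℕ) :
    alternant A (stair r) * schur A α = alternant A fun j => α j + stair r j :=
  (Classical.choose_spec (alternant_stair_dvd A fun j => α j + stair r j)).symm

/-- The linear operator `ρ_k`, characterized on symmetric polynomials by
`ρ_k s_λ(u_1, …, u_r) = s_{λ, k}(u_1, …, u_{r + 1})` for all partitions `λ` with at most `r` parts
(see `rhoK_schur`). The coefficient of `s_λ` in a symmetric polynomial `f` is the coefficient of
`u ^ (λ + δ)` in `det (u_i ^ (r - j)) * f`, and the exponents `λ + δ` are exactly the strictly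
decreasing ones. -/
def rhoK {r : ℕ} (k : ℕ) : MvPolynomial (Fin r) A →ₗ[A] MvPolynomial (Fin (r + 1)) A :=
  open scoped Classical in
  ((MvPolynomial.basisMonomials (Fin r) A).constr A fun m =>
      if StrictAnti m then schur A (Fin.snoc (α := fun _ => ℕ) (fun j => m j - stair r j) k)
      else 0) ∘ₗ
    LinearMap.mulLeft A (alternant A (stair r))

theorem rhoK_schur {r : ℕ} (k : ℕ) (lam : Fin r → ℕ) (hlam : Antitone lam) :
    rhoK A k (schur A lam) = schur A (Fin.snoc (α := fun _ => ℕ) lam k) := by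
  classical
  have hm : StrictAnti fun j => lam j + stair r j := by
    intro i j hij
    have h1 := hlam hij.le
    have h2 : stair r j < stair r i := by
      have := j.2; have : (i : ℕ) < j := hij; simp only [stair]; omega
    change lam j + stair r j < lam i + stair r i
    omega
  set m : Fin r → ℕ := fun j => lam j + stair r j with hmdef
  have hmon : ∀ σ : Equiv.Perm (Fin r),
      (∏ i, (MvPolynomial.X (σ i) : MvPolynomial (Fin r) A) ^ m i) =
        MvPolynomial.basisMonomials (Fin r) A (Finsupp.equivFunOnFinite.symm (m ∘ σ.symm)) := by
    intro σ
    rw [MvPolynomial.coe_basisMonomials]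
    simp only
    rw [MvPolynomial.monomial_eq, ← Equiv.prod_comp σ.symm]
    simp [Finsupp.prod_fintype]
  rw [rhoK, LinearMap.comp_apply, LinearMap.mulLeft_apply, alternant_stair_mul_schur,
    alternant, Matrix.det_apply, map_sum, Finset.sum_eq_single 1]
  · simp only [Equiv.Perm.sign_one, one_smul, Matrix.of_apply]
    rw [hmon 1, Module.Basis.constr_basis]
    have he : ⇑(Finsupp.equivFunOnFinite.symm (m ∘ (1 : Equiv.Perm (Fin r)).symm)) = m := by
      ext; simp; rfl
    rw [he, if_pos hm]
    congr 2
    ext j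
    simp [hmdef]
  · intro σ _ hσ
    simp only [Matrix.of_apply]
    rw [hmon σ]
    rw [LinearMap.map_smul_of_tower, Module.Basis.constr_basis, if_neg, smul_zero]
    intro h
    apply hσ
    have he : ⇑(Finsupp.equivFunOnFinite.symm (m ∘ σ.symm)) = m ∘ σ.symm := by
      ext; simp
    rw [he] at h
    have hmono : StrictMono σ.symm := by
      intro a b hab
      exact hm.lt_iff_gt.1 (h hab)
    have := Subsingleton.elim (StrictMono.orderIsoOfSurjective _ hmono σ.symm.surjective)
      (OrderIso.refl (Fin r))
    ext i
    have h2 := congrArg (fun e : Fin r ≃o Fin r => e (σ i)) this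
    simp at h2
    simp [← h2]
  · simp

end Schur

/-- `ℤ[t_1^{±1}, …, t_n^{±1}]`. -/
abbrev TRing (n : ℕ) : Type := AddMonoidAlgebra ℤ (Fin n → ℤ)

/-- The elementary symmetric polynomial `e_k(t_1, …, t_n)`. -/
def elemT (n k : ℕ) : TRing n :=
  MvPolynomial.aeval (fun j : Fin n => (AddMonoidAlgebra.single (Pi.single j 1) 1 : TRing n))
    (MvPolynomial.esymm (Fin n) ℤ k)

/-- The operator `ρ = ∑_{k = 0}^n (-1)^k e_k(t) ρ_k` on polynomials in `u_1, …, u_r` with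
coefficients in `ℤ[t^{±1}]`. -/
def rho {r : ℕ} (n : ℕ) :
    MvPolynomial (Fin r) (TRing n) →ₗ[TRing n] MvPolynomial (Fin (r + 1)) (TRing n) :=
  ∑ k ∈ Finset.range (n + 1), ((-1) ^ k * elemT n k : TRing n) • rhoK (TRing n) k

/-! ### The group `G_r = GL_r(k) × T` and equivariant modules -/

section Modules

variable (k : Type*) [Field k] (r n : ℕ)

/-- The torus `T = (kˣ)^n`. -/
abbrev Torus : Type _ := Fin n → kˣ

/-- `G_r = GL_r(k) × T`. -/
abbrev GrpG : Type _ := Matrix.GeneralLinearGroup (Fin r) k × Torus k n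

/-- `R_r = k[x_ij : i ∈ [r], j ∈ [n]]`. -/
abbrev MatRing : Type _ := MvPolynomial (Fin r × Fin n) k

variable {k r n}

/-- The action of `G_r` on `R_r`, `((g, t) · f)(v) = f(g⁻¹ v t)`. -/
def coordAct (g : GrpG k r n) : MatRing k r n →ₐ[k] MatRing k r n :=
  MvPolynomial.aeval fun p =>
    ∑ l, MvPolynomial.C ((g.1⁻¹).val p.1 l * (g.2 p.2 : k)) * MvPolynomial.X (l, p.2)

theorem coordAct_one : coordAct (1 : GrpG k r n) = AlgHom.id k (MatRing k r n) := by
  refine MvPolynomial.algHom_ext fun p => ?_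
  simp only [coordAct, MvPolynomial.aeval_X, AlgHom.id_apply, Prod.fst_one, Prod.snd_one,
    inv_one, Pi.one_apply, Units.val_one, mul_one]
  rw [Finset.sum_eq_single p.1]
  · simp
  · intro l _ hl
    simp [Matrix.one_apply_ne hl.symm]
  · simp

theorem coordAct_mul (g h : GrpG k r n) :
    coordAct (g * h) = (coordAct g).comp (coordAct h) := by
  refine MvPolynomial.algHom_ext fun p => ?_
  simp only [coordAct, MvPolynomial.aeval_X, AlgHom.comp_apply, map_sum, map_mul,
    MvPolynomial.algHom_C, MvPolynomial.algebraMap_eq, Prod.fst_mul, Prod.snd_mul, mul_inv_rev,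
    Units.val_mul, Pi.mul_apply, Matrix.mul_apply, Finset.mul_sum, Finset.sum_mul]
  rw [Finset.sum_comm]
  refine Finset.sum_congr rfl fun a _ => Finset.sum_congr rfl fun b _ => ?_
  ring

/-- The diagonal matrix with entries `d` as an element of `GL_r(k)`. -/
def diagGL (d : Fin r → kˣ) : Matrix.GeneralLinearGroup (Fin r) k :=
  Units.map (Matrix.diagonalRingHom (Fin r) k : (Fin r → k) →* Matrix (Fin r) (Fin r) k)
    (MulEquiv.piUnits.symm d)

/-- A representation of the torus `T` is rational if its matrix entries are Laurent polynomials
in the coordinates of `T`. -/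
def IsRationalTorusRep {V : Type*} [AddCommGroup V] [Module k V]
    (τ : Representation k (Torus k n) V) : Prop :=
  ∃ B : (Fin n → ℤ) →₀ (V →ₗ[k] V),
    ∀ t, τ t = B.sum fun b f => ((∏ j, t j ^ b j : kˣ) : k) • f

/-- The action of `G_r` on `R_r ⊗ V`, where `GL_r(k)` acts trivially on the representation `V`
of `T`. -/
def tensorAct {V : Type*} [AddCommGroup V] [Module k V] (τ : Representation k (Torus k n) V)
    (g : GrpG k r n) : MatRing k r n ⊗[k] V →ₗ[k] MatRing k r n ⊗[k] V :=
  TensorProduct.map (coordAct g).toLinearMap (τ g.2)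

/-- `φ : R_r ⊗ V → M` is an equivariant presentation of the `R_r`-module `M` with `G_r`-action `σ`.
(It follows that the action on `M` is rational and compatible with the one on `R_r`.) -/
structure IsEquivariantPresentation {V M : Type*} [AddCommGroup V] [Module k V]
    [AddCommGroup M] [Module k M] [Module (MatRing k r n) M] [IsScalarTower k (MatRing k r n) M]
    (τ : Representation k (Torus k n) V) (σ : Representation k (GrpG k r n) M)
    (φ : MatRing k r n ⊗[k] V →ₗ[MatRing k r n] M) : Prop where
  surjective : Function.Surjective φ
  equivariant : ∀ g x, φ (tensorAct τ g x) = σ g (φ x)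

/-- The inclusion `R_r ⊂ R_{r + 1}`. -/
def addRow : MatRing k r n →ₐ[k] MatRing k (r + 1) n :=
  MvPolynomial.rename fun p => (p.1.castSucc, p.2)

/-- The ideal `J_r` of `R_r` generated by the minors of size `r` of the matrix `(x_ij)`. -/
def minorIdeal (k : Type*) [Field k] (r n : ℕ) : Ideal (MatRing k r n) :=
  Ideal.span (Set.range fun c : Fin r ↪o Fin n =>
    Matrix.det (Matrix.of fun i j : Fin r => (MvPolynomial.X (i, c j) : MatRing k r n)))

/-- `N_{r + 1}`: the smallest `G_{r + 1}`-stable `R_{r + 1}`-submodule of `R_{r + 1} ⊗ V`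
containing `N_r`. -/
def extendSubmodule {V : Type*} [AddCommGroup V] [Module k V]
    (τ : Representation k (Torus k n) V)
    (N : Submodule (MatRing k r n) (MatRing k r n ⊗[k] V)) :
    Submodule (MatRing k (r + 1) n) (MatRing k (r + 1) n ⊗[k] V) :=
  sInf {P | (∀ (g : GrpG k (r + 1) n), ∀ x ∈ P, tensorAct τ g x ∈ P) ∧
    ∀ x ∈ N, LinearMap.rTensor V (addRow (k := k) (r := r) (n := n)).toLinearMap x ∈ P}

/-- `M'` with the action `σ'` is a stabilization of the module `M = (R_r ⊗ V) / N`: there is an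
exact sequence `0 → N_{r + 1} + J_{r + 1} ⊗ V → R_{r + 1} ⊗ V → M' → 0`. -/
def IsStabilization {V M' : Type*} [AddCommGroup V] [Module k V]
    [AddCommGroup M'] [Module k M'] [Module (MatRing k (r + 1) n) M']
    [IsScalarTower k (MatRing k (r + 1) n) M']
    (τ : Representation k (Torus k n) V)
    (N : Submodule (MatRing k r n) (MatRing k r n ⊗[k] V))
    (σ' : Representation k (GrpG k (r + 1) n) M') : Prop :=
  ∃ ψ : MatRing k (r + 1) n ⊗[k] V →ₗ[MatRing k (r + 1) n] M',
    IsEquivariantPresentation τ σ' ψ ∧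
    LinearMap.ker ψ = extendSubmodule τ N ⊔ minorIdeal k (r + 1) n • ⊤

/-! ### Hilbert series and `K`-polynomials -/

/-- The graded piece `M_(a, b)`: the vectors of `GL_r`-weight `-a` and `T`-weight `b`. -/
def gradedPiece {M : Type*} [AddCommGroup M] [Module k M] (σ : Representation k (GrpG k r n) M)
    (w : (Fin r → ℤ) × (Fin n → ℤ)) : Submodule k M where
  carrier := {x | ∀ (d : Fin r → kˣ) (t : Torus k n), σ (diagGL d, t) x =
    (((∏ i, d i ^ (-w.1 i)) * ∏ j, t j ^ w.2 j : kˣ) : k) • x}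
  add_mem' hx hy d t := by rw [map_add, hx d t, hy d t, smul_add]
  zero_mem' d t := by rw [map_zero, smul_zero]
  smul_mem' c x hx d t := by rw [map_smul, hx d t, smul_comm]

/-- `ℤ[u_1^{±1}, …, u_r^{±1}, t_1^{±1}, …, t_n^{±1}]`. -/
abbrev LaurentRing (r n : ℕ) : Type := AddMonoidAlgebra ℤ ((Fin r → ℤ) × (Fin n → ℤ))

/-- `∏_{i, j} (1 - u_i t_j)`. -/
def hilbDenom (r n : ℕ) : LaurentRing r n :=
  ∏ i : Fin r, ∏ j : Fin n, (1 - AddMonoidAlgebra.single (Pi.single i 1, Pi.single j 1) 1)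

/-- `K` is the `K`-polynomial of `M`: the graded pieces of `M` are finite dimensional, and
`Hilb(M) * ∏_{i, j} (1 - u_i t_j) = K`, compared coefficient by coefficient, where
`Hilb(M) = ∑ dim M_(a, b) u^a t^b`. -/
def IsKPolynomial {M : Type*} [AddCommGroup M] [Module k M]
    (σ : Representation k (GrpG k r n) M) (K : LaurentRing r n) : Prop :=
  (∀ w, FiniteDimensional k (gradedPiece σ w)) ∧
  ∀ w, K.coeff w = (hilbDenom r n).coeff.sum fun d c =>
    c * (Module.finrank k (gradedPiece σ (w - d)) : ℤ)

theorem IsKPolynomial.unique {M : Type*} [AddCommGroup M] [Module k M]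
    {σ : Representation k (GrpG k r n) M} {K K' : LaurentRing r n}
    (h : IsKPolynomial σ K) (h' : IsKPolynomial σ K') : K = K' := by
  ext w
  rw [h.2 w, h'.2 w]

/-- The inclusion of `ℤ[u, t^{±1}]` in `ℤ[u^{±1}, t^{±1}]`. -/
def toLaurent (r n : ℕ) : MvPolynomial (Fin r) (TRing n) →+* LaurentRing r n :=
  MvPolynomial.eval₂Hom
    (AddMonoidAlgebra.mapDomainRingHom ℤ (AddMonoidHom.inr (Fin r → ℤ) (Fin n → ℤ)))
    fun i => AddMonoidAlgebra.single (Pi.single i 1, 0) 1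

/-! ### Stable closed subsets of the space of matrices -/

/-- The action of `g = (g, t)` on `𝔸^{r × n} = Spec R_r`, given on `k`-points by `v ↦ g v t⁻¹`. -/
def specAct (g : GrpG k r n) : PrimeSpectrum (MatRing k r n) → PrimeSpectrum (MatRing k r n) :=
  PrimeSpectrum.comap (coordAct g⁻¹ : MatRing k r n →+* MatRing k r n)

/-- `X ⊆ 𝔸^{r × n}` is `G_r`-stable. -/
def IsStableSet (X : Set (PrimeSpectrum (MatRing k r n))) : Prop :=
  ∀ (g : GrpG k r n), ∀ x ∈ X, specAct g x ∈ X

theorem coordAct_mem_vanishingIdeal {X : Set (PrimeSpectrum (MatRing k r n))}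
    (hX : IsStableSet X) (g : GrpG k r n) {f : MatRing k r n}
    (hf : f ∈ PrimeSpectrum.vanishingIdeal X) : coordAct g f ∈ PrimeSpectrum.vanishingIdeal X := by
  rw [PrimeSpectrum.mem_vanishingIdeal] at hf ⊢
  intro x hx
  have h := hf _ (hX g⁻¹ x hx)
  rw [specAct, inv_inv] at h
  exact h

/-- The coordinate ring of the `G_r`-stable closed set `X` (with its reduced structure), as a
representation of `G_r`. -/
def coordRep {X : Set (PrimeSpectrum (MatRing k r n))} (hX : IsStableSet X) :
    Representation k (GrpG k r n) (MatRing k r n ⧸ PrimeSpectrum.vanishingIdeal X) where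
  toFun g := (Ideal.quotientMapₐ (PrimeSpectrum.vanishingIdeal X) (coordAct g)
    fun _ hf => coordAct_mem_vanishingIdeal hX g hf).toLinearMap
  map_one' := LinearMap.ext fun x => by
    obtain ⟨f, rfl⟩ := Ideal.Quotient.mk_surjective x
    exact congrArg (Ideal.Quotient.mk _) (DFunLike.congr_fun coordAct_one f)
  map_mul' g h := LinearMap.ext fun x => by
    obtain ⟨f, rfl⟩ := Ideal.Quotient.mk_surjective x
    exact congrArg (Ideal.Quotient.mk _) (DFunLike.congr_fun (coordAct_mul g h) f)

/-- The closed embedding `𝔸^{r × n} ⊂ 𝔸^{(r + 1) × n}` adding a last row of zeros, on coordinate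
rings. -/
def zeroRow : MatRing k (r + 1) n →ₐ[k] MatRing k r n :=
  MvPolynomial.aeval fun p =>
    Fin.lastCases (motive := fun _ => MatRing k r n) 0 (fun i => MvPolynomial.X (i, p.2)) p.1

/-- `ρ(X)`, the closure of `GL_{r + 1}(k) X` in `𝔸^{(r + 1) × n}`. -/
def orbitClosure (X : Set (PrimeSpectrum (MatRing k r n))) :
    Set (PrimeSpectrum (MatRing k (r + 1) n)) :=
  closure (⋃ g : Matrix.GeneralLinearGroup (Fin (r + 1)) k,
    specAct (g, (1 : Torus k n)) ''
      (PrimeSpectrum.comap (zeroRow : MatRing k (r + 1) n →ₐ[k] MatRing k r n).toRingHom '' X))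

theorem specAct_mul (g h : GrpG k r n) (x : PrimeSpectrum (MatRing k r n)) :
    specAct (g * h) x = specAct g (specAct h x) := by
  refine PrimeSpectrum.ext (Ideal.ext fun f => ?_)
  change coordAct (g * h)⁻¹ f ∈ x.asIdeal ↔ coordAct h⁻¹ (coordAct g⁻¹ f) ∈ x.asIdeal
  rw [mul_inv_rev, coordAct_mul, AlgHom.comp_apply]

theorem zeroRow_coordAct (t : Torus k n) (f : MatRing k (r + 1) n) :
    zeroRow (coordAct ((1, t) : GrpG k (r + 1) n) f) =
      coordAct ((1, t) : GrpG k r n) (zeroRow f) := by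
  have h : (zeroRow : MatRing k (r + 1) n →ₐ[k] MatRing k r n).comp
      (coordAct ((1, t) : GrpG k (r + 1) n)) =
      (coordAct ((1, t) : GrpG k r n)).comp zeroRow := by
    refine MvPolynomial.algHom_ext fun p => ?_
    obtain ⟨i, j⟩ := p
    refine Fin.lastCases ?_ (fun i => ?_) i
    · simp [coordAct, zeroRow, Matrix.one_apply, Fin.sum_univ_castSucc,
        (Fin.castSucc_lt_last _).ne']
    · simp [coordAct, zeroRow, Matrix.one_apply, Fin.sum_univ_castSucc,
        (Fin.castSucc_lt_last _).ne]
  exact DFunLike.congr_fun h f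

theorem isStableSet_orbitClosure {X : Set (PrimeSpectrum (MatRing k r n))}
    (hX : IsStableSet X) : IsStableSet (orbitClosure X) := by
  intro g x hx
  have hcont : Continuous (specAct g) := PrimeSpectrum.continuous_comap _
  refine map_mem_closure hcont hx ?_
  intro y hy
  obtain ⟨h, z, ⟨p, hp, rfl⟩, rfl⟩ := by simpa only [Set.mem_iUnion] using hy
  refine Set.mem_iUnion.2 ⟨g.1 * h, _, ⟨specAct (1, g.2) p, hX _ _ hp, rfl⟩, ?_⟩
  have hz : PrimeSpectrum.comap (zeroRow : MatRing k (r + 1) n →ₐ[k] MatRing k r n).toRingHom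
      (specAct (1, g.2) p) = specAct (1, g.2)
        (PrimeSpectrum.comap (zeroRow : MatRing k (r + 1) n →ₐ[k] MatRing k r n).toRingHom p) := by
    refine PrimeSpectrum.ext (Ideal.ext fun f => ?_)
    have := zeroRow_coordAct (r := r) (g.2)⁻¹ f
    change coordAct ((1, g.2)⁻¹ : GrpG k r n) (zeroRow f) ∈ p.asIdeal ↔
      zeroRow (coordAct ((1, g.2)⁻¹ : GrpG k (r + 1) n) f) ∈ p.asIdeal
    rw [Prod.inv_mk, inv_one, Prod.inv_mk, inv_one, this]
  rw [hz, ← specAct_mul, ← specAct_mul]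
  congr 1
  ext1 <;> simp

end Modules

end RowStabilization

end

open scoped TensorProduct
open RowStabilization

/-!
Let `M = (R_r ⊗ V) / N`, and let `Q` be the kernel `N_{r+1} + J_{r+1} ⊗ V` of its stabilization
`M'`. The Hilbert functions of `M` and `M'` are compared one `T`-weight at a time.

* `Q` is the set `orbitKernel τ N` of the vectors all of whose translates by `GL_{r+1}` restrict to
  elements of `N` on the matrices with last row zero (`extendSubmodule_sup_eq_orbitKernel`). Hence
  in the degrees `(a, b)` with `a_i = 0` for some `i`, the module `M'` is `M` with the row `i`
  inserted (`hilb_orbitKernel_insRow`).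
* `M'` is killed by the maximal minors. By Capelli's identity (`capelli_polarEnd_mem`) the Capelli
  element acts on it by zero. It acts on a highest weight vector of weight `λ` by
  `∏ (λ_i + r - i)`, `0 ≤ i ≤ r`, so only highest weights with `λ_r = 0` occur: the product of the
  Weyl denominator `a_δ` with the character of `M'` has no monomial with all exponents positive
  (`exists_character`).
* So every monomial of that product has a zero exponent, and in those degrees only the terms of
  `a_δ` with the same zero exponent contribute. Since `a_δ` restricted to `u_i = 0` is, up to sign,
  the product of the remaining variables with the Weyl denominator in them, the product is
  determined by the Hilbert function of `M` (`conv_alternant_eq_sum`). Laplace expansion along the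
  last column shows that `ρ` satisfies the same formula (`alternant_mul_rho`), the factors
  `∏_j (1 - u_i t_j)` being the quotients of the denominators of the Hilbert series of `R_{r+1}`
  and `R_r` (`exists_toLaurent_rho`).

That the `K`-polynomials exist is the theorem of Hilbert and Serre (`finite_support_conv`). The
first point also follows from Capelli's identity: `Q` is clearly contained in `orbitKernel τ N`,
both have the same vectors of degree zero in the last row, and a nonzero module killed by the
Capelli element has a nonzero vector of degree zero in the last row (`le_of_last_eq_zero`).

Mathlib has no complete reducibility for representations of `gl_m`. It is avoided as follows. A
`GL_m`-stable subspace is stable under the polarization operators `∑_p x_ip ∂/∂x_jp`, since all but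
finitely many of the matrices `A + s` are invertible (`IsGStable.matAct_mem`,
`IsGStable.polarEnd_mem`); so the quotients of fixed `T`-weight carry operators satisfying the
relations of `gl_m` (`GLModule`). Multiplication of characters by `a_δ` turns the Casimir element
into `∑ (u_i ∂/∂u_i)²` up to lower order terms (`GLModule.radial_casimir`), just by
`tr (x y) = tr (y x)`. Splitting the module by Fitting idempotents of the Casimir element, its
eigenvalue forces the exponents in `a_δ ch` to be of the form `λ + δ`, up to permutation, for
highest weights `λ` (`GLModule.coeff_alternant_mul_trSeries`).

For a closed set `X`, the ideal of the closure of `GL_{r+1} X` is by definition of the form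
`orbitKernel` (`mem_vanishingIdeal_orbitClosure`), so that its coordinate ring is a stabilization of
that of `X`, with `V = k`.
-/

open scoped TensorProduct

noncomputable section

namespace RowStabilization

/-! ### The Capelli element -/

section Capelli

variable {A : Type*} [Ring A] {m : ℕ}

/-- The product over a list of columns `c` of the entries `E (σ c) c`, with the diagonal entries
shifted by the number of columns that follow; the factors are in the order of the list. -/
def capelliProd (E : Fin m → Fin m → A) (σ : Equiv.Perm (Fin m)) : List (Fin m) → A
  | [] => 1
  | c :: L => (E (σ c) c + if σ c = c then (L.length : A) else 0) * capelliProd E σ L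

/-- The Capelli element: the column determinant of the matrix `E i j + (m - 1 - j) δ_ij`
(with indices starting at `0`). -/
def capelli (E : Fin m → Fin m → A) : A :=
  ∑ σ : Equiv.Perm (Fin m), (Equiv.Perm.sign σ : ℤ) • capelliProd E σ (List.finRange m)

theorem capelliProd_map {B : Type*} [Ring B] (f : A →+* B) (E : Fin m → Fin m → A)
    (σ : Equiv.Perm (Fin m)) (L : List (Fin m)) :
    f (capelliProd E σ L) = capelliProd (fun i j => f (E i j)) σ L := by
  induction L with
  | nil => simp [capelliProd]
  | cons c L ih =>
    simp only [capelliProd, map_mul, map_add, ih]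
    congr 2
    split_ifs <;> simp

theorem capelli_map {B : Type*} [Ring B] (f : A →+* B) (E : Fin m → Fin m → A) :
    f (capelli E) = capelli (fun i j => f (E i j)) := by
  simp [capelli, capelliProd_map]

theorem stair_eq_card_Ioi (c : Fin m) : stair m c = (Finset.Ioi c).card := by
  simp [stair]

/-- On a highest weight vector `y`, a partial product over the last columns vanishes unless `σ`
fixes these columns: for the last column `c` that is not fixed, `σ c < c`, so its factor kills `y`.
-/
theorem capelliProd_mul_of_highest (E : Fin m → Fin m → A) (y : A) (a : Fin m → ℕ)
    (hdiag : ∀ i, E i i * y = (a i : A) * y) (hraise : ∀ i j, i < j → E i j * y = 0)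
    (σ : Equiv.Perm (Fin m)) (L : List (Fin m)) (hL : L.Pairwise (· < ·))
    (hup : ∀ c ∈ L, ∀ l, c < l → l ∈ L) :
    capelliProd E σ L * y =
      if ∀ c ∈ L, σ c = c then ((L.map fun c => a c + stair m c).prod : A) * y else 0 := by
  induction L with
  | nil => simp [capelliProd]
  | cons c L ih =>
    rw [List.pairwise_cons] at hL
    have hup' : ∀ c' ∈ L, ∀ l, c' < l → l ∈ L := by
      intro c' hc' l hl
      have := hup c' (List.mem_cons_of_mem _ hc') l hl
      rcases List.mem_cons.1 this with h | h
      · exact absurd (hL.1 c' hc') (by rw [← h]; exact hl.not_gt)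
      · exact h
    have hlen : L.length = stair m c := by
      rw [stair_eq_card_Ioi, ← List.toFinset_card_of_nodup
        (hL.2.imp fun h => h.ne : L.Nodup)]
      congr 1
      ext l
      simp only [List.mem_toFinset, Finset.mem_Ioi]
      refine ⟨hL.1 l, fun h => ?_⟩
      rcases List.mem_cons.1 (hup c List.mem_cons_self l h) with h' | h'
      · exact absurd h (by rw [h']; exact lt_irrefl _)
      · exact h'
    rw [capelliProd, mul_assoc, ih hL.2 hup']
    by_cases hfix : ∀ c ∈ L, σ c = c
    · rw [if_pos hfix]
      have hcast : ((L.map fun c => a c + stair m c).prod : ℕ) * (y : A) =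
          y * ((L.map fun c => a c + stair m c).prod : ℕ) := (Nat.cast_commute _ y).eq
      by_cases hc : σ c = c
      · rw [if_pos hc, if_pos (by simpa [hc] using hfix), hc, hlen, hcast, ← mul_assoc, add_mul,
          hdiag, List.map_cons, List.prod_cons, Nat.cast_mul, Nat.cast_add, ← add_mul, mul_assoc,
          ← hcast, ← mul_assoc]
      · rw [if_neg hc, add_zero, if_neg (by simp [hc]), hcast, ← mul_assoc, hraise, zero_mul]
        rcases lt_trichotomy (σ c) c with h | h | h
        · exact h
        · exact absurd h hc
        · have h1 : σ c ∈ L := by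
            rcases List.mem_cons.1 (hup c List.mem_cons_self _ h) with h' | h'
            · exact absurd h' hc
            · exact h'
          exact absurd (σ.injective (hfix _ h1)) hc
    · rw [if_neg hfix, mul_zero, if_neg]
      intro h
      exact hfix fun c' hc' => h c' (List.mem_cons_of_mem _ hc')

/-- The Capelli element acts on a highest weight vector of weight `a` by
`∏ (a_i + m - 1 - i)`. -/
theorem capelli_mul_of_highest (E : Fin m → Fin m → A) (y : A) (a : Fin m → ℕ)
    (hdiag : ∀ i, E i i * y = (a i : A) * y) (hraise : ∀ i j, i < j → E i j * y = 0) :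
    capelli E * y = ((∏ i, (a i + stair m i) : ℕ) : A) * y := by
  rw [capelli, Finset.sum_mul, Finset.sum_eq_single 1]
  · rw [smul_mul_assoc, capelliProd_mul_of_highest E y a hdiag hraise]
    · simp [List.prod_ofFn, ← List.ofFn_eq_map]
    · exact List.pairwise_lt_finRange m
    · simp
  · intro σ _ hσ
    rw [smul_mul_assoc, capelliProd_mul_of_highest E y a hdiag hraise, if_neg, smul_zero]
    · intro h
      exact hσ (Equiv.ext fun c => h c (List.mem_finRange c))
    · exact List.pairwise_lt_finRange m
    · simp
  · simp

end Capelli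

/-! ### Polynomial `gl_m`-modules -/

section GLModule

/-- A polynomial representation of `gl_m` on `W` with finitely many weights, together with the
action of the permutation matrices: the operators `E i j` of the matrix units, the projections
`pr a` to the weight spaces (with `weights` a finite set containing all weights), and the operators
`perm w`. -/
structure GLModule (k : Type*) [Field k] (W : Type*) [AddCommGroup W] [Module k W] (m : ℕ) where
  /-- The action of the matrix units. -/
  E : Fin m → Fin m → Module.End k W
  /-- The projections to the weight spaces. -/
  pr : (Fin m →₀ ℕ) → Module.End k W
  /-- A finite set that contains all weights. -/
  weights : Finset (Fin m →₀ ℕ)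
  /-- The action of the permutation matrices. -/
  perm : Equiv.Perm (Fin m) → Module.End k W
  comm : ∀ i j l q, E i j * E l q - E l q * E i j =
    (if j = l then E i q else 0) - (if q = i then E l j else 0)
  pr_mul_self : ∀ a, pr a * pr a = pr a
  pr_mul_of_ne : ∀ a b, a ≠ b → pr a * pr b = 0
  sum_pr : ∑ a ∈ weights, pr a = 1
  E_mul_pr : ∀ i a, E i i * pr a = (a i : k) • pr a
  perm_mul_E : ∀ w i j, perm w * E i j = E (w i) (w j) * perm w
  perm_mul_inv : ∀ w, perm w * perm w⁻¹ = 1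

namespace GLModule

variable {k : Type*} [Field k] {W : Type*} [AddCommGroup W] [Module k W] {m : ℕ}
  (D : GLModule k W m)

theorem pr_eq_zero {a : Fin m →₀ ℕ} (ha : a ∉ D.weights) : D.pr a = 0 := by
  rw [← mul_one (D.pr a), ← D.sum_pr, Finset.mul_sum]
  exact Finset.sum_eq_zero fun b hb => D.pr_mul_of_ne a b fun h => ha (h ▸ hb)

theorem eq_sum_pr_mul (X : Module.End k W) : X = ∑ a ∈ D.weights, D.pr a * X := by
  rw [← Finset.sum_mul, D.sum_pr, one_mul]

theorem eq_sum_mul_pr (X : Module.End k W) : X = ∑ a ∈ D.weights, X * D.pr a := by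
  rw [← Finset.mul_sum, D.sum_pr, mul_one]

theorem pr_mul_E (i : Fin m) (a : Fin m →₀ ℕ) : D.pr a * D.E i i = (a i : k) • D.pr a := by
  classical
  rw [D.eq_sum_mul_pr (D.pr a * D.E i i)]
  simp only [mul_assoc, D.E_mul_pr, mul_smul_comm]
  by_cases ha : a ∈ D.weights
  · rw [Finset.sum_eq_single a]
    · rw [D.pr_mul_self]
    · intro b _ hb
      rw [D.pr_mul_of_ne _ _ hb.symm, smul_zero]
    · exact fun h => absurd ha h
  · simp [D.pr_eq_zero ha]

/-- An operator of weight `c` shifts weights by `c`. -/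
theorem pr_mul_mul_pr {X : Module.End k W} {i : Fin m} {c : k}
    (hX : D.E i i * X - X * D.E i i = c • X) {a b : Fin m →₀ ℕ} (h : (b i : k) ≠ a i + c) :
    D.pr b * X * D.pr a = 0 := by
  have h1 : (D.pr b * D.E i i) * X * D.pr a - D.pr b * X * (D.E i i * D.pr a) =
      c • (D.pr b * X * D.pr a) := by
    rw [← smul_mul_assoc, ← mul_smul_comm, ← hX]
    noncomm_ring
  rw [D.pr_mul_E, D.E_mul_pr, mul_smul_comm, smul_mul_assoc, smul_mul_assoc, ← sub_smul] at h1
  have h2 : ((b i : k) - a i - c) • (D.pr b * X * D.pr a) = 0 := by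
    rw [sub_smul, h1, sub_self]
  rcases smul_eq_zero.1 h2 with h3 | h3
  · exact absurd (by linear_combination h3) h
  · exact h3

theorem mul_pr_eq {X : Module.End k W} {a b : Fin m →₀ ℕ}
    (h : ∀ c, c ≠ b → D.pr c * X * D.pr a = 0) : X * D.pr a = D.pr b * X * D.pr a := by
  classical
  rw [D.eq_sum_pr_mul (X * D.pr a)]
  by_cases hb : b ∈ D.weights
  · rw [Finset.sum_eq_single b, mul_assoc]
    · intro c _ hc
      rw [← mul_assoc, h c hc]
    · exact fun h => absurd hb h
  · rw [D.pr_eq_zero hb, zero_mul, zero_mul]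
    refine Finset.sum_eq_zero fun c hc => ?_
    rw [← mul_assoc]
    exact h c fun h' => hb (h' ▸ hc)

theorem pr_mul_eq {X : Module.End k W} {a b : Fin m →₀ ℕ}
    (h : ∀ c, c ≠ a → D.pr b * X * D.pr c = 0) : D.pr b * X = D.pr b * X * D.pr a := by
  classical
  conv_lhs => rw [D.eq_sum_mul_pr (D.pr b * X)]
  by_cases ha : a ∈ D.weights
  · rw [Finset.sum_eq_single a]
    · exact fun c _ hc => h c hc
    · exact fun h => absurd ha h
  · rw [D.pr_eq_zero ha, mul_zero]
    exact Finset.sum_eq_zero fun c hc => h c fun h' => ha (h' ▸ hc)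

theorem pr_comm_of_comm [CharZero k] {X : Module.End k W} (hX : ∀ i, D.E i i * X = X * D.E i i)
    (a : Fin m →₀ ℕ) : D.pr a * X = X * D.pr a := by
  classical
  have h : ∀ b c, b ≠ c → D.pr b * X * D.pr c = 0 := by
    intro b c hbc
    obtain ⟨i, hi⟩ : ∃ i, b i ≠ c i := by
      by_contra! h; exact hbc (Finsupp.ext h)
    refine D.pr_mul_mul_pr (i := i) (c := 0) (by rw [hX, sub_self, zero_smul]) ?_
    rw [add_zero]
    exact_mod_cast hi
  rw [D.mul_pr_eq fun c hc => h c a hc, ← D.pr_mul_eq fun c hc => h a c hc.symm]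

theorem E_diag_mul_E (i j l : Fin m) : D.E l l * D.E i j - D.E i j * D.E l l =
    (((if l = i then 1 else 0) - (if j = l then 1 else 0) : ℤ) : k) • D.E i j := by
  rw [D.comm]
  split_ifs with h1 h2 h2 <;> simp_all

theorem pr_mul_E_mul_pr [CharZero k] {i j : Fin m} {a b : Fin m →₀ ℕ}
    (h : b + Finsupp.single j 1 ≠ a + Finsupp.single i 1) : D.pr b * D.E i j * D.pr a = 0 := by
  obtain ⟨l, hl⟩ : ∃ l, (b + Finsupp.single j 1 : Fin m →₀ ℕ) l ≠
      (a + Finsupp.single i 1 : Fin m →₀ ℕ) l := by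
    by_contra! h'; exact h (Finsupp.ext h')
  refine D.pr_mul_mul_pr (D.E_diag_mul_E i j l) ?_
  intro h2
  have h3 : (b l : ℤ) = a l + ((if l = i then 1 else 0) - (if j = l then 1 else 0)) := by
    exact_mod_cast h2
  apply hl
  simp only [Finsupp.add_apply, Finsupp.single_apply]
  split_ifs at h3 ⊢ <;> omega

theorem E_mul_pr_comm [CharZero k] {i j : Fin m} {a b : Fin m →₀ ℕ}
    (h : b + Finsupp.single j 1 = a + Finsupp.single i 1) :
    D.E i j * D.pr a = D.pr b * D.E i j := by
  rw [D.mul_pr_eq (b := b) fun c hc => D.pr_mul_E_mul_pr fun h' =>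
      hc (add_right_cancel (h'.trans h.symm)), ← D.pr_mul_eq fun c hc =>
      D.pr_mul_E_mul_pr fun h' => hc (add_right_cancel (h'.symm.trans h))]

theorem E_mul_pr_eq_zero [CharZero k] {i j : Fin m} (hij : i ≠ j) {a : Fin m →₀ ℕ} (h : a j = 0) :
    D.E i j * D.pr a = 0 := by
  rw [D.eq_sum_pr_mul (D.E i j * D.pr a)]
  refine Finset.sum_eq_zero fun b _ => ?_
  rw [← mul_assoc]
  refine D.pr_mul_E_mul_pr fun h' => ?_
  have := DFunLike.congr_fun h' j
  simp [h, hij] at this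

theorem perm_mul_pr [CharZero k] (w : Equiv.Perm (Fin m)) (a : Fin m →₀ ℕ) :
    D.perm w * D.pr a = D.pr (a.mapDomain w) * D.perm w := by
  classical
  have key : ∀ b c, b ≠ Finsupp.mapDomain w c → D.pr b * D.perm w * D.pr c = 0 := by
    intro b c hbc
    obtain ⟨i, hi⟩ : ∃ i, b (w i) ≠ c i := by
      by_contra! h
      refine hbc (Finsupp.ext fun i => ?_)
      obtain ⟨i, rfl⟩ := w.surjective i
      rw [h, Finsupp.mapDomain_apply w.injective]
    have h1 : (b (w i) : k) • (D.pr b * D.perm w * D.pr c) =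
        (c i : k) • (D.pr b * D.perm w * D.pr c) := by
      rw [← smul_mul_assoc, ← smul_mul_assoc, ← D.pr_mul_E, mul_assoc _ _ (D.perm w),
        ← D.perm_mul_E, ← mul_assoc, mul_assoc _ (D.E i i), D.E_mul_pr, mul_smul_comm]
    rw [← sub_eq_zero, ← sub_smul, smul_eq_zero, sub_eq_zero] at h1
    rcases h1 with h1 | h1
    · exact absurd (by exact_mod_cast h1) hi
    · exact h1
  rw [D.mul_pr_eq fun c hc => key c a hc, ← D.pr_mul_eq fun c hc =>
    key _ _ fun h' => hc ((Finsupp.mapDomain_injective w.injective) h').symm]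

/-- The Casimir element. -/
def casimir : Module.End k W := ∑ i, ∑ j, D.E i j * D.E j i

theorem casimir_mul_E (l q : Fin m) : D.casimir * D.E l q = D.E l q * D.casimir := by
  rw [← sub_eq_zero, casimir]
  simp only [Finset.sum_mul, Finset.mul_sum, ← Finset.sum_sub_distrib]
  have h : ∀ i j, D.E i j * D.E j i * D.E l q - D.E l q * (D.E i j * D.E j i) =
      ((if i = l then D.E i j * D.E j q else 0) - (if q = j then D.E i j * D.E l i else 0)) +
      ((if j = l then D.E i q * D.E j i else 0) - (if q = i then D.E l j * D.E j i else 0)) := by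
    intro i j
    have e : D.E i j * D.E j i * D.E l q - D.E l q * (D.E i j * D.E j i) =
      D.E i j * (D.E j i * D.E l q - D.E l q * D.E j i) +
        (D.E i j * D.E l q - D.E l q * D.E i j) * D.E j i := by noncomm_ring
    rw [e, D.comm, D.comm]
    simp only [mul_sub, sub_mul, mul_ite, ite_mul, mul_zero, zero_mul]
  simp only [h, Finset.sum_add_distrib, Finset.sum_sub_distrib]
  rw [Finset.sum_comm (f := fun i j => if i = l then D.E i j * D.E j q else 0),
    Finset.sum_comm (f := fun i j => if q = i then D.E l j * D.E j i else 0)]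
  simp only [Finset.sum_ite_eq, Finset.sum_ite_eq', Finset.mem_univ, if_true]
  abel

theorem casimir_mul_perm (w : Equiv.Perm (Fin m)) :
    D.casimir * D.perm w = D.perm w * D.casimir := by
  simp only [casimir, Finset.mul_sum, Finset.sum_mul]
  rw [← Equiv.sum_comp w]
  refine Finset.sum_congr rfl fun i _ => ?_
  rw [← Equiv.sum_comp w]
  refine Finset.sum_congr rfl fun j _ => ?_
  rw [mul_assoc, ← D.perm_mul_E, ← mul_assoc, ← D.perm_mul_E, mul_assoc]

end GLModule

end GLModule

/-! ### Characters -/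

section Euler

variable {k : Type*} [Field k] {m : ℕ}

theorem coeff_X_mul_pderiv (i : Fin m) (f : MvPolynomial (Fin m) k) (a : Fin m →₀ ℕ) :
    (MvPolynomial.X i * MvPolynomial.pderiv i f).coeff a = a i * f.coeff a := by
  classical
  induction f using MvPolynomial.induction_on' with
  | monomial b c =>
    rw [MvPolynomial.X_mul_pderiv_monomial, MvPolynomial.coeff_smul, MvPolynomial.coeff_monomial]
    split_ifs with h
    · rw [h, nsmul_eq_mul]
    · simp
  | add f g hf hg =>
    rw [map_add, mul_add, MvPolynomial.coeff_add, hf, hg, MvPolynomial.coeff_add, mul_add]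

/-- The product `∏_{i < j} (u_i - u_j)`. -/
theorem alternant_stair_eq_prod (A : Type*) [CommRing A] (m : ℕ) :
    alternant A (stair m) = ∏ p : Fin m × Fin m with p.1 < p.2,
      (MvPolynomial.X p.1 - MvPolynomial.X p.2 : MvPolynomial (Fin m) A) := by
  have h := Matrix.det_projVandermonde (n := m) (fun _ => (1 : MvPolynomial (Fin m) A))
    (fun i => MvPolynomial.X i)
  have h2 : Matrix.projVandermonde (fun _ => (1 : MvPolynomial (Fin m) A))
      (fun i => MvPolynomial.X i) = Matrix.of fun i j =>
        (MvPolynomial.X i : MvPolynomial (Fin m) A) ^ stair m j := by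
    ext1 i j
    rw [Matrix.projVandermonde_apply, one_pow, one_mul, Matrix.of_apply]
    congr 1
    simp [stair, Fin.val_rev]
    omega
  rw [alternant, ← h2, h, Finset.prod_filter, Fintype.prod_prod_type]
  refine Finset.prod_congr rfl fun i _ => ?_
  rw [← Finset.prod_filter]
  refine Finset.prod_congr (by ext; simp) fun j _ => by simp

/-- The Leibniz expansion of an alternant. -/
theorem alternant_eq_sum (A : Type*) [CommRing A] (a : Fin m → ℕ) :
    alternant A a = ∑ w : Equiv.Perm (Fin m), (Equiv.Perm.sign w : ℤ) •
      MvPolynomial.monomial (Finsupp.equivFunOnFinite.symm (a ∘ w)) (1 : A) := by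
  rw [alternant, ← Matrix.det_transpose, Matrix.det_apply]
  refine Finset.sum_congr rfl fun w _ => ?_
  rw [MvPolynomial.monomial_eq, Finsupp.prod_fintype _ _ (by simp)]
  simp [Units.smul_def]

end Euler

namespace GLModule

variable {k : Type*} [Field k] {W : Type*} [AddCommGroup W] [Module k W] {m : ℕ}
  (D : GLModule k W m)

/-- The generating function of the traces of an operator on the weight spaces. -/
def trSeries : Module.End k W →ₗ[k] MvPolynomial (Fin m) k :=
  ∑ a ∈ D.weights, MvPolynomial.monomial a ∘ₗ LinearMap.trace k W ∘ₗ LinearMap.mulRight k (D.pr a)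

theorem coeff_trSeries (X : Module.End k W) (a : Fin m →₀ ℕ) :
    (D.trSeries X).coeff a = LinearMap.trace k W (X * D.pr a) := by
  classical
  simp only [trSeries, LinearMap.sum_apply, LinearMap.comp_apply, LinearMap.mulRight_apply,
    MvPolynomial.coeff_sum, MvPolynomial.coeff_monomial]
  rw [Finset.sum_ite_eq']
  split_ifs with h
  · rfl
  · simp [D.pr_eq_zero h]

theorem trSeries_mul_E_diag (X : Module.End k W) (i : Fin m) :
    D.trSeries (X * D.E i i) = MvPolynomial.X i * MvPolynomial.pderiv i (D.trSeries X) := by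
  ext a
  rw [coeff_X_mul_pderiv, coeff_trSeries, coeff_trSeries, mul_assoc, D.E_mul_pr, mul_smul_comm,
    map_smul, smul_eq_mul]

/-- The relation between the traces of `z E_ij E_ji` and `z E_ji E_ij` that comes from
`tr (x y) = tr (y x)`. -/
theorem X_mul_trSeries [CharZero k] {z : Module.End k W} (hz : ∀ i j, z * D.E i j = D.E i j * z)
    {i j : Fin m} (hij : i ≠ j) :
    MvPolynomial.X j * D.trSeries (z * (D.E i j * D.E j i)) =
      MvPolynomial.X i * D.trSeries (z * (D.E j i * D.E i j)) := by
  classical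
  have key : ∀ i j : Fin m, i ≠ j → ∀ a, a i = 0 →
      (D.trSeries (z * (D.E i j * D.E j i))).coeff a = 0 := by
    intro i j hij a ha
    rw [coeff_trSeries, mul_assoc, mul_assoc, D.E_mul_pr_eq_zero hij.symm ha, mul_zero, mul_zero,
      map_zero]
  ext c
  rw [MvPolynomial.coeff_X_mul', MvPolynomial.coeff_X_mul']
  by_cases hi : i ∈ c.support <;> by_cases hj : j ∈ c.support
  · rw [if_pos hi, if_pos hj, coeff_trSeries, coeff_trSeries]
    have hci : Finsupp.single i 1 ≤ c := by
      rw [Finsupp.single_le_iff]; have := Finsupp.mem_support_iff.1 hi; omega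
    have hcj : Finsupp.single j 1 ≤ c := by
      rw [Finsupp.single_le_iff]; have := Finsupp.mem_support_iff.1 hj; omega
    have h := D.E_mul_pr_comm (i := j) (j := i) (a := c - Finsupp.single j 1)
      (b := c - Finsupp.single i 1) (by rw [tsub_add_cancel_of_le hci, tsub_add_cancel_of_le hcj])
    rw [mul_assoc z, mul_assoc (D.E i j), h, ← mul_assoc (D.E i j), ← mul_assoc z,
      LinearMap.trace_mul_comm]
    congr 1
    rw [← mul_assoc, ← mul_assoc, ← hz, mul_assoc z]
  · rw [if_pos hi, if_neg hj]
    refine (key j i hij.symm _ ?_).symm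
    simpa [hij] using hj
  · rw [if_pos hj, if_neg hi]
    refine key i j hij _ ?_
    simpa [hij.symm] using hi
  · rw [if_neg hi, if_neg hj]

theorem trSeries_sub (z : Module.End k W) {i j : Fin m} :
    D.trSeries (z * (D.E i j * D.E j i)) - D.trSeries (z * (D.E j i * D.E i j)) =
      MvPolynomial.X i * MvPolynomial.pderiv i (D.trSeries z) -
        MvPolynomial.X j * MvPolynomial.pderiv j (D.trSeries z) := by
  rw [← map_sub, ← mul_sub, D.comm, if_pos rfl, if_pos rfl, mul_sub, map_sub, trSeries_mul_E_diag,
    trSeries_mul_E_diag]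

end GLModule

/-! ### The radial part of the Casimir element -/

section Euler

variable {k : Type*} [Field k] {m : ℕ}

/-- If each factor `g p` satisfies `g p * A p = 2 ∑ θ_i (g p) θ_i f`, where `θ_i = u_i ∂/∂u_i`, then
the product satisfies the same relation with the sum of the `A p`. -/
theorem two_mul_sum_euler_prod {I : Type*} (s : Finset I)
    (g A : I → MvPolynomial (Fin m) k) (f : MvPolynomial (Fin m) k)
    (h : ∀ p ∈ s, g p * A p = 2 * ∑ i, (MvPolynomial.X i * MvPolynomial.pderiv i (g p)) *
      (MvPolynomial.X i * MvPolynomial.pderiv i f)) :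
    2 * ∑ i, (MvPolynomial.X i * MvPolynomial.pderiv i (∏ p ∈ s, g p)) *
      (MvPolynomial.X i * MvPolynomial.pderiv i f) = (∏ p ∈ s, g p) * ∑ p ∈ s, A p := by
  classical
  induction s using Finset.induction_on with
  | empty => simp
  | insert p s hp ih =>
    have h1 := h p (Finset.mem_insert_self p s)
    have h2 := ih fun q hq => h q (Finset.mem_insert_of_mem hq)
    rw [Finset.prod_insert hp, Finset.sum_insert hp]
    have h3 : ∀ i, (MvPolynomial.X i * MvPolynomial.pderiv i (g p * ∏ q ∈ s, g q)) *
        (MvPolynomial.X i * MvPolynomial.pderiv i f) =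
        (∏ q ∈ s, g q) * ((MvPolynomial.X i * MvPolynomial.pderiv i (g p)) *
          (MvPolynomial.X i * MvPolynomial.pderiv i f)) +
        g p * ((MvPolynomial.X i * MvPolynomial.pderiv i (∏ q ∈ s, g q)) *
          (MvPolynomial.X i * MvPolynomial.pderiv i f)) := by
      intro i
      rw [Derivation.leibniz, smul_eq_mul, smul_eq_mul]
      ring
    rw [Finset.sum_congr rfl fun i _ => h3 i, Finset.sum_add_distrib, ← Finset.mul_sum,
      ← Finset.mul_sum]
    linear_combination (-(∏ q ∈ s, g q)) * h1 + g p * h2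

theorem sum_euler_X_mul (l : Fin m) (f : Fin m → MvPolynomial (Fin m) k) :
    ∑ i, (MvPolynomial.X i * MvPolynomial.pderiv i (MvPolynomial.X l)) * f i =
      MvPolynomial.X l * f l := by
  rw [Finset.sum_eq_single l]
  · simp
  · intro i _ hi
    simp [MvPolynomial.pderiv_X, hi]
  · simp

theorem exists_perm_of_coeff_alternant (A : Type*) [CommRing A] {a : Fin m → ℕ} {e : Fin m →₀ ℕ}
    (h : (alternant A a).coeff e ≠ 0) : ∃ w : Equiv.Perm (Fin m), ⇑e = a ∘ w := by
  classical
  rw [alternant_eq_sum, MvPolynomial.coeff_sum] at h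
  obtain ⟨w, _, hw⟩ := Finset.exists_ne_zero_of_sum_ne_zero h
  refine ⟨w, ?_⟩
  rw [MvPolynomial.coeff_smul, MvPolynomial.coeff_monomial] at hw
  by_contra hne
  rw [if_neg, smul_zero] at hw
  · exact hw rfl
  · rintro rfl
    exact hne (by ext; simp)

theorem sum_euler_alternant (a : Fin m → ℕ) :
    ∑ i, MvPolynomial.X i * MvPolynomial.pderiv i (alternant k a) =
      ((∑ i, a i : ℕ) : MvPolynomial (Fin m) k) * alternant k a := by
  ext e
  rw [MvPolynomial.coeff_sum, ← MvPolynomial.C_eq_coe_nat, MvPolynomial.coeff_C_mul]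
  simp only [coeff_X_mul_pderiv, ← Finset.sum_mul]
  by_cases h : (alternant k a).coeff e = 0
  · simp [h]
  · obtain ⟨w, hw⟩ := exists_perm_of_coeff_alternant k h
    rw [hw]
    congr 1
    push_cast
    exact Equiv.sum_comp w fun i => (a i : k)

theorem sum_euler_euler_alternant (a : Fin m → ℕ) :
    ∑ i, MvPolynomial.X i * MvPolynomial.pderiv i
      (MvPolynomial.X i * MvPolynomial.pderiv i (alternant k a)) =
      ((∑ i, a i ^ 2 : ℕ) : MvPolynomial (Fin m) k) * alternant k a := by
  ext e
  rw [MvPolynomial.coeff_sum, ← MvPolynomial.C_eq_coe_nat, MvPolynomial.coeff_C_mul]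
  simp only [coeff_X_mul_pderiv, ← Finset.sum_mul, ← mul_assoc]
  by_cases h : (alternant k a).coeff e = 0
  · simp [h]
  · obtain ⟨w, hw⟩ := exists_perm_of_coeff_alternant k h
    rw [hw]
    congr 1
    push_cast
    simp only [← sq]
    exact Equiv.sum_comp w fun i => (a i : k) ^ 2

/-- A sum over unordered pairs of distinct indices. -/
theorem sum_pairs {B : Type*} [AddCommMonoid B] (f : Fin m → Fin m → B) :
    ∑ i, ∑ j, f i j = ∑ i, f i i + ∑ p : Fin m × Fin m with p.1 < p.2,
      (f p.1 p.2 + f p.2 p.1) := by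
  have h1 : ∑ i, f i i = ∑ i, ∑ j, if i = j then f i j else 0 := by simp
  have h2 : ∑ p : Fin m × Fin m with p.1 < p.2, f p.1 p.2 =
      ∑ i, ∑ j, if i < j then f i j else 0 := by
    rw [Finset.sum_filter, Fintype.sum_prod_type]
  have h3 : ∑ p : Fin m × Fin m with p.1 < p.2, f p.2 p.1 =
      ∑ i, ∑ j, if j < i then f i j else 0 := by
    rw [Finset.sum_filter, Fintype.sum_prod_type, Finset.sum_comm]
  rw [Finset.sum_add_distrib, h1, h2, h3, ← Finset.sum_add_distrib, ← Finset.sum_add_distrib]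
  refine Finset.sum_congr rfl fun i _ => ?_
  rw [← Finset.sum_add_distrib, ← Finset.sum_add_distrib]
  refine Finset.sum_congr rfl fun j _ => ?_
  rcases lt_trichotomy i j with h | h | h
  · simp [h, h.ne, h.not_gt]
  · simp [h]
  · simp [h, h.ne', h.not_gt]

end Euler

namespace GLModule

variable {k : Type*} [Field k] {W : Type*} [AddCommGroup W] [Module k W] {m : ℕ}
  (D : GLModule k W m)

/-- The radial part of the Casimir element: after multiplication with the Weyl denominator, the
Casimir element acts on characters as `∑ θ_i ^ 2`, up to lower order terms. -/
theorem radial_casimir [CharZero k] {z : Module.End k W} (hz : ∀ i j, z * D.E i j = D.E i j * z)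
    (e : Fin m →₀ ℕ) :
    (∑ i, (e i : k) ^ 2) * (alternant k (stair m) * D.trSeries z).coeff e =
      (alternant k (stair m) * D.trSeries (z * D.casimir)).coeff e +
      ((m - 1 : k) * (∑ i, (e i : k) - ∑ i, (stair m i : k)) + ∑ i, (stair m i : k) ^ 2) *
        (alternant k (stair m) * D.trSeries z).coeff e := by
  classical
  set f := D.trSeries z with hf
  set G := alternant k (stair m) with hG
  let th : Fin m → MvPolynomial (Fin m) k → MvPolynomial (Fin m) k :=
    fun i g => MvPolynomial.X i * MvPolynomial.pderiv i g
  let T : Fin m → Fin m → MvPolynomial (Fin m) k := fun i j => D.trSeries (z * (D.E i j * D.E j i))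
  have hth : ∀ i g h, th i (g * h) = g * th i h + h * th i g := by
    intro i g h
    simp only [th, Derivation.leibniz, smul_eq_mul]
    ring
  have hthadd : ∀ i g h, th i (g + h) = th i g + th i h := by
    intro i g h
    simp only [th, map_add, mul_add]
  have hGf : 2 * ∑ i, th i G * th i f = G * ∑ p : Fin m × Fin m with p.1 < p.2,
      (T p.1 p.2 + T p.2 p.1 + (th p.1 f + th p.2 f)) := by
    rw [hG, alternant_stair_eq_prod]
    refine two_mul_sum_euler_prod _ _ _ _ fun p hp => ?_
    have hne : p.1 ≠ p.2 := (Finset.mem_filter.1 hp).2.ne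
    simp only [map_sub, mul_sub, sub_mul, Finset.sum_sub_distrib]
    rw [sum_euler_X_mul, sum_euler_X_mul]
    have h1 := D.X_mul_trSeries hz hne
    have h2 := D.trSeries_sub z (i := p.1) (j := p.2)
    rw [← hf] at h2
    linear_combination (MvPolynomial.X p.1 + MvPolynomial.X p.2) * h2 - 2 * h1
  have hcas : D.trSeries (z * D.casimir) = ∑ i, th i (th i f) +
      ∑ p : Fin m × Fin m with p.1 < p.2, (T p.1 p.2 + T p.2 p.1) := by
    have hd : ∀ i, th i (th i f) = T i i := by
      intro i
      simp only [th, T, ← mul_assoc]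
      rw [trSeries_mul_E_diag, trSeries_mul_E_diag]
    simp only [hd]
    rw [← sum_pairs]
    simp only [T, casimir, Finset.mul_sum, map_sum]
  have hdeg : ∑ p : Fin m × Fin m with p.1 < p.2, (th p.1 f + th p.2 f) =
      (m - 1 : MvPolynomial (Fin m) k) * ∑ i, th i f := by
    have h := sum_pairs fun i _ => th i f
    simp only [Finset.sum_const, Finset.card_univ, Fintype.card_fin, nsmul_eq_mul,
      ← Finset.mul_sum] at h
    linear_combination -h
  have hsq : ∑ i, th i (th i (G * f)) = G * ∑ i, th i (th i f) + 2 * ∑ i, th i G * th i f +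
      (∑ i, th i (th i G)) * f := by
    rw [Finset.mul_sum, Finset.mul_sum, Finset.sum_mul, ← Finset.sum_add_distrib,
      ← Finset.sum_add_distrib]
    refine Finset.sum_congr rfl fun i _ => ?_
    rw [hth i G f, hthadd, hth i G, hth i f]
    ring
  have hlin : ∑ i, th i (G * f) = G * ∑ i, th i f + (∑ i, th i G) * f := by
    rw [Finset.mul_sum, Finset.sum_mul, ← Finset.sum_add_distrib]
    refine Finset.sum_congr rfl fun i _ => ?_
    rw [hth]
    ring
  have e1 : ∑ i, th i (th i G) = _ := sum_euler_euler_alternant (k := k) (stair m)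
  have e2 : ∑ i, th i G = _ := sum_euler_alternant (k := k) (stair m)
  rw [← hG] at e1 e2
  have main : ∑ i, th i (th i (G * f)) = G * D.trSeries (z * D.casimir) +
      (((m - 1 : MvPolynomial (Fin m) k)) * (∑ i, th i (G * f) -
        ((∑ i, stair m i : ℕ) : MvPolynomial (Fin m) k) * (G * f)) +
        ((∑ i, stair m i ^ 2 : ℕ) : MvPolynomial (Fin m) k) * (G * f)) := by
    rw [hsq, hGf, hlin, hcas, e1, e2, Finset.sum_add_distrib, hdeg]
    ring
  have := congrArg (MvPolynomial.coeff e) main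
  have hm : ((m : MvPolynomial (Fin m) k) - 1) = MvPolynomial.C ((m : k) - 1) := by simp
  rw [hm] at this
  simp only [MvPolynomial.coeff_add, MvPolynomial.coeff_sum, MvPolynomial.coeff_C_mul, th,
    MvPolynomial.coeff_sub, coeff_X_mul_pderiv, ← MvPolynomial.C_eq_coe_nat] at this
  simp only [← mul_assoc, ← sq, ← Finset.sum_mul] at this
  rw [this]
  push_cast
  ring

end GLModule

/-! ### Modules killed by the Capelli element -/

theorem sum_eq_add_add_sum {m : ℕ} {B : Type*} [AddCommMonoid B] {i j : Fin m} (hij : i ≠ j)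
    (F : Fin m → B) :
    ∑ l, F l = F i + (F j + ∑ l ∈ (Finset.univ.erase i).erase j, F l) := by
  rw [Finset.add_sum_erase _ _ (by simp [hij.symm]), Finset.add_sum_erase _ _ (Finset.mem_univ i)]

/-- The number `|a + δ|² - (m - 1) |a|`, where `δ = stair m`: up to the constant `|δ|²`, the
eigenvalue of the Casimir element on highest weight vectors of weight `a`. -/
def casimirForm {m : ℕ} (a : Fin m →₀ ℕ) : ℤ :=
  ∑ i, ((a i : ℤ) + stair m i) ^ 2 - (m - 1) * ∑ i, (a i : ℤ)

/-- The Fitting idempotent of an endomorphism `f`: a polynomial in `f` that projects to the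
generalized kernel. -/
theorem exists_fitting_idempotent {k : Type*} [Field k] {W : Type*} [AddCommGroup W] [Module k W]
    [FiniteDimensional k W] (f : Module.End k W) :
    ∃ z : Module.End k W, z * z = z ∧ IsNilpotent (f * z) ∧
      (∀ X : Module.End k W, X * f = f * X → X * z = z * X) ∧
      ∀ Y : Module.End k W, f * Y = 0 → z * Y = Y := by
  have hp : minpoly k f ≠ 0 := minpoly.ne_zero (Algebra.IsIntegral.isIntegral f)
  obtain ⟨g, hg, hnd⟩ := Polynomial.exists_eq_pow_rootMultiplicity_mul_and_not_dvd
    (minpoly k f) hp 0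
  rw [map_zero, sub_zero] at hg hnd
  set N := (minpoly k f).rootMultiplicity 0
  obtain ⟨u, v, huv⟩ : IsCoprime (Polynomial.X ^ (N + 1)) g :=
    ((Polynomial.irreducible_X.coprime_iff_not_dvd).2 hnd).pow_left
  have hcomm : ∀ p : Polynomial k, ∀ X : Module.End k W, X * f = f * X →
      X * Polynomial.aeval f p = Polynomial.aeval f p * X := by
    intro p X hX
    induction p using Polynomial.induction_on' with
    | add p q hp hq => rw [map_add, mul_add, add_mul, hp, hq]
    | monomial n a =>
      rw [Polynomial.aeval_monomial]
      exact (Algebra.commute_algebraMap_right a X).mul_right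
        ((show Commute X f from hX).pow_right n)
  have h0 : Polynomial.aeval f (Polynomial.X ^ (N + 1) * g) = 0 := by
    rw [pow_succ', mul_assoc, ← hg, map_mul, minpoly.aeval, mul_zero]
  have h1 : Polynomial.aeval f (u * Polynomial.X ^ (N + 1)) = 1 - Polynomial.aeval f (v * g) := by
    rw [eq_sub_iff_add_eq, ← map_add, huv, map_one]
  refine ⟨Polynomial.aeval f (v * g), ?_, ⟨N + 1, ?_⟩, fun X hX => hcomm _ X hX, fun Y hY => ?_⟩
  · have h2 : Polynomial.aeval f (v * g) * (1 - Polynomial.aeval f (v * g)) = 0 := by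
      rw [← h1, ← map_mul]
      have : v * g * (u * Polynomial.X ^ (N + 1)) = (v * u) * (Polynomial.X ^ (N + 1) * g) := by
        ring
      rw [this, map_mul, h0, mul_zero]
    rw [mul_sub, mul_one, sub_eq_zero] at h2
    exact h2.symm
  · have h3 : f * Polynomial.aeval f (v * g) = Polynomial.aeval f (Polynomial.X * (v * g)) := by
      rw [map_mul _ Polynomial.X, Polynomial.aeval_X]
    rw [h3, ← map_pow]
    have : (Polynomial.X * (v * g)) ^ (N + 1) =
        (v ^ (N + 1) * g ^ N) * (Polynomial.X ^ (N + 1) * g) := by ring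
    rw [this, map_mul, h0, mul_zero]
  · have h4 : Polynomial.aeval f (u * Polynomial.X ^ (N + 1)) * Y = 0 := by
      rw [map_mul, map_pow, Polynomial.aeval_X, pow_succ, mul_assoc, mul_assoc, hY, mul_zero,
        mul_zero]
    rw [h1, sub_mul, one_mul, sub_eq_zero] at h4
    exact h4.symm

namespace GLModule

variable {k : Type*} [Field k] [CharZero k] {W : Type*} [AddCommGroup W] [Module k W] {m : ℕ}
  (D : GLModule k W m)

/-- `a` is a weight of the image of `z` at which `casimirForm` is maximal. -/
def IsMaxWeight (z : Module.End k W) (a : Fin m →₀ ℕ) : Prop :=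
  z * D.pr a ≠ 0 ∧ ∀ b, z * D.pr b ≠ 0 → casimirForm b ≤ casimirForm a

omit [CharZero k] in
theorem exists_isMaxWeight {z : Module.End k W} (hz : z ≠ 0) : ∃ a, D.IsMaxWeight z a := by
  classical
  have hne : (D.weights.filter fun a => z * D.pr a ≠ 0).Nonempty := by
    by_contra h
    rw [Finset.not_nonempty_iff_eq_empty] at h
    apply hz
    rw [D.eq_sum_mul_pr z]
    refine Finset.sum_eq_zero fun a ha => ?_
    by_contra h'
    exact Finset.notMem_empty a (h ▸ Finset.mem_filter.2 ⟨ha, h'⟩)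
  obtain ⟨a, ha, hmax⟩ := Finset.exists_max_image _ casimirForm hne
  refine ⟨a, (Finset.mem_filter.1 ha).2, fun b hb => hmax b (Finset.mem_filter.2 ⟨?_, hb⟩)⟩
  by_contra h
  rw [D.pr_eq_zero h, mul_zero] at hb
  exact hb rfl

variable {D}

theorem mul_pr_mapDomain_ne_zero {z : Module.End k W} (hzp : ∀ w, z * D.perm w = D.perm w * z)
    (w : Equiv.Perm (Fin m)) {a : Fin m →₀ ℕ} (ha : z * D.pr a ≠ 0) :
    z * D.pr (a.mapDomain w) ≠ 0 := by
  intro h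
  apply ha
  have h1 : D.perm w * (z * D.pr a) = 0 := by
    rw [← mul_assoc, ← hzp, mul_assoc, D.perm_mul_pr, ← mul_assoc, h, zero_mul]
  have h2 := D.perm_mul_inv w⁻¹
  rw [inv_inv] at h2
  rw [← one_mul (z * D.pr a), ← h2, mul_assoc, h1, mul_zero]

variable {z : Module.End k W} {a : Fin m →₀ ℕ}

/-- Interchanging two entries of `a` that are in increasing order would increase `casimirForm`. -/
theorem IsMaxWeight.antitone (ha : D.IsMaxWeight z a) (hzp : ∀ w, z * D.perm w = D.perm w * z)
    {i j : Fin m} (hij : i < j) : a j ≤ a i := by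
  by_contra! hlt
  have h := ha.2 _ (mul_pr_mapDomain_ne_zero hzp (Equiv.swap i j) ha.1)
  set b := a.mapDomain (Equiv.swap i j) with hb
  have hbl : ∀ l, b l = a (Equiv.swap i j l) := by
    intro l
    conv_lhs => rw [hb, ← Equiv.swap_apply_self i j l]
    rw [Finsupp.mapDomain_apply (Equiv.injective _)]
  have hs : stair m j < stair m i := by
    have := j.2; have : (i : ℕ) < j := hij; simp only [stair]; omega
  rw [casimirForm, casimirForm, sum_eq_add_add_sum hij.ne, sum_eq_add_add_sum hij.ne,
    sum_eq_add_add_sum hij.ne, sum_eq_add_add_sum hij.ne] at h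
  have e1 : ∀ l ∈ (Finset.univ.erase i).erase j, b l = a l := by
    intro l hl
    simp only [Finset.mem_erase, Finset.mem_univ, and_true] at hl
    rw [hbl, Equiv.swap_apply_of_ne_of_ne hl.2 hl.1]
  rw [Finset.sum_congr rfl fun l hl => by rw [e1 l hl],
    Finset.sum_congr (s₁ := (Finset.univ.erase i).erase j) (f := fun l => (b l : ℤ)) rfl
      fun l hl => by rw [e1 l hl], hbl, hbl, Equiv.swap_apply_left, Equiv.swap_apply_right] at h
  have h1 : (a i : ℤ) < a j := by exact_mod_cast hlt
  have h2 : (stair m j : ℤ) < stair m i := by exact_mod_cast hs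
  nlinarith

/-- The vectors of maximal weight are highest weight vectors: moving a unit to an earlier entry of
`a` would increase `casimirForm`. -/
theorem IsMaxWeight.E_mul_eq_zero (ha : D.IsMaxWeight z a)
    (hz : ∀ i j, z * D.E i j = D.E i j * z) (hzp : ∀ w, z * D.perm w = D.perm w * z)
    {i j : Fin m} (hij : i < j) : D.E i j * (z * D.pr a) = 0 := by
  classical
  by_cases haj : a j = 0
  · rw [← mul_assoc, ← hz, mul_assoc, D.E_mul_pr_eq_zero hij.ne haj, mul_zero]
  have hle : Finsupp.single j 1 ≤ a + Finsupp.single i 1 := by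
    rw [Finsupp.single_le_iff]
    simp only [Finsupp.add_apply]
    omega
  set b := a + Finsupp.single i 1 - Finsupp.single j 1 with hb
  have hba : b + Finsupp.single j 1 = a + Finsupp.single i 1 := tsub_add_cancel_of_le hle
  rw [← mul_assoc, ← hz, mul_assoc, D.E_mul_pr_comm hba, ← mul_assoc]
  by_contra hne
  have h := ha.2 b fun h0 => hne (by rw [h0, zero_mul])
  have hl := fun l => DFunLike.congr_fun hba l
  simp only [Finsupp.add_apply] at hl
  have hs : stair m j < stair m i := by
    have := j.2; have : (i : ℕ) < j := hij; simp only [stair]; omega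
  rw [casimirForm, casimirForm, sum_eq_add_add_sum hij.ne, sum_eq_add_add_sum hij.ne,
    sum_eq_add_add_sum hij.ne, sum_eq_add_add_sum hij.ne] at h
  have e1 : ∀ l ∈ (Finset.univ.erase i).erase j, b l = a l := by
    intro l hl'
    simp only [Finset.mem_erase, Finset.mem_univ, and_true] at hl'
    have := hl l
    rwa [Finsupp.single_eq_of_ne hl'.1, Finsupp.single_eq_of_ne hl'.2, add_zero,
      add_zero] at this
  have hbi : (b i : ℤ) = a i + 1 := by
    have := hl i
    rw [Finsupp.single_eq_of_ne hij.ne, Finsupp.single_eq_same] at this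
    omega
  have hbj : (b j : ℤ) = a j - 1 := by
    have := hl j
    rw [Finsupp.single_eq_same, Finsupp.single_eq_of_ne hij.ne'] at this
    omega
  rw [Finset.sum_congr rfl fun l hl => by rw [e1 l hl],
    Finset.sum_congr (s₁ := (Finset.univ.erase i).erase j) (f := fun l => (b l : ℤ)) rfl
      fun l hl => by rw [e1 l hl], hbi, hbj] at h
  have h1 : (a j : ℤ) ≤ a i := by exact_mod_cast ha.antitone hzp hij
  have h2 : (stair m j : ℤ) < stair m i := by exact_mod_cast hs
  nlinarith

omit [CharZero k] in
theorem E_diag_mul_mul_pr (hz : ∀ i j, z * D.E i j = D.E i j * z) (i : Fin m) (a : Fin m →₀ ℕ) :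
    D.E i i * (z * D.pr a) = (a i : k) • (z * D.pr a) := by
  rw [← mul_assoc, ← hz, mul_assoc, D.E_mul_pr, mul_smul_comm]

theorem IsMaxWeight.casimir_mul (ha : D.IsMaxWeight z a)
    (hz : ∀ i j, z * D.E i j = D.E i j * z) (hzp : ∀ w, z * D.perm w = D.perm w * z) :
    D.casimir * (z * D.pr a) =
      ((casimirForm a - ∑ i, (stair m i : ℤ) ^ 2 : ℤ) : k) • (z * D.pr a) := by
  set y := z * D.pr a with hy
  have hd := fun i => E_diag_mul_mul_pr hz i a
  rw [← hy] at hd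
  have hc : ((casimirForm a - ∑ i, (stair m i : ℤ) ^ 2 : ℤ) : k) =
      ∑ i, (a i : k) ^ 2 + ∑ p : Fin m × Fin m with p.1 < p.2, ((a p.1 : k) - a p.2) := by
    have h1 := sum_pairs fun i _ : Fin m => (a i : k)
    have h2 : ∑ p : Fin m × Fin m with p.1 < p.2, (a p.1 : k) = ∑ i, a i * (stair m i : k) := by
      rw [Finset.sum_filter, Fintype.sum_prod_type]
      refine Finset.sum_congr rfl fun i _ => ?_
      rw [stair_eq_card_Ioi, ← Finset.sum_filter]
      simp only [Finset.sum_const, nsmul_eq_mul]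
      rw [mul_comm]
      congr 3
      ext; simp
    simp only [Finset.sum_const, Finset.card_univ, Fintype.card_fin, nsmul_eq_mul,
      ← Finset.mul_sum, Finset.sum_add_distrib] at h1
    rw [Finset.sum_sub_distrib, casimirForm]
    push_cast
    simp only [add_sq, Finset.sum_add_distrib, mul_assoc, ← Finset.mul_sum]
    linear_combination -h1 - 2 * h2
  rw [hc, casimir, Finset.sum_mul]
  simp only [Finset.sum_mul, mul_assoc]
  rw [sum_pairs fun i j => D.E i j * (D.E j i * y), add_smul, Finset.sum_smul, Finset.sum_smul]
  congr 1
  · refine Finset.sum_congr rfl fun i _ => ?_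
    rw [hd, mul_smul_comm, hd, smul_smul, sq]
  · refine Finset.sum_congr rfl fun p hp => ?_
    have hlt := (Finset.mem_filter.1 hp).2
    have h3 := congrArg (· * y) (D.comm p.1 p.2 p.2 p.1)
    simp only [if_true, sub_mul, hd, mul_assoc] at h3
    rw [ha.E_mul_eq_zero hz hzp hlt, mul_zero, sub_zero] at h3
    rw [ha.E_mul_eq_zero hz hzp hlt, mul_zero, add_zero, h3, sub_smul]

/-- If the Capelli element vanishes, then so does its eigenvalue `∏ (a_i + δ_i)` on the highest
weight vectors of weight `a`. -/
theorem IsMaxWeight.exists_add_stair_eq_zero (ha : D.IsMaxWeight z a)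
    (hz : ∀ i j, z * D.E i j = D.E i j * z) (hzp : ∀ w, z * D.perm w = D.perm w * z)
    (hcap : capelli D.E = 0) : ∃ i, a i + stair m i = 0 := by
  have h := capelli_mul_of_highest D.E (z * D.pr a) a
    (fun i => by
      rw [E_diag_mul_mul_pr hz i a, ← nsmul_eq_mul, Nat.cast_smul_eq_nsmul])
    (fun i j hij => ha.E_mul_eq_zero hz hzp hij)
  rw [hcap, zero_mul, ← nsmul_eq_mul, ← Nat.cast_smul_eq_nsmul k] at h
  rcases smul_eq_zero.1 h.symm with h | h
  · rw [Nat.cast_eq_zero, Finset.prod_eq_zero_iff] at h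
    obtain ⟨i, _, hi⟩ := h
    exact ⟨i, hi⟩
  · exact absurd h ha.1

variable (D)

/-- A nonzero module on which the Capelli element vanishes has a nonzero vector whose weight has
last entry zero. -/
theorem exists_weight_of_capelli_eq_zero [Nontrivial W] (hcap : capelli D.E = 0) :
    ∃ a, D.pr a ≠ 0 ∧ ∃ i, a i + stair m i = 0 := by
  obtain ⟨a, ha⟩ := D.exists_isMaxWeight (z := 1) one_ne_zero
  refine ⟨a, fun h => ha.1 (by rw [h, mul_zero]), ?_⟩
  exact ha.exists_add_stair_eq_zero (by simp) (by simp) hcap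

/-- If the Capelli element vanishes on a module, then the product of its character with the Weyl
denominator contains only monomials with some exponent equal to zero: in terms of Schur
polynomials, only those of partitions with less than `m` parts occur in the character. -/
theorem coeff_alternant_mul_trSeries [FiniteDimensional k W] (hcap : capelli D.E = 0)
    {e : Fin m →₀ ℕ} (he : ∀ i, 0 < e i) :
    (alternant k (stair m) * D.trSeries 1).coeff e = 0 := by
  -- Induction on the rank of an idempotent `z` that commutes with the action: the Fitting
  -- idempotent `y` of the Casimir element minus its eigenvalue `c` at a maximal weight splits `z`
  -- as `z y + z (1 - y)`, and `z (1 - y)` has smaller rank.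
  suffices H : ∀ (N : ℕ) (z : Module.End k W), z * z = z → (∀ i j, z * D.E i j = D.E i j * z) →
      (∀ w, z * D.perm w = D.perm w * z) → Module.finrank k (LinearMap.range z) < N →
      (alternant k (stair m) * D.trSeries z).coeff e = 0 from
    H _ 1 (one_mul 1) (by simp) (by simp) (Nat.lt_succ_self _)
  intro N
  induction N with
  | zero => intro z _ _ _ h; exact absurd h (Nat.not_lt_zero _)
  | succ N ih =>
    intro z hzz hz hzp hN
    by_cases hz0 : z = 0
    · rw [hz0, map_zero, mul_zero, MvPolynomial.coeff_zero]
    obtain ⟨a, ha⟩ := D.exists_isMaxWeight hz0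
    set c : k := ((casimirForm a - ∑ i, (stair m i : ℤ) ^ 2 : ℤ) : k) with hc
    obtain ⟨y, hyy, hnil, hcomm, hker⟩ := exists_fitting_idempotent (D.casimir - c • 1)
    have hcomm' : ∀ X, X * D.casimir = D.casimir * X → X * y = y * X := by
      intro X hX
      refine hcomm X ?_
      rw [mul_sub, sub_mul, hX, mul_smul_comm, smul_mul_assoc, mul_one, one_mul]
    have hcz : z * D.casimir = D.casimir * z := by
      simp only [casimir, Finset.mul_sum, Finset.sum_mul]
      refine Finset.sum_congr rfl fun i _ => Finset.sum_congr rfl fun j _ => ?_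
      rw [← mul_assoc, hz, mul_assoc, hz, mul_assoc]
    have hyE : ∀ i j, y * D.E i j = D.E i j * y := fun i j =>
      (hcomm' _ (D.casimir_mul_E i j).symm).symm
    have hyp : ∀ w, y * D.perm w = D.perm w * y := fun w =>
      (hcomm' _ (D.casimir_mul_perm w).symm).symm
    have hzy : z * y = y * z := hcomm' z hcz
    have hmax : y * (z * D.pr a) = z * D.pr a := by
      refine hker _ ?_
      rw [sub_mul, ha.casimir_mul hz hzp, smul_mul_assoc, one_mul, sub_self]
    -- On the image of `z y` the Casimir element has the trace of the scalar `c` in each weight. By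
    -- `radial_casimir`, a monomial `u^e` with nonzero coefficient then has the form `w (b' + δ)`
    -- with `casimirForm b'` maximal, so that `b'` is a highest weight and some `e_i` vanishes.
    have h1 : (alternant k (stair m) * D.trSeries (z * y)).coeff e = 0 := by
      by_contra hne
      have hr := D.radial_casimir (z := z * y)
        (fun i j => by rw [mul_assoc, hyE, ← mul_assoc, hz, mul_assoc]) e
      have hcas : D.trSeries (z * y * D.casimir) = c • D.trSeries (z * y) := by
        ext b
        rw [MvPolynomial.coeff_smul, coeff_trSeries, coeff_trSeries, ← map_smul, ← sub_eq_zero,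
          ← map_sub]
        have hpr : D.pr b * D.casimir = D.casimir * D.pr b :=
          D.pr_comm_of_comm (fun i => (D.casimir_mul_E i i).symm) b
        have e1 : z * y * D.casimir * D.pr b - c • (z * y * D.pr b) =
            (D.casimir - c • 1) * y * (z * D.pr b) := by
          have : y * D.casimir = D.casimir * y := (hcomm' _ rfl).symm
          rw [mul_assoc z, this, ← mul_assoc z, hcz, sub_mul, sub_mul, smul_mul_assoc, one_mul,
            smul_mul_assoc, mul_assoc _ z, mul_assoc _ (z * y), hzy, ← mul_assoc y, mul_assoc _ y,
            ← mul_assoc y]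
        rw [e1]
        refine (LinearMap.isNilpotent_trace_of_isNilpotent ?_).eq_zero
        refine Commute.isNilpotent_mul_right ?_ hnil
        have c1 : Commute (z * D.pr b) D.casimir := by
          change z * D.pr b * D.casimir = D.casimir * (z * D.pr b)
          rw [mul_assoc, hpr, ← mul_assoc, hcz, mul_assoc]
        refine Commute.symm (Commute.mul_right ?_ (hcomm' _ c1))
        exact c1.sub_right ((Commute.one_right _).smul_right c)
      rw [hcas, mul_smul_comm, MvPolynomial.coeff_smul, smul_eq_mul, ← add_mul] at hr
      have hr' := mul_right_cancel₀ hne hr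
      rw [MvPolynomial.coeff_mul] at hne
      obtain ⟨⟨d, b⟩, hdb, hne⟩ := Finset.exists_ne_zero_of_sum_ne_zero hne
      rw [Finset.HasAntidiagonal.mem_antidiagonal] at hdb
      simp only at hdb hne
      obtain ⟨w, hw⟩ := exists_perm_of_coeff_alternant k (left_ne_zero_of_mul hne)
      have hb : z * D.pr b ≠ 0 := by
        intro h0
        apply right_ne_zero_of_mul hne
        rw [coeff_trSeries, hzy, mul_assoc, h0, mul_zero, map_zero]
      have hb' := mul_pr_mapDomain_ne_zero hzp w hb
      set b' := b.mapDomain w with hbdef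
      have hbe : ∀ i, b' (w i) + stair m (w i) = e i := by
        intro i
        rw [hbdef, Finsupp.mapDomain_apply w.injective, ← hdb, Finsupp.add_apply, hw, add_comm]
        rfl
      have hq : casimirForm b' = casimirForm a := by
        have e2 : casimirForm b' = ∑ i, (e i : ℤ) ^ 2 -
            (m - 1) * (∑ i, (e i : ℤ) - ∑ i, (stair m i : ℤ)) := by
          have e3 : ∀ i, (e i : ℤ) = b' (w i) + stair m (w i) := fun i => by
            rw [← hbe]; push_cast; rfl
          simp only [e3]
          rw [Equiv.sum_comp w fun i => ((b' i : ℤ) + stair m i) ^ 2,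
            Equiv.sum_comp w fun i => ((b' i : ℤ) + stair m i), Finset.sum_add_distrib,
            casimirForm]
          ring
        have e4 : (casimirForm b' : k) = casimirForm a := by
          rw [e2]
          rw [hc] at hr'
          push_cast at hr' ⊢
          linear_combination hr'
        exact_mod_cast e4
      have hbmax : D.IsMaxWeight z b' := ⟨hb', fun d hd => hq ▸ ha.2 d hd⟩
      obtain ⟨i, hi⟩ := hbmax.exists_add_stair_eq_zero hz hzp hcap
      obtain ⟨i, rfl⟩ := w.surjective i
      rw [hbe] at hi
      exact (he i).ne' hi
    have h2 : (alternant k (stair m) * D.trSeries (z * (1 - y))).coeff e = 0 := by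
      refine ih _ ?_ ?_ ?_ ?_
      · have : (1 - y) * z = z * (1 - y) := by rw [sub_mul, mul_sub, hzy, one_mul, mul_one]
        have h3 : (1 - y) * (1 - y) = 1 - y := by
          have h4 : (1 - y) * (1 - y) = 1 - y - y + y * y := by noncomm_ring
          rw [h4, hyy, sub_add_cancel]
        rw [mul_assoc, ← mul_assoc (1 - y), this, mul_assoc z (1 - y), h3, ← mul_assoc, hzz]
      · intro i j
        rw [mul_assoc, sub_mul, one_mul, hyE, ← mul_assoc, ← hz, mul_assoc, mul_sub, mul_sub,
          mul_sub, mul_one]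
      · intro w
        rw [mul_assoc, sub_mul, one_mul, hyp, ← mul_assoc, ← hzp, mul_assoc, mul_sub, mul_sub,
          mul_sub, mul_one]
      · refine lt_of_lt_of_le (Submodule.finrank_lt_finrank_of_lt ?_) (Nat.lt_succ_iff.1 hN)
        refine lt_of_le_of_ne ?_ fun heq => ?_
        · rintro _ ⟨x, rfl⟩
          exact ⟨(1 - y) x, rfl⟩
        · apply ha.1
          ext x
          have hx : (z * D.pr a) x ∈ LinearMap.range (z * (1 - y)) := heq ▸ ⟨D.pr a x, rfl⟩
          obtain ⟨u, hu⟩ := hx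
          have h3 : y * (z * (1 - y)) = 0 := by
            rw [← mul_assoc, ← hzy, mul_assoc, mul_sub, hyy, mul_one, sub_self, mul_zero]
          rw [← hmax, Module.End.mul_apply, ← hu, ← Module.End.mul_apply, h3]
          simp
    have h3 : z = z * y + z * (1 - y) := by rw [mul_sub, mul_one, add_sub_cancel]
    rw [h3, map_add, mul_add, MvPolynomial.coeff_add, h1, h2, add_zero]

end GLModule

/-! ### Capelli's identity -/

section CapelliIdentity

variable {k : Type*} [Field k] {m n : ℕ}

/-- The polarization operator `∑_p x_ip ∂/∂x_jp`. -/
def polar (i j : Fin m) : Derivation k (MatRing k m n) (MatRing k m n) :=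
  ∑ p, (MvPolynomial.X (i, p) : MatRing k m n) • MvPolynomial.pderiv (j, p)

/-- Multiplication by the variable `x_ip`. -/
def mulX (i : Fin m) (p : Fin n) : Module.End k (MatRing k m n) :=
  LinearMap.mulLeft k (MvPolynomial.X (i, p))

/-- The partial derivative with respect to `x_jp`. -/
def dX (j : Fin m) (p : Fin n) : Module.End k (MatRing k m n) :=
  (MvPolynomial.pderiv (j, p) : Derivation k (MatRing k m n) (MatRing k m n)).toLinearMap

/-- The polarization operators as endomorphisms of the vector space `R_m`. -/
def polarEnd (i j : Fin m) : Module.End k (MatRing k m n) := (polar i j).toLinearMap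

theorem polarEnd_eq (i j : Fin m) :
    (polarEnd i j : Module.End k (MatRing k m n)) = ∑ p, mulX i p * dX j p := by
  refine LinearMap.ext fun f => ?_
  rw [polarEnd, polar, LinearMap.sum_apply]
  change Derivation.coeFnAddMonoidHom (∑ p, _) f = _
  rw [map_sum, Finset.sum_apply]
  rfl

theorem polar_X (i j l : Fin m) (p : Fin n) :
    polar i j (MvPolynomial.X (l, p) : MatRing k m n) =
      if l = j then MvPolynomial.X (i, p) else 0 := by
  classical
  rw [polar]
  change Derivation.coeFnAddMonoidHom (∑ p, _) _ = _
  rw [map_sum, Finset.sum_apply]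
  simp only [Derivation.coeFnAddMonoidHom_apply, Derivation.smul_apply,
    MvPolynomial.pderiv_X, smul_eq_mul, Pi.single_apply, Prod.mk.injEq]
  split_ifs with h
  · rw [Finset.sum_eq_single p]
    · simp [h]
    · intro q _ hq
      simp [hq.symm]
    · simp
  · simp [h]

theorem mulX_mul_comm (i j : Fin m) (p q : Fin n) :
    (mulX i p * mulX j q : Module.End k (MatRing k m n)) = mulX j q * mulX i p := by
  refine LinearMap.ext fun f => ?_
  simp only [mulX, Module.End.mul_apply, LinearMap.mulLeft_apply]
  ring

theorem dX_mul_comm (i j : Fin m) (p q : Fin n) :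
    (dX i p * dX j q : Module.End k (MatRing k m n)) = dX j q * dX i p := by
  refine LinearMap.ext fun f => ?_
  have h : ⁅(MvPolynomial.pderiv (i, p) : Derivation k (MatRing k m n) (MatRing k m n)),
      (MvPolynomial.pderiv (j, q) : Derivation k (MatRing k m n) (MatRing k m n))⁆ = 0 := by
    refine MvPolynomial.derivation_ext fun x => ?_
    simp [Derivation.commutator_apply, MvPolynomial.pderiv_X, Pi.single_apply, apply_ite]
  have h2 := DFunLike.congr_fun h f
  rw [Derivation.commutator_apply, Derivation.zero_apply, sub_eq_zero] at h2
  exact h2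

theorem polarEnd_mul_mulX (i j l : Fin m) (q : Fin n) :
    (polarEnd i j * mulX l q : Module.End k (MatRing k m n)) =
      mulX l q * polarEnd i j + if l = j then mulX i q else 0 := by
  refine LinearMap.ext fun f => ?_
  change polar i j ((MvPolynomial.X (l, q) : MatRing k m n) * f) =
    (MvPolynomial.X (l, q) : MatRing k m n) * polar i j f + _
  rw [(polar i j).leibniz, polar_X, smul_eq_mul, smul_eq_mul]
  split_ifs
  · rw [mul_comm f]; rfl
  · rw [mul_zero]; rfl

/-- The normally ordered product `∑_p ∏_c x_{z(c), p_c} ∏_c ∂/∂x_{c, p_c}` over a list of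
columns `c`. -/
def normalOrd (z : Fin m → Fin m) : List (Fin m) → Module.End k (MatRing k m n)
  | [] => 1
  | c :: L => ∑ p, mulX (z c) p * normalOrd z L * dX c p

theorem normalOrd_congr {z z' : Fin m → Fin m} {L : List (Fin m)} (h : ∀ c ∈ L, z c = z' c) :
    (normalOrd z L : Module.End k (MatRing k m n)) = normalOrd z' L := by
  induction L with
  | nil => rfl
  | cons c L ih =>
    rw [normalOrd, normalOrd, ih fun c hc => h c (List.mem_cons_of_mem _ hc),
      h c List.mem_cons_self]

/-- Moving the derivative in a polarization operator past a normally ordered product: by the Leibniz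
rule, it replaces in turn each factor `x_jp` by `x_ip`. -/
theorem polarEnd_mul_normalOrd (i j : Fin m) (z : Fin m → Fin m) {L : List (Fin m)}
    (hL : L.Nodup) :
    (polarEnd i j * normalOrd z L : Module.End k (MatRing k m n)) =
      ∑ p, mulX i p * normalOrd z L * dX j p +
      (L.map fun l => if z l = j then normalOrd (Function.update z l i) L else 0).sum := by
  induction L with
  | nil => simp [normalOrd, polarEnd_eq]
  | cons c L ih =>
    rw [List.nodup_cons] at hL
    have h1 : ∀ l ∈ L, (if z l = j then
        (normalOrd (Function.update z l i) (c :: L) : Module.End k (MatRing k m n)) else 0) =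
        ∑ q, mulX (z c) q * (if z l = j then normalOrd (Function.update z l i) L else 0) *
          dX c q := by
      intro l hl
      have hcl : c ≠ l := fun h => hL.1 (h ▸ hl)
      split_ifs
      · rw [normalOrd, Function.update_of_ne hcl]
      · simp
    have h2 : ∀ f : Fin m → Module.End k (MatRing k m n),
        (L.map fun l => ∑ q : Fin n, mulX (z c) q * f l * dX c q).sum =
        ∑ q, mulX (z c) q * (L.map f).sum * dX c q := by
      intro f
      clear h1 ih hL
      induction L with
      | nil => simp
      | cons l L ih =>
        simp only [List.map_cons, List.sum_cons, ih, mul_add, add_mul, Finset.sum_add_distrib]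
    have h3 : (if z c = j then
        (normalOrd (Function.update z c i) (c :: L) : Module.End k (MatRing k m n)) else 0) =
        ∑ q, (if z c = j then mulX i q else 0) * normalOrd z L * dX c q := by
      split_ifs
      · rw [normalOrd, Function.update_self]
        refine Finset.sum_congr rfl fun q _ => ?_
        rw [normalOrd_congr (z' := z)]
        intro l hl
        exact Function.update_of_ne (by rintro rfl; exact hL.1 hl) _ _
      · simp
    rw [List.map_cons, List.sum_cons, List.map_congr_left h1, h2, h3]
    simp only [normalOrd, Finset.mul_sum, Finset.sum_mul, ← mul_assoc, polarEnd_mul_mulX, add_mul]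
    rw [Finset.sum_add_distrib, add_comm (∑ q, mulX (z c) q * polarEnd i j * normalOrd z L * _),
      add_left_comm]
    congr 1
    rw [Finset.sum_comm, ← Finset.sum_add_distrib]
    refine Finset.sum_congr rfl fun q _ => ?_
    rw [mul_assoc (mulX (z c) q), ih hL.2, mul_add, add_mul]
    congr 1
    rw [Finset.mul_sum, Finset.sum_mul]
    refine Finset.sum_congr rfl fun p _ => ?_
    rw [mulX_mul_comm i]
    simp only [mul_assoc]
    rw [dX_mul_comm]

/-- Capelli's identity for a partial list of columns. The factors `g` stand for the columns
that are expanded before. -/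
theorem sum_capelliProd_eq {L : List (Fin m)} (hL : L.Nodup)
    (g : Equiv.Perm (Fin m) → Module.End k (MatRing k m n))
    (hg : ∀ σ, ∀ c ∈ L, ∀ l ∈ L, g (σ * Equiv.swap c l) = g σ) :
    ∑ σ : Equiv.Perm (Fin m), (Equiv.Perm.sign σ : ℤ) • (g σ * capelliProd polarEnd σ L) =
      ∑ σ : Equiv.Perm (Fin m), (Equiv.Perm.sign σ : ℤ) • (g σ * normalOrd σ L) := by
  classical
  induction L generalizing g with
  | nil => rfl
  | cons c L ih =>
    rw [List.nodup_cons] at hL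
    simp only [capelliProd, ← mul_assoc]
    rw [ih hL.2 fun σ => g σ * (polarEnd (σ c) c +
      if σ c = c then (L.length : Module.End k (MatRing k m n)) else 0)]
    swap
    · intro σ a ha b hb
      have hc : (σ * Equiv.swap a b) c = σ c := by
        rw [Equiv.Perm.mul_apply, Equiv.swap_apply_of_ne_of_ne]
        · exact fun h => hL.1 (h ▸ ha)
        · exact fun h => hL.1 (h ▸ hb)
      simp only [hc, hg σ a (List.mem_cons_of_mem _ ha) b (List.mem_cons_of_mem _ hb)]
    have h1 : ∀ σ : Equiv.Perm (Fin m),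
        (polarEnd (σ c) c * normalOrd σ L : Module.End k (MatRing k m n)) =
        normalOrd σ (c :: L) +
          (L.map fun l => if σ l = c then normalOrd (σ * Equiv.swap c l : Equiv.Perm (Fin m)) L
            else 0).sum := by
      intro σ
      rw [polarEnd_mul_normalOrd _ _ _ hL.2, normalOrd]
      congr 2
      refine List.map_congr_left fun l hl => ?_
      congr 1
      refine normalOrd_congr fun l' hl' => ?_
      rw [Equiv.Perm.mul_apply]
      by_cases h : l' = l
      · rw [h, Function.update_self, Equiv.swap_apply_right]
      · rw [Function.update_of_ne h, Equiv.swap_apply_of_ne_of_ne _ h]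
        exact fun h => hL.1 (h ▸ hl')
    -- each column after `c` contributes the same correction term
    have h2 : ∀ l ∈ L, ∑ σ : Equiv.Perm (Fin m), (Equiv.Perm.sign σ : ℤ) • (g σ *
        if σ l = c then (normalOrd (σ * Equiv.swap c l : Equiv.Perm (Fin m)) L :
          Module.End k (MatRing k m n)) else 0) =
        -∑ σ : Equiv.Perm (Fin m), (Equiv.Perm.sign σ : ℤ) • (g σ *
          if σ c = c then normalOrd σ L else 0) := by
      intro l hl
      have hcl : c ≠ l := fun h => hL.1 (h ▸ hl)
      rw [← Equiv.sum_comp (Equiv.mulRight (Equiv.swap c l)), ← Finset.sum_neg_distrib]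
      refine Finset.sum_congr rfl fun σ _ => ?_
      simp only [Equiv.coe_mulRight, Equiv.Perm.sign_mul, Equiv.Perm.sign_swap hcl]
      rw [hg σ c List.mem_cons_self l (List.mem_cons_of_mem _ hl), mul_assoc σ,
        Equiv.swap_mul_self, mul_one]
      have hl' : (σ * Equiv.swap c l) l = σ c := by
        rw [Equiv.Perm.mul_apply, Equiv.swap_apply_right]
      simp only [hl']
      split_ifs <;> simp
    have h3 : ∀ L' : List (Fin m), (∀ l ∈ L', l ∈ L) →
        ∑ σ : Equiv.Perm (Fin m), (Equiv.Perm.sign σ : ℤ) • (g σ * (L'.map fun l =>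
          if σ l = c then (normalOrd (σ * Equiv.swap c l : Equiv.Perm (Fin m)) L :
            Module.End k (MatRing k m n)) else 0).sum) =
        -∑ σ : Equiv.Perm (Fin m), (Equiv.Perm.sign σ : ℤ) • (g σ *
          ((if σ c = c then (L'.length : Module.End k (MatRing k m n)) else 0) *
            normalOrd σ L)) := by
      intro L' hL'
      induction L' with
      | nil => simp
      | cons l L' ih' =>
        simp only [List.map_cons, List.sum_cons, mul_add, smul_add, Finset.sum_add_distrib]
        rw [ih' fun l hl => hL' l (List.mem_cons_of_mem _ hl), h2 l (hL' l List.mem_cons_self),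
          ← neg_add, ← Finset.sum_add_distrib]
        congr 1
        refine Finset.sum_congr rfl fun σ _ => ?_
        rw [← smul_add, ← mul_add]
        congr 2
        split_ifs
        · rw [List.length_cons, Nat.cast_add, Nat.cast_one, add_mul, one_mul, add_comm]
        · simp
    have h4 : ∀ σ : Equiv.Perm (Fin m), (Equiv.Perm.sign σ : ℤ) •
        (g σ * (polarEnd (σ c) c + if σ c = c then
          (L.length : Module.End k (MatRing k m n)) else 0) * normalOrd σ L) =
        (Equiv.Perm.sign σ : ℤ) • (g σ * normalOrd σ (c :: L)) +
        ((Equiv.Perm.sign σ : ℤ) • (g σ * (L.map fun l =>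
          if σ l = c then (normalOrd (σ * Equiv.swap c l : Equiv.Perm (Fin m)) L :
            Module.End k (MatRing k m n)) else 0).sum) +
        (Equiv.Perm.sign σ : ℤ) • (g σ * ((if σ c = c then
          (L.length : Module.End k (MatRing k m n)) else 0) * normalOrd σ L))) := by
      intro σ
      rw [mul_assoc, add_mul, h1, mul_add, mul_add, smul_add, smul_add, add_assoc]
    rw [Finset.sum_congr rfl fun σ _ => h4 σ, Finset.sum_add_distrib, Finset.sum_add_distrib,
      h3 L fun _ h => h, neg_add_cancel, add_zero]

/-- Capelli's identity: the Capelli element of the polarization operators is the normally ordered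
determinant. -/
theorem capelli_polarEnd : capelli (polarEnd : Fin m → Fin m → Module.End k (MatRing k m n)) =
    ∑ σ : Equiv.Perm (Fin m), (Equiv.Perm.sign σ : ℤ) • normalOrd σ (List.finRange m) := by
  have h := sum_capelliProd_eq (k := k) (n := n) (List.nodup_finRange m) (fun _ => 1)
    fun _ _ _ _ _ => rfl
  simp only [one_mul] at h
  exact h

/-- An alternating sum of normally ordered products maps polynomials into an ideal that contains the
alternating sums of their polynomial factors, for any choice of the columns `q` of the matrix of
variables. -/
theorem sum_mul_normalOrd_mem (J : Ideal (MatRing k m n)) (L : List (Fin m))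
    (h : Equiv.Perm (Fin m) → MatRing k m n)
    (hJ : ∀ q : List (Fin n), q.length = L.length → ∑ σ : Equiv.Perm (Fin m),
      (Equiv.Perm.sign σ : ℤ) • (h σ *
        (List.zipWith (fun c p => (MvPolynomial.X (σ c, p) : MatRing k m n)) L q).prod) ∈ J)
    (f : MatRing k m n) :
    ∑ σ : Equiv.Perm (Fin m), (Equiv.Perm.sign σ : ℤ) • (h σ * normalOrd σ L f) ∈ J := by
  induction L generalizing h f with
  | nil =>
    have := J.mul_mem_right f (hJ [] rfl)
    simpa [normalOrd, Finset.sum_mul, mul_assoc] using this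
  | cons c L ih =>
    have h1 : ∑ σ : Equiv.Perm (Fin m), (Equiv.Perm.sign σ : ℤ) • (h σ * normalOrd σ (c :: L) f) =
        ∑ p, ∑ σ : Equiv.Perm (Fin m), (Equiv.Perm.sign σ : ℤ) •
          ((h σ * MvPolynomial.X (σ c, p)) * normalOrd σ L (dX c p f)) := by
      rw [Finset.sum_comm]
      refine Finset.sum_congr rfl fun σ _ => ?_
      rw [normalOrd, LinearMap.sum_apply, Finset.mul_sum, Finset.smul_sum]
      refine Finset.sum_congr rfl fun p _ => ?_
      rw [mul_assoc (h σ), mul_assoc (mulX _ _)]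
      rfl
    rw [h1]
    refine J.sum_mem fun p _ => ih _ (fun q hq => ?_) _
    have := hJ (p :: q) (by simp [hq])
    simpa only [List.zipWith_cons_cons, List.prod_cons, mul_assoc] using this

/-- The columns `q` need not be in increasing order or distinct. -/
theorem det_mem_minorIdeal (q : Fin m → Fin n) :
    Matrix.det (Matrix.of fun i j : Fin m => (MvPolynomial.X (i, q j) : MatRing k m n)) ∈
      minorIdeal k m n := by
  classical
  by_cases hq : Function.Injective q
  · set s : Finset (Fin n) := Finset.univ.image q with hs
    have hcard : s.card = m := by
      rw [hs, Finset.card_image_of_injective _ hq, Finset.card_univ, Fintype.card_fin]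
    let w : Fin m → Fin m := fun i => (s.orderIsoOfFin hcard).symm ⟨q i, by simp [hs]⟩
    have hw : Function.Injective w := fun i j hij => by
      have := (s.orderIsoOfFin hcard).symm.injective hij
      exact hq (congrArg Subtype.val this)
    let e : Equiv.Perm (Fin m) := Equiv.ofBijective w (Finite.injective_iff_bijective.1 hw)
    have he : ∀ i, s.orderEmbOfFin hcard (e i) = q i := by
      intro i
      change ((s.orderIsoOfFin hcard) ((s.orderIsoOfFin hcard).symm ⟨q i, _⟩) : Fin n) = q i
      rw [OrderIso.apply_symm_apply]
    have hdet := Matrix.det_permute' e (Matrix.of fun i j : Fin m =>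
      (MvPolynomial.X (i, s.orderEmbOfFin hcard j) : MatRing k m n))
    have h2 : (Matrix.of fun i j : Fin m =>
        (MvPolynomial.X (i, s.orderEmbOfFin hcard j) : MatRing k m n)).submatrix id e =
        Matrix.of fun i j : Fin m => (MvPolynomial.X (i, q j) : MatRing k m n) := by
      ext1 i j
      simp [he]
    rw [h2] at hdet
    rw [hdet]
    exact Ideal.mul_mem_left _ _ (Ideal.subset_span ⟨s.orderEmbOfFin hcard, rfl⟩)
  · rw [Function.not_injective_iff] at hq
    obtain ⟨i, j, hij, hne⟩ := hq
    rw [Matrix.det_zero_of_column_eq hne]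
    · exact Ideal.zero_mem _
    · intro l
      simp [hij]

/-- The Capelli element maps polynomials into the ideal of maximal minors. -/
theorem capelli_polarEnd_mem (f : MatRing k m n) : capelli polarEnd f ∈ minorIdeal k m n := by
  simp only [capelli_polarEnd, LinearMap.sum_apply, LinearMap.smul_apply]
  have h := sum_mul_normalOrd_mem (minorIdeal k m n) (List.finRange m) (fun _ => 1) (fun q hq => ?_)
    f
  · simpa only [one_mul] using h
  · rw [List.length_finRange] at hq
    subst hq
    have h1 := det_mem_minorIdeal (k := k) q.get
    rw [Matrix.det_apply] at h1
    refine (congrArg (· ∈ minorIdeal k q.length n) (Finset.sum_congr rfl fun σ _ => ?_)).mp h1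
    rw [one_mul]
    have : List.zipWith (fun c p => (MvPolynomial.X (σ c, p) : MatRing k q.length n))
        (List.finRange q.length) q = List.ofFn fun i => MvPolynomial.X (σ i, q.get i) := by
      refine List.ext_getElem (by simp) fun i h1 h2 => by simp
    rw [this, List.prod_ofFn]
    simp [Units.smul_def]

theorem polarEnd_comm (i j l q : Fin m) :
    (polarEnd i j * polarEnd l q - polarEnd l q * polarEnd i j : Module.End k (MatRing k m n)) =
      (if j = l then polarEnd i q else 0) - (if q = i then polarEnd l j else 0) := by
  have h : ⁅(polar i j : Derivation k (MatRing k m n) (MatRing k m n)), polar l q⁆ =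
      (if j = l then polar i q else 0) -
      (if q = i then polar l j else 0 : Derivation k (MatRing k m n) (MatRing k m n)) := by
    refine MvPolynomial.derivation_ext fun x => ?_
    obtain ⟨a, p⟩ := x
    rw [Derivation.commutator_apply, Derivation.sub_apply]
    split_ifs <;> simp only [polar_X, Derivation.zero_apply] <;> split_ifs <;>
      simp_all [polar_X] <;> grind
  refine LinearMap.ext fun f => ?_
  have h3 := DFunLike.congr_fun h f
  rw [Derivation.commutator_apply, Derivation.sub_apply] at h3
  rw [LinearMap.sub_apply, LinearMap.sub_apply]
  refine h3.trans ?_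
  split_ifs <;> rfl

end CapelliIdentity

/-! ### Vector spaces graded by the weights of a basis -/

section WeightedBasis

variable {k F I Γ : Type*} [Field k] [AddCommGroup F] [Module k F]
  (B : Module.Basis I k F) (wt : I → Γ)

open scoped Classical in
/-- The projection to the span of the basis vectors of weight `w`. -/
def wproj (w : Γ) : Module.End k F := B.constr k fun i => if wt i = w then B i else 0

open scoped Classical in
theorem wproj_basis (w : Γ) (i : I) : wproj B wt w (B i) = if wt i = w then B i else 0 :=
  B.constr_basis k _ i

theorem wproj_wproj_self (w : Γ) (x : F) : wproj B wt w (wproj B wt w x) = wproj B wt w x := by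
  have h : wproj B wt w ∘ₗ wproj B wt w = wproj B wt w := by
    refine B.ext fun i => ?_
    rw [LinearMap.comp_apply, wproj_basis]
    split_ifs with h
    · rw [wproj_basis, if_pos h]
    · rw [map_zero]
  exact LinearMap.congr_fun h x

theorem wproj_wproj_of_ne {w w' : Γ} (hw : w ≠ w') (x : F) :
    wproj B wt w (wproj B wt w' x) = 0 := by
  have h : wproj B wt w ∘ₗ wproj B wt w' = 0 := by
    refine B.ext fun i => ?_
    rw [LinearMap.comp_apply, wproj_basis]
    split_ifs with h
    · rw [wproj_basis, if_neg fun h' => hw (h'.symm.trans h), LinearMap.zero_apply]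
    · rw [map_zero, LinearMap.zero_apply]
  exact LinearMap.congr_fun h x

theorem exists_sum_wproj (x : F) : ∃ s : Finset Γ, (∀ w ∉ s, wproj B wt w x = 0) ∧
    ∑ w ∈ s, wproj B wt w x = x := by
  classical
  suffices H : ∃ s : Finset Γ, ∀ w ∉ s, wproj B wt w x = 0 by
    obtain ⟨s, hs⟩ := H
    refine ⟨s, hs, ?_⟩
    -- enlarge `s` so that it contains the weights of all basis vectors that occur in `x`
    have h1 : ∑ w ∈ s, wproj B wt w x =
        ∑ w ∈ s ∪ (B.repr x).support.image wt, wproj B wt w x :=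
      Finset.sum_subset Finset.subset_union_left fun w _ hw => hs w hw
    rw [h1]
    conv_rhs => rw [← B.linearCombination_repr x, Finsupp.linearCombination_apply, Finsupp.sum]
    have h2 : ∀ w, wproj B wt w x =
        ∑ i ∈ (B.repr x).support, B.repr x i • if wt i = w then B i else 0 := by
      intro w
      conv_lhs => rw [← B.linearCombination_repr x, Finsupp.linearCombination_apply, Finsupp.sum]
      simp only [map_sum, map_smul, wproj_basis]
    simp only [h2]
    rw [Finset.sum_comm]
    refine Finset.sum_congr rfl fun i hi => ?_
    rw [← Finset.smul_sum, Finset.sum_ite_eq, if_pos]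
    exact Finset.mem_union_right _ (Finset.mem_image_of_mem _ hi)
  refine ⟨(B.repr x).support.image wt, fun w hw => ?_⟩
  conv_lhs => rw [← B.linearCombination_repr x, Finsupp.linearCombination_apply, Finsupp.sum]
  rw [map_sum]
  refine Finset.sum_eq_zero fun i hi => ?_
  rw [map_smul, wproj_basis, if_neg, smul_zero]
  rintro rfl
  exact hw (Finset.mem_image_of_mem _ hi)

/-- The vectors of weight `w`. -/
def wpiece (w : Γ) : Submodule k F := LinearMap.range (wproj B wt w)

theorem mem_wpiece {w : Γ} {x : F} : x ∈ wpiece B wt w ↔ wproj B wt w x = x := by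
  refine ⟨?_, fun h => ⟨x, h⟩⟩
  rintro ⟨y, rfl⟩
  exact wproj_wproj_self B wt w y

theorem wpiece_finite {w : Γ} (h : {i | wt i = w}.Finite) :
    FiniteDimensional k (wpiece B wt w) := by
  classical
  have : wpiece B wt w ≤ Submodule.span k (B '' {i | wt i = w}) := by
    rintro _ ⟨x, rfl⟩
    rw [← B.linearCombination_repr x, Finsupp.linearCombination_apply, Finsupp.sum, map_sum]
    refine Submodule.sum_mem _ fun i _ => ?_
    rw [map_smul, wproj_basis]
    refine Submodule.smul_mem _ _ ?_
    split_ifs with hi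
    · exact Submodule.subset_span ⟨i, hi, rfl⟩
    · exact Submodule.zero_mem _
  have := FiniteDimensional.span_of_finite k (h.image B)
  exact Submodule.finiteDimensional_of_le ‹_›

/-- A subspace is graded if it contains the components of its elements. -/
def IsWGraded (P : Submodule k F) : Prop := ∀ w, ∀ x ∈ P, wproj B wt w x ∈ P

/-- The dimension of the piece of weight `w` of a subspace. -/
def wdim (P : Submodule k F) (w : Γ) : ℤ := Module.finrank k (P ⊓ wpiece B wt w : Submodule k F)

/-- An operator is of degree `γ` if it raises weights by `γ`. -/
def HasDegree [Add Γ] (X : Module.End k F) (γ : Γ) : Prop :=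
  ∀ w x, X (wproj B wt w x) = wproj B wt (w + γ) (X x)

theorem hasDegree_of_basis [Add Γ] [IsRightCancelAdd Γ] {X : Module.End k F} {γ : Γ}
    (h : ∀ i, X (B i) ∈ wpiece B wt (wt i + γ)) : HasDegree B wt X γ := by
  intro w x
  have h1 : X ∘ₗ wproj B wt w = wproj B wt (w + γ) ∘ₗ X := by
    refine B.ext fun i => ?_
    rw [LinearMap.comp_apply, LinearMap.comp_apply, wproj_basis, ← (mem_wpiece B wt).1 (h i)]
    split_ifs with hi
    · rw [hi, wproj_wproj_self, ← hi, (mem_wpiece B wt).1 (h i)]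
    · rw [map_zero, wproj_wproj_of_ne]
      exact fun h' => hi (add_right_cancel h').symm
  exact LinearMap.congr_fun h1 x

theorem finrank_map_add_finrank_inf_ker {F' : Type*} [AddCommGroup F'] [Module k F']
    (f : F →ₗ[k] F') (S : Submodule k F) [FiniteDimensional k S] :
    Module.finrank k (S.map f) + Module.finrank k (S ⊓ LinearMap.ker f : Submodule k F) =
      Module.finrank k S := by
  rw [← LinearMap.finrank_range_add_finrank_ker (f.domRestrict S), LinearMap.range_domRestrict,
    LinearMap.ker_domRestrict]
  congr 1
  rw [← Submodule.finrank_map_subtype_eq S, Submodule.map_comap_subtype]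

variable {B wt}

theorem wdim_add_wdim [AddGroup Γ] (hfin : ∀ w, FiniteDimensional k (wpiece B wt w))
    {X : Module.End k F} {γ : Γ} (hX : HasDegree B wt X γ) {P Q : Submodule k F}
    (hP : IsWGraded B wt P) (hQ : IsWGraded B wt Q) (w : Γ) :
    wdim B wt (P.map X ⊔ Q) w - wdim B wt Q w =
      wdim B wt P (w - γ) - wdim B wt (P ⊓ Q.comap X) (w - γ) := by
  have hw : w - γ + γ = w := sub_add_cancel w γ
  have h1 := finrank_map_add_finrank_inf_ker (Q.mkQ ∘ₗ X) (P ⊓ wpiece B wt (w - γ))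
  have h2 := finrank_map_add_finrank_inf_ker Q.mkQ ((P.map X ⊔ Q) ⊓ wpiece B wt w)
  have e1 : P ⊓ wpiece B wt (w - γ) ⊓ LinearMap.ker (Q.mkQ ∘ₗ X) =
      P ⊓ Q.comap X ⊓ wpiece B wt (w - γ) := by
    rw [LinearMap.ker_comp, Submodule.ker_mkQ, inf_right_comm]
  have e2 : (P.map X ⊔ Q) ⊓ wpiece B wt w ⊓ LinearMap.ker Q.mkQ = Q ⊓ wpiece B wt w := by
    rw [Submodule.ker_mkQ, inf_right_comm, inf_eq_right.2 (le_sup_right : Q ≤ P.map X ⊔ Q)]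
  have e3 : (P ⊓ wpiece B wt (w - γ)).map (Q.mkQ ∘ₗ X) =
      ((P.map X ⊔ Q) ⊓ wpiece B wt w).map Q.mkQ := by
    refine le_antisymm ?_ ?_
    · rintro _ ⟨x, ⟨hxP, hx⟩, rfl⟩
      refine ⟨X x, ⟨Submodule.mem_sup_left ⟨x, hxP, rfl⟩, ?_⟩, rfl⟩
      rw [SetLike.mem_coe, mem_wpiece] at hx ⊢
      conv_rhs => rw [← hx, hX, hw]
    · rintro _ ⟨y, ⟨hy, hyw⟩, rfl⟩
      obtain ⟨_, ⟨x, hx, rfl⟩, q, hq, rfl⟩ := Submodule.mem_sup.1 hy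
      refine ⟨wproj B wt (w - γ) x, ⟨hP _ _ hx, ⟨x, rfl⟩⟩, ?_⟩
      rw [SetLike.mem_coe, mem_wpiece] at hyw
      rw [LinearMap.comp_apply, hX, hw, ← hyw, map_add, map_add,
        (Submodule.Quotient.mk_eq_zero Q).2 (hQ w q hq) |> fun h => (show Q.mkQ _ = 0 from h),
        add_zero]
  rw [e1, e3] at h1
  rw [e2] at h2
  simp only [wdim]
  omega

end WeightedBasis

/-! ### Convolution and the theorem of Hilbert and Serre -/

section Conv

variable {Γ : Type*} [AddCommGroup Γ]

/-- The action of the group ring of `Γ` on functions on `Γ` by convolution. -/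
def conv : AddMonoidAlgebra ℤ Γ →ₐ[ℤ] Module.End ℤ (Γ → ℤ) :=
  AddMonoidAlgebra.lift ℤ (Module.End ℤ (Γ → ℤ)) Γ
    { toFun := fun γ => LinearMap.funLeft ℤ ℤ fun w => w - γ.toAdd
      map_one' := by ext h w; simp [LinearMap.funLeft]
      map_mul' := fun a b => by
        ext h w
        simp only [LinearMap.funLeft, Module.End.mul_apply]
        simp [sub_sub] }

theorem conv_apply (D : AddMonoidAlgebra ℤ Γ) (h : Γ → ℤ) (w : Γ) :
    conv D h w = D.coeff.sum fun d c => c * h (w - d) := by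
  rw [conv, AddMonoidAlgebra.lift_apply, Finsupp.sum, LinearMap.sum_apply, Finset.sum_apply]
  rfl

theorem conv_single (γ : Γ) (c : ℤ) (h : Γ → ℤ) (w : Γ) :
    conv (AddMonoidAlgebra.single γ c) h w = c * h (w - γ) := by
  rw [conv, AddMonoidAlgebra.lift_single]
  rfl

theorem conv_one_sub_single (γ : Γ) (h : Γ → ℤ) (w : Γ) :
    conv (1 - AddMonoidAlgebra.single γ 1) h w = h w - h (w - γ) := by
  rw [map_sub, map_one, LinearMap.sub_apply, Pi.sub_apply, conv_single, one_mul]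
  rfl

end Conv

section HilbertSerre

variable {k F I Γ J : Type*} [Field k] [Finite J] [AddCommGroup F] [Module k F]
  [Module (MvPolynomial J k) F] [IsScalarTower k (MvPolynomial J k) F]
  [Module.Finite (MvPolynomial J k) F] {B : Module.Basis I k F} [AddCommGroup Γ] {wt : I → Γ}

/-- The operator of multiplication by the variable `j`. -/
def varMul (k F : Type*) {J : Type*} [Field k] [AddCommGroup F] [Module k F]
    [Module (MvPolynomial J k) F] [IsScalarTower k (MvPolynomial J k) F] (j : J) :
    Module.End k F :=
  (LinearMap.lsmul (MvPolynomial J k) F (MvPolynomial.X j)).restrictScalars k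

omit [Finite J] [Module.Finite (MvPolynomial J k) F] in
/-- Polynomials act on `P / Q` by their constant terms if the variables act by zero. -/
theorem exists_smul_sub_mem {P Q : Submodule (MvPolynomial J k) F}
    (h : ∀ j, ∀ x ∈ P, (MvPolynomial.X j : MvPolynomial J k) • x ∈ Q) (f : MvPolynomial J k) :
    ∃ c : k, ∀ x ∈ P, f • x - c • x ∈ Q := by
  induction f using MvPolynomial.induction_on with
  | C a =>
    refine ⟨a, fun x _ => ?_⟩
    rw [← MvPolynomial.algebraMap_eq, algebraMap_smul, sub_self]
    exact Q.zero_mem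
  | add f g hf hg =>
    obtain ⟨a, ha⟩ := hf
    obtain ⟨b, hb⟩ := hg
    refine ⟨a + b, fun x hx => ?_⟩
    rw [add_smul, add_smul, add_sub_add_comm]
    exact Q.add_mem (ha x hx) (hb x hx)
  | mul_X f j _ =>
    refine ⟨0, fun x hx => ?_⟩
    rw [zero_smul, sub_zero, mul_smul]
    exact Q.smul_mem _ (h j x hx)

/-- The theorem of Hilbert and Serre for a subquotient `P / Q` that is killed by the variables
outside `s`. -/
theorem finite_support_conv (hfin : ∀ w, FiniteDimensional k (wpiece B wt w)) (γ : J → Γ)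
    (hγ : ∀ j, HasDegree B wt (varMul k F j) (γ j)) (s : Finset J)
    (P Q : Submodule (MvPolynomial J k) F) (hQP : Q ≤ P)
    (hP : IsWGraded B wt (P.restrictScalars k)) (hQ : IsWGraded B wt (Q.restrictScalars k))
    (hs : ∀ j ∉ s, ∀ x ∈ P, (MvPolynomial.X j : MvPolynomial J k) • x ∈ Q) :
    (Function.support (conv (∏ j ∈ s, (1 - AddMonoidAlgebra.single (γ j) 1))
      (wdim B wt (P.restrictScalars k) - wdim B wt (Q.restrictScalars k)))).Finite := by
  classical
  induction s using Finset.induction_on generalizing P Q with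
  | empty =>
    rw [Finset.prod_empty, map_one]
    obtain ⟨S, hS⟩ := (IsNoetherian.noetherian P : P.FG)
    choose T hT _ using fun x : F => exists_sum_wproj B wt x
    refine (S.biUnion T).finite_toSet.subset fun w hw => ?_
    by_contra hwT
    apply hw
    have hwT' : ∀ x ∈ S, wproj B wt w x = 0 := fun x hx =>
      hT x w fun h => hwT (Finset.mem_coe.2 (Finset.mem_biUnion.2 ⟨x, hx, h⟩))
    have key : ∀ x ∈ P, wproj B wt w x ∈ Q := by
      intro x hx
      rw [← hS] at hx
      induction hx using Submodule.span_induction with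
      | mem x hx => rw [hwT' x hx]; exact Q.zero_mem
      | zero => rw [map_zero]; exact Q.zero_mem
      | add x y _ _ hx hy => rw [map_add]; exact Q.add_mem hx hy
      | smul f x hx' hx =>
        rw [hS] at hx'
        obtain ⟨c, hc⟩ := exists_smul_sub_mem (fun j => hs j (Finset.notMem_empty j)) f
        have h1 := hQ w _ (hc x hx')
        have h2 : f • x = (f • x - c • x) + c • x := (sub_add_cancel _ _).symm
        rw [h2, map_add, map_smul]
        exact Q.add_mem h1 (Submodule.smul_of_tower_mem Q c hx)
    change wdim B wt _ w - wdim B wt _ w = 0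
    rw [sub_eq_zero, wdim, wdim]
    suffices h : P.restrictScalars k ⊓ wpiece B wt w = Q.restrictScalars k ⊓ wpiece B wt w by
      rw [h]
    refine le_antisymm ?_ ?_
    · rintro x ⟨hx, hxw⟩
      refine ⟨?_, hxw⟩
      rw [SetLike.mem_coe, mem_wpiece] at hxw
      rw [← hxw]
      exact key x hx
    · exact inf_le_inf_right _ hQP
  | insert j s hj ih =>
    rw [Finset.prod_insert hj, mul_comm, map_mul, Module.End.mul_apply]
    set X := varMul k F j with hX
    -- the cokernel `P / (x P + Q)` and the kernel `(P ∩ x⁻¹ Q) / Q` of multiplication by `x`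
    let P' : Submodule (MvPolynomial J k) F :=
      P.map (LinearMap.lsmul (MvPolynomial J k) F (MvPolynomial.X j)) ⊔ Q
    let Q' : Submodule (MvPolynomial J k) F :=
      P ⊓ Q.comap (LinearMap.lsmul (MvPolynomial J k) F (MvPolynomial.X j))
    have hP' : P'.restrictScalars k = (P.restrictScalars k).map X ⊔ Q.restrictScalars k := by
      ext x
      simp only [P', Submodule.restrictScalars_mem, Submodule.mem_sup, Submodule.mem_map]
      rfl
    have hQ' : Q'.restrictScalars k = P.restrictScalars k ⊓ (Q.restrictScalars k).comap X := rfl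
    have hXP : ∀ x ∈ P, X x ∈ P := fun x hx => P.smul_mem _ hx
    have hXQ : ∀ x ∈ Q, X x ∈ Q := fun x hx => Q.smul_mem _ hx
    have hP'P : P' ≤ P := by
      refine sup_le ?_ hQP
      rintro _ ⟨x, hx, rfl⟩
      exact P.smul_mem _ hx
    have hQQ' : Q ≤ Q' := le_inf hQP fun x hx => Q.smul_mem _ hx
    have hP'g : IsWGraded B wt (P'.restrictScalars k) := by
      intro w x hx
      rw [hP'] at hx ⊢
      obtain ⟨_, ⟨y, hy, rfl⟩, q, hq, rfl⟩ := Submodule.mem_sup.1 hx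
      rw [map_add]
      refine Submodule.add_mem_sup ⟨wproj B wt (w - γ j) y, hP _ _ hy, ?_⟩ (hQ _ _ hq)
      rw [hX, hγ j, sub_add_cancel]
    have hQ'g : IsWGraded B wt (Q'.restrictScalars k) := by
      rintro w x ⟨hx, hxq⟩
      refine ⟨hP _ _ hx, ?_⟩
      change X (wproj B wt w x) ∈ Q
      rw [hX, hγ j]
      exact hQ _ _ hxq
    have e : conv (1 - AddMonoidAlgebra.single (γ j) 1)
        (wdim B wt (P.restrictScalars k) - wdim B wt (Q.restrictScalars k)) =
        (wdim B wt (P.restrictScalars k) - wdim B wt (P'.restrictScalars k)) -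
        conv (AddMonoidAlgebra.single (γ j) 1)
          (wdim B wt (Q'.restrictScalars k) - wdim B wt (Q.restrictScalars k)) := by
      ext w
      have := wdim_add_wdim hfin (hγ j) hP hQ w
      rw [← hX, ← hP', ← hQ'] at this
      rw [conv_one_sub_single, Pi.sub_apply, Pi.sub_apply, Pi.sub_apply, Pi.sub_apply,
        conv_single, Pi.sub_apply, one_mul]
      linarith
    rw [e, map_sub]
    refine (Set.Finite.subset (Set.Finite.union (ih P P' hP'P hP hP'g ?_)
      ?_) (Function.support_sub _ _))
    · intro l hl x hx
      by_cases h : l = j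
      · subst h
        exact Submodule.mem_sup_left ⟨x, hx, rfl⟩
      · exact Submodule.mem_sup_right (hs l (by simp [h, hl]) x hx)
    · have h1 := ih Q' Q hQQ' hQ'g hQ ?_
      · rw [← Module.End.mul_apply, ← map_mul, mul_comm, map_mul, Module.End.mul_apply]
        refine (h1.image fun w => w + γ j).subset fun w hw => ⟨w - γ j, ?_, sub_add_cancel _ _⟩
        rw [Function.mem_support, conv_single, one_mul] at hw
        exact hw
      · rintro l hl x ⟨hx, hxq⟩
        by_cases h : l = j
        · subst h
          exact hxq
        · exact hs l (by simp [h, hl]) x hx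

end HilbertSerre

/-! ### Weights of tori -/

section Characters

variable {k : Type*} [Field k]

/-- Distinct characters are linearly independent, also with coefficients in a vector space. -/
theorem eq_zero_of_sum_char_smul {G Γ F : Type*} [Monoid G] [AddCommGroup F] [Module k F]
    {χ : Γ → G →* k} (hχ : Function.Injective χ) {s : Finset Γ} {y : Γ → F}
    (h : ∀ g, ∑ w ∈ s, χ w g • y w = 0) : ∀ w ∈ s, y w = 0 := by
  intro w hw
  rw [← Module.forall_dual_apply_eq_zero_iff k]
  intro f
  have hli := (linearIndependent_monoidHom G k).comp χ hχ
  rw [linearIndependent_iff'] at hli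
  refine hli s (fun w => f (y w)) ?_ w hw
  ext g
  have := congrArg f (h g)
  rw [map_sum, map_zero] at this
  rw [Finset.sum_apply, Pi.zero_apply, ← this]
  refine Finset.sum_congr rfl fun w _ => ?_
  rw [Pi.smul_apply, smul_eq_mul, map_smul, smul_eq_mul, mul_comm]
  rfl

/-- The character of weight `w` of the torus `(kˣ)^m × (kˣ)^n`, with the sign convention of
`gradedPiece`. -/
def wchar {m n : ℕ} (w : (Fin m → ℤ) × (Fin n → ℤ)) : (Fin m → kˣ) × Torus k n →* k :=
  (Units.coeHom k).comp
    { toFun := fun g => (∏ i, g.1 i ^ (-w.1 i)) * ∏ j, g.2 j ^ w.2 j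
      map_one' := by simp
      map_mul' := fun g h => by
        simp only [Prod.fst_mul, Prod.snd_mul, Pi.mul_apply, mul_zpow, Finset.prod_mul_distrib]
        exact mul_mul_mul_comm _ _ _ _ }

theorem wchar_apply {m n : ℕ} (w : (Fin m → ℤ) × (Fin n → ℤ)) (d : Fin m → kˣ) (t : Torus k n) :
    wchar w (d, t) = (((∏ i, d i ^ (-w.1 i)) * ∏ j, t j ^ w.2 j : kˣ) : k) := rfl

theorem wchar_injective [CharZero k] {m n : ℕ} :
    Function.Injective (wchar (k := k) (m := m) (n := n)) := by
  have h2 : (2 : k) ≠ 0 := two_ne_zero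
  have hinj : Function.Injective fun e : ℤ => (Units.mk0 (2 : k) h2) ^ e := by
    intro a b hab
    have h3 : ((2 : ℚ) : k) ^ a = ((2 : ℚ) : k) ^ b := by
      simpa using congrArg Units.val hab
    have h4 : (2 : ℚ) ^ a = 2 ^ b := by exact_mod_cast h3
    exact zpow_right_injective₀ (by norm_num) (by norm_num) h4
  intro w w' h
  ext i
  · have h1 := DFunLike.congr_fun h (Pi.mulSingle i (Units.mk0 (2 : k) h2), 1)
    rw [wchar_apply, wchar_apply, Units.val_inj] at h1
    have key : ∀ v : (Fin m → ℤ) × (Fin n → ℤ), ∏ l, (Pi.mulSingle i (Units.mk0 (2 : k) h2) :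
        Fin m → kˣ) l ^ (-v.1 l) = Units.mk0 (2 : k) h2 ^ (-v.1 i) := by
      intro v
      rw [Finset.prod_eq_single i]
      · simp
      · intro l _ hl
        simp [hl]
      · simp
    simp only [key, Pi.one_apply, one_zpow, Finset.prod_const_one, mul_one] at h1
    exact neg_injective (hinj h1)
  · have h1 := DFunLike.congr_fun h (1, Pi.mulSingle i (Units.mk0 (2 : k) h2))
    rw [wchar_apply, wchar_apply, Units.val_inj] at h1
    have key : ∀ v : (Fin m → ℤ) × (Fin n → ℤ), ∏ l, (Pi.mulSingle i (Units.mk0 (2 : k) h2) :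
        Fin n → kˣ) l ^ (v.2 l) = Units.mk0 (2 : k) h2 ^ (v.2 i) := by
      intro v
      rw [Finset.prod_eq_single i]
      · simp
      · intro l _ hl
        simp [hl]
      · simp
    simp only [key, Pi.one_apply, one_zpow, Finset.prod_const_one, one_mul] at h1
    exact hinj h1

/-- The character `t ^ b` of `T`. -/
def tchar {n : ℕ} (b : Fin n → ℤ) : Torus k n →* k :=
  (wchar (m := 0) (0, b)).comp (MonoidHom.inr _ _)

theorem tchar_apply {n : ℕ} (b : Fin n → ℤ) (t : Torus k n) :
    tchar b t = ((∏ j, t j ^ b j : kˣ) : k) := by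
  simp [tchar, wchar_apply]

theorem tchar_injective [CharZero k] {n : ℕ} : Function.Injective (tchar (k := k) (n := n)) := by
  intro b b' h
  have : wchar (k := k) (m := 0) (0, b) = wchar (0, b') := by
    refine MonoidHom.ext fun g => ?_
    have h1 := DFunLike.congr_fun h g.2
    rw [tchar_apply, tchar_apply] at h1
    rw [Units.val_inj] at h1
    rw [wchar_apply, wchar_apply]
    simp [h1]
  exact congrArg Prod.snd (wchar_injective this)

/-- A rational representation of `T` has a basis of weight vectors. -/
theorem exists_weight_basis [CharZero k] {n : ℕ} {V : Type*} [AddCommGroup V] [Module k V]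
    (τ : Representation k (Torus k n) V) (hτ : IsRationalTorusRep τ) :
    ∃ (s : Set V) (v : Module.Basis s k V) (β : s → Fin n → ℤ),
      ∀ t l, τ t (v l) = tchar (β l) t • v l := by
  classical
  obtain ⟨E, hE⟩ := hτ
  have hE' : ∀ t, τ t = ∑ b ∈ E.support, tchar b t • E b := by
    intro t
    rw [hE t, Finsupp.sum]
    simp only [tchar_apply]
  have h1 : ∀ t, ∀ b ∈ E.support, τ t * E b - tchar b t • E b = 0 := by
    intro t
    refine eq_zero_of_sum_char_smul (k := k) tchar_injective
      (y := fun b => τ t * E b - tchar b t • E b) fun s => ?_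
    have h2 : τ t * τ s = τ (s * t) := by rw [mul_comm s, map_mul]
    rw [hE' s, hE' (s * t), Finset.mul_sum, ← sub_eq_zero, ← Finset.sum_sub_distrib] at h2
    rw [← h2]
    refine Finset.sum_congr rfl fun b _ => ?_
    rw [smul_sub, mul_smul_comm, map_mul, smul_smul]
  let U : Set V := {x | ∃ b : Fin n → ℤ, ∀ t, τ t x = tchar b t • x}
  have hU : ⊤ ≤ Submodule.span k U := by
    intro x _
    have hx : x = ∑ b ∈ E.support, E b x := by
      have := LinearMap.congr_fun (hE' 1) x
      rw [map_one] at this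
      simpa using this
    rw [hx]
    refine Submodule.sum_mem _ fun b hb => Submodule.subset_span ⟨b, fun t => ?_⟩
    have := LinearMap.congr_fun (sub_eq_zero.1 (h1 t b hb)) x
    exact this
  have hmem : ∀ l, Module.Basis.ofSpan hU l ∈ U := fun l =>
    Module.Basis.ofSpan_subset hU ⟨l, rfl⟩
  exact ⟨_, Module.Basis.ofSpan hU, fun l => (hmem l).choose, fun t l => (hmem l).choose_spec t⟩

end Characters

section TensorBasis

variable {k : Type*} [Field k] {m n : ℕ} {V ι : Type*} [AddCommGroup V] [Module k V]

/-- The weight of `x^μ ⊗ v_l`, where `v_l` has weight `β l`. -/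
def twt (m : ℕ) (β : ι → Fin n → ℤ) (i : (Fin m × Fin n →₀ ℕ) × ι) :
    (Fin m → ℤ) × (Fin n → ℤ) :=
  (fun a => ∑ p, (i.1 (a, p) : ℤ), fun p => ∑ a, (i.1 (a, p) : ℤ) + β i.2 p)

/-- The basis of the vectors `x^μ ⊗ v_l` of `R_m ⊗ V`. -/
def tbasis (m n : ℕ) (v : Module.Basis ι k V) :
    Module.Basis ((Fin m × Fin n →₀ ℕ) × ι) k (MatRing k m n ⊗[k] V) :=
  (MvPolynomial.basisMonomials (Fin m × Fin n) k).tensorProduct v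

theorem tbasis_apply (v : Module.Basis ι k V) (μ : Fin m × Fin n →₀ ℕ) (l : ι) :
    tbasis m n v (μ, l) = MvPolynomial.monomial μ 1 ⊗ₜ v l := by
  simp [tbasis, Module.Basis.tensorProduct_apply]

variable {v : Module.Basis ι k V} {β : ι → Fin n → ℤ}

theorem tbasis_mem_wpiece (i : (Fin m × Fin n →₀ ℕ) × ι) :
    tbasis m n v i ∈ wpiece (tbasis m n v) (twt m β) (twt m β i) := by
  rw [mem_wpiece, wproj_basis, if_pos rfl]

theorem finite_twt_fst [Finite ι] (a : Fin m → ℤ) :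
    {i | (twt m β i).1 = a}.Finite := by
  let bd : Fin m × Fin n →₀ ℕ := Finsupp.equivFunOnFinite.symm fun p => (a p.1).toNat
  refine ((Set.finite_Iic bd).prod (Set.finite_univ (α := ι))).subset ?_
  rintro ⟨μ, l⟩ h
  refine ⟨fun p => ?_, Set.mem_univ _⟩
  have h1 : ∑ q, (μ (p.1, q) : ℤ) = a p.1 := congrFun h p.1
  have h2 : (μ (p.1, p.2) : ℤ) ≤ ∑ q, (μ (p.1, q) : ℤ) :=
    Finset.single_le_sum (f := fun q => (μ (p.1, q) : ℤ)) (fun _ _ => Int.natCast_nonneg _)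
      (Finset.mem_univ p.2)
  change μ (p.1, p.2) ≤ (a p.1).toNat
  omega

theorem finite_twt_snd [Finite ι] (b : Fin n → ℤ) :
    {i | (twt m β i).2 = b}.Finite := by
  have : {i | (twt m β i).2 = b} ⊆ ⋃ l : ι, (Set.Iic (Finsupp.equivFunOnFinite.symm
      fun p : Fin m × Fin n => (b p.2 - β l p.2).toNat)) ×ˢ {l} := by
    rintro ⟨μ, l⟩ h
    refine Set.mem_iUnion.2 ⟨l, fun p => ?_, rfl⟩
    have h1 : ∑ a, (μ (a, p.2) : ℤ) + β l p.2 = b p.2 := congrFun h p.2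
    have h2 : (μ (p.1, p.2) : ℤ) ≤ ∑ a, (μ (a, p.2) : ℤ) :=
      Finset.single_le_sum (f := fun a => (μ (a, p.2) : ℤ)) (fun _ _ => Int.natCast_nonneg _)
        (Finset.mem_univ p.1)
    change μ (p.1, p.2) ≤ (b p.2 - β l p.2).toNat
    omega
  exact (Set.finite_iUnion fun l => (Set.finite_Iic _).prod (Set.finite_singleton l)).subset this

theorem wpiece_twt_finite [Finite ι] (w : (Fin m → ℤ) × (Fin n → ℤ)) :
    FiniteDimensional k (wpiece (tbasis m n v) (twt m β) w) :=
  wpiece_finite _ _ ((finite_twt_fst w.1).subset fun _ h => congrArg Prod.fst h)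

theorem twt_add_single (μ : Fin m × Fin n →₀ ℕ) (p : Fin m × Fin n) (l : ι) :
    twt m β (μ + Finsupp.single p 1, l) = twt m β (μ, l) + (Pi.single p.1 1, Pi.single p.2 1) := by
  obtain ⟨a, q⟩ := p
  ext c
  · simp only [twt, Finsupp.add_apply, Prod.fst_add, Pi.add_apply, Nat.cast_add,
      Finset.sum_add_distrib, Finsupp.single_apply, Prod.mk.injEq]
    congr 1
    by_cases h : a = c
    · subst h; simp
    · simp [h, Ne.symm h]
  · simp only [twt, Finsupp.add_apply, Prod.snd_add, Pi.add_apply, Nat.cast_add,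
      Finset.sum_add_distrib, Finsupp.single_apply, Prod.mk.injEq]
    rw [add_right_comm]
    congr 1
    by_cases h : q = c
    · subst h; simp
    · simp [h, Ne.symm h]

theorem hasDegree_varMul (p : Fin m × Fin n) :
    HasDegree (tbasis m n v) (twt m β) (varMul k (MatRing k m n ⊗[k] V) p)
      (Pi.single p.1 1, Pi.single p.2 1) := by
  refine hasDegree_of_basis _ _ fun i => ?_
  obtain ⟨μ, l⟩ := i
  have h : varMul k (MatRing k m n ⊗[k] V) p (tbasis m n v (μ, l)) =
      tbasis m n v (μ + Finsupp.single p 1, l) := by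
    rw [tbasis_apply, tbasis_apply]
    change (MvPolynomial.X p : MatRing k m n) • (MvPolynomial.monomial μ (1 : k) ⊗ₜ[k] v l) = _
    rw [TensorProduct.smul_tmul', smul_eq_mul, MvPolynomial.X, MvPolynomial.monomial_mul, one_mul,
      add_comm]
  rw [h, ← twt_add_single]
  exact tbasis_mem_wpiece _

theorem coordAct_diagGL_X (d : Fin m → kˣ) (t : Torus k n) (p : Fin m × Fin n) :
    coordAct (diagGL d, t) (MvPolynomial.X p : MatRing k m n) =
      (((d p.1)⁻¹ * t p.2 : kˣ) : k) • MvPolynomial.X p := by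
  have hd : ((diagGL d)⁻¹ : Matrix.GeneralLinearGroup (Fin m) k).val =
      Matrix.diagonal fun i => (((d i)⁻¹ : kˣ) : k) := by
    rw [diagGL, ← map_inv]
    simp [Matrix.diagonalRingHom, MulEquiv.piUnits]
    rfl
  rw [coordAct, MvPolynomial.aeval_X, Finset.sum_eq_single p.1]
  · rw [hd, Matrix.diagonal_apply_eq, MvPolynomial.smul_eq_C_mul, Units.val_mul]
  · intro l _ hl
    rw [hd, Matrix.diagonal_apply_ne _ hl.symm, zero_mul, map_zero, zero_mul]
  · simp

theorem tensorAct_diagGL (τ : Representation k (Torus k n) V)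
    (hτ : ∀ t l, τ t (v l) = tchar (β l) t • v l) (d : Fin m → kˣ) (t : Torus k n)
    (i : (Fin m × Fin n →₀ ℕ) × ι) :
    tensorAct τ (diagGL d, t) (tbasis m n v i) = wchar (twt m β i) (d, t) • tbasis m n v i := by
  obtain ⟨μ, l⟩ := i
  rw [tbasis_apply, tensorAct, TensorProduct.map_tmul, hτ, AlgHom.toLinearMap_apply]
  have h : coordAct (diagGL d, t) (MvPolynomial.monomial μ (1 : k)) =
      ((∏ p, ((d p.1)⁻¹ * t p.2) ^ μ p : kˣ) : k) • MvPolynomial.monomial μ 1 := by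
    rw [MvPolynomial.monomial_eq, map_one, one_mul, Finsupp.prod_fintype _ _ (by simp), map_prod]
    simp only [map_pow, coordAct_diagGL_X, smul_pow]
    rw [Finset.prod_smul]
    simp
  rw [h, TensorProduct.tmul_smul, TensorProduct.smul_tmul', smul_smul]
  congr 1
  rw [wchar_apply, tchar_apply, ← Units.val_mul]
  congr 1
  simp only [twt, mul_pow, Finset.prod_mul_distrib, zpow_add, Fintype.prod_prod_type]
  rw [mul_comm (∏ j, t j ^ β l j), mul_assoc]
  refine congrArg Units.val ?_
  congr 1
  · refine Finset.prod_congr rfl fun a _ => ?_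
    rw [Finset.prod_pow_eq_pow_sum, zpow_neg, inv_pow, ← zpow_natCast]
    push_cast
    rfl
  · congr 1
    rw [Finset.prod_comm]
    refine Finset.prod_congr rfl fun q _ => ?_
    rw [Finset.prod_pow_eq_pow_sum, ← zpow_natCast]
    push_cast
    rfl

variable {τ : Representation k (Torus k n) V}

theorem tensorAct_wproj (hτ : ∀ t l, τ t (v l) = tchar (β l) t • v l) (d : Fin m → kˣ)
    (t : Torus k n) (w : (Fin m → ℤ) × (Fin n → ℤ)) (x : MatRing k m n ⊗[k] V) :
    tensorAct τ (diagGL d, t) (wproj (tbasis m n v) (twt m β) w x) =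
      wchar w (d, t) • wproj (tbasis m n v) (twt m β) w x := by
  have h : tensorAct τ (diagGL d, t) ∘ₗ wproj (tbasis m n v) (twt m β) w =
      wchar w (d, t) • wproj (tbasis m n v) (twt m β) w := by
    refine (tbasis m n v).ext fun i => ?_
    rw [LinearMap.comp_apply, LinearMap.smul_apply, wproj_basis]
    split_ifs with hi
    · rw [tensorAct_diagGL τ hτ, hi]
    · rw [map_zero, smul_zero]
  exact LinearMap.congr_fun h x

/-- A torus-stable subspace is graded. -/
theorem isWGraded_of_stable [CharZero k] (hτ : ∀ t l, τ t (v l) = tchar (β l) t • v l)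
    {P : Submodule k (MatRing k m n ⊗[k] V)}
    (hP : ∀ (d : Fin m → kˣ) (t : Torus k n), ∀ x ∈ P, tensorAct τ (diagGL d, t) x ∈ P) :
    IsWGraded (tbasis m n v) (twt m β) P := by
  intro w x hx
  obtain ⟨s, hs, hsum⟩ := exists_sum_wproj (tbasis m n v) (twt m β) x
  by_cases hw : w ∈ s
  · rw [← Submodule.Quotient.mk_eq_zero]
    refine eq_zero_of_sum_char_smul (k := k) (χ := wchar) wchar_injective (s := s)
      (y := fun w => P.mkQ (wproj (tbasis m n v) (twt m β) w x)) (fun g => ?_) w hw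
    obtain ⟨d, t⟩ := g
    have h := hP d t x hx
    rw [← hsum, map_sum] at h
    simp only [tensorAct_wproj hτ] at h
    rw [← (Submodule.Quotient.mk_eq_zero P).2 h]
    change _ = P.mkQ _
    rw [map_sum]
    exact Finset.sum_congr rfl fun w _ => (map_smul _ _ _).symm
  · rw [hs w hw]
    exact P.zero_mem

theorem gradedPiece_eq_map [CharZero k] (hτ : ∀ t l, τ t (v l) = tchar (β l) t • v l)
    {M : Type*} [AddCommGroup M] [Module k M] [Module (MatRing k m n) M]
    [IsScalarTower k (MatRing k m n) M] {σ : Representation k (GrpG k m n) M}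
    {φ : MatRing k m n ⊗[k] V →ₗ[MatRing k m n] M} (hφ : IsEquivariantPresentation τ σ φ)
    (w : (Fin m → ℤ) × (Fin n → ℤ)) :
    gradedPiece σ w =
      (wpiece (tbasis m n v) (twt m β) w).map (φ.restrictScalars k) := by
  classical
  refine le_antisymm ?_ ?_
  · intro y hy
    obtain ⟨x, rfl⟩ := hφ.surjective y
    obtain ⟨s, hs, hsum⟩ := exists_sum_wproj (tbasis m n v) (twt m β) x
    refine ⟨wproj (tbasis m n v) (twt m β) w x, ⟨x, rfl⟩, ?_⟩
    have h := eq_zero_of_sum_char_smul (k := k) (χ := wchar) wchar_injective (s := insert w s)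
      (y := fun w' => φ (wproj (tbasis m n v) (twt m β) w' x) - if w' = w then φ x else 0)
      (fun g => ?_) w (Finset.mem_insert_self _ _)
    · rw [if_pos rfl, sub_eq_zero] at h
      exact h
    · obtain ⟨d, t⟩ := g
      have h1 := hy d t
      rw [← hφ.equivariant] at h1
      have h2 : x = ∑ w' ∈ insert w s, wproj (tbasis m n v) (twt m β) w' x := by
        rw [← Finset.sum_subset (Finset.subset_insert w s) fun w' _ hw' => hs w' hw', hsum]
      conv_lhs at h1 => rw [h2, map_sum, map_sum]
      simp only [smul_sub, Finset.sum_sub_distrib, smul_ite, smul_zero]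
      rw [Finset.sum_ite_eq', if_pos (Finset.mem_insert_self _ _), sub_eq_zero, wchar_apply w,
        ← h1]
      refine Finset.sum_congr rfl fun w' _ => ?_
      rw [tensorAct_wproj hτ]
      exact ((φ.restrictScalars k).map_smul _ _).symm
  · rintro _ ⟨x, hx, rfl⟩ d t
    rw [SetLike.mem_coe, mem_wpiece] at hx
    change σ (diagGL d, t) (φ x) = _ • φ x
    rw [← hφ.equivariant, ← hx, tensorAct_wproj hτ]
    exact (φ.restrictScalars k).map_smul _ _

theorem gradedPiece_finite_and_finrank [CharZero k] [Finite ι]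
    (hτ : ∀ t l, τ t (v l) = tchar (β l) t • v l)
    {M : Type*} [AddCommGroup M] [Module k M] [Module (MatRing k m n) M]
    [IsScalarTower k (MatRing k m n) M] {σ : Representation k (GrpG k m n) M}
    {φ : MatRing k m n ⊗[k] V →ₗ[MatRing k m n] M} (hφ : IsEquivariantPresentation τ σ φ)
    (w : (Fin m → ℤ) × (Fin n → ℤ)) :
    FiniteDimensional k (gradedPiece σ w) ∧
    (Module.finrank k (gradedPiece σ w) : ℤ) = wdim (tbasis m n v) (twt m β) ⊤ w -
      wdim (tbasis m n v) (twt m β) ((LinearMap.ker φ).restrictScalars k) w := by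
  have := wpiece_twt_finite (v := v) (β := β) w
  rw [gradedPiece_eq_map hτ hφ w]
  refine ⟨inferInstance, ?_⟩
  have h := finrank_map_add_finrank_inf_ker (φ.restrictScalars k)
    (wpiece (tbasis m n v) (twt m β) w)
  have h2 : LinearMap.ker (φ.restrictScalars k) = (LinearMap.ker φ).restrictScalars k := rfl
  rw [wdim, wdim, top_inf_eq, inf_comm, ← h2]
  omega

end TensorBasis

/-! ### Stable subspaces and the polarization operators -/

section PolynomialFamilies

variable {k : Type*} [Field k] [CharZero k] {F : Type*} [AddCommGroup F] [Module k F]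

omit [CharZero k] in
/-- If a polynomial curve lies in a subspace for infinitely many parameters, then its coefficients
lie in this subspace. -/
theorem coeff_mem_of_infinite {P : Submodule k F} (c : ℕ →₀ F) {S : Set k} (hS : S.Infinite)
    (h : ∀ s ∈ S, (c.sum fun e y => s ^ e • y) ∈ P) (e : ℕ) : c e ∈ P := by
  classical
  rw [← Submodule.Quotient.mk_eq_zero, ← Module.forall_dual_apply_eq_zero_iff k]
  intro f
  let p : Polynomial k := ∑ e ∈ c.support, Polynomial.monomial e (f (P.mkQ (c e)))
  have hp : p = 0 := by
    refine Polynomial.eq_zero_of_infinite_isRoot p (hS.mono fun s hs => ?_)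
    have h1 := congrArg f ((Submodule.Quotient.mk_eq_zero P).2 (h s hs))
    change f (P.mkQ _) = f 0 at h1
    rw [map_zero, Finsupp.sum, map_sum, map_sum] at h1
    change p.eval s = 0
    rw [Polynomial.eval_finsetSum, ← h1]
    refine Finset.sum_congr rfl fun e _ => ?_
    rw [map_smul, map_smul, Polynomial.eval_monomial, smul_eq_mul, mul_comm]
  have h2 := congrArg (Polynomial.coeff · e) hp
  simp only [p, Polynomial.finsetSum_coeff, Polynomial.coeff_monomial, Finset.sum_ite_eq',
    Polynomial.coeff_zero] at h2
  split_ifs at h2 with h3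
  · exact h2
  · rw [Finsupp.notMem_support_iff.1 h3]
    exact (congrArg f (map_zero P.mkQ)).trans (map_zero f)

theorem infinite_setOf_isUnit_add_smul_one {m : ℕ} (A : Matrix (Fin m) (Fin m) k) :
    {s : k | IsUnit (A + s • (1 : Matrix (Fin m) (Fin m) k))}.Infinite := by
  have h : {s : k | (-A).charpoly.IsRoot s}.Finite :=
    Polynomial.finite_setOfPred_isRoot (Matrix.charpoly_monic _).ne_zero
  refine h.infinite_compl.mono fun s hs => ?_
  rw [Set.mem_ofPred_eq, Matrix.isUnit_iff_isUnit_det, isUnit_iff_ne_zero]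
  intro h0
  apply hs
  rw [Set.mem_ofPred_eq, Polynomial.IsRoot, Matrix.eval_charpoly, ← h0]
  congr 1
  rw [sub_neg_eq_add, add_comm, Matrix.scalar_apply, ← Matrix.smul_one_eq_diagonal]

end PolynomialFamilies

section MatAct

variable {k : Type*} [Field k] {m n : ℕ} {V : Type*} [AddCommGroup V] [Module k V]

/-- The substitution `x ↦ A x` on `R_m`, for an arbitrary square matrix `A`. -/
def matAct (A : Matrix (Fin m) (Fin m) k) : MatRing k m n →ₐ[k] MatRing k m n :=
  MvPolynomial.aeval fun p => ∑ l, MvPolynomial.C (A p.1 l) * MvPolynomial.X (l, p.2)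

theorem coordAct_eq_matAct (g : Matrix.GeneralLinearGroup (Fin m) k) :
    coordAct ((g, 1) : GrpG k m n) = matAct (g⁻¹).val := by
  refine MvPolynomial.algHom_ext fun p => ?_
  simp [coordAct, matAct]

theorem tensorAct_eq_matAct (τ : Representation k (Torus k n) V)
    (g : Matrix.GeneralLinearGroup (Fin m) k) :
    tensorAct τ ((g, 1) : GrpG k m n) =
      LinearMap.rTensor V (matAct (g⁻¹).val : MatRing k m n →ₐ[k] _).toLinearMap := by
  rw [tensorAct, coordAct_eq_matAct, map_one]
  rfl

theorem tensorAct_mul (τ : Representation k (Torus k n) V) (g h : GrpG k m n) :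
    tensorAct τ (g * h) = tensorAct τ g ∘ₗ tensorAct τ h := by
  rw [tensorAct, tensorAct, tensorAct, ← TensorProduct.map_comp, coordAct_mul, Prod.snd_mul,
    map_mul]
  rfl

theorem tensorAct_one (τ : Representation k (Torus k n) V) :
    tensorAct τ (1 : GrpG k m n) = LinearMap.id := by
  rw [tensorAct, coordAct_one, Prod.snd_one, map_one]
  exact TensorProduct.map_id

/-- The permutation of the rows of the matrix of variables. -/
def rowPerm (w : Equiv.Perm (Fin m)) : MatRing k m n →ₐ[k] MatRing k m n :=
  MvPolynomial.rename (Prod.map w id)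

theorem rowPerm_eq_matAct (w : Equiv.Perm (Fin m)) :
    (rowPerm w : MatRing k m n →ₐ[k] _) = matAct (w.permMatrix k) := by
  refine MvPolynomial.algHom_ext fun p => ?_
  rw [rowPerm, MvPolynomial.rename_X, matAct, MvPolynomial.aeval_X, Finset.sum_eq_single (w p.1)]
  · simp [Equiv.Perm.permMatrix, PEquiv.toMatrix_apply]
    rfl
  · intro l _ hl
    simp [Equiv.Perm.permMatrix, PEquiv.toMatrix_apply, hl.symm]
  · simp

/-- The curve `s ↦ matAct (A + s B)`. -/
def matCurve (A B : Matrix (Fin m) (Fin m) k) :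
    MatRing k m n →ₐ[k] Polynomial (MatRing k m n) :=
  MvPolynomial.aeval fun p => Polynomial.C (∑ l, MvPolynomial.C (A p.1 l) * MvPolynomial.X (l, p.2))
    + Polynomial.X * Polynomial.C (∑ l, MvPolynomial.C (B p.1 l) * MvPolynomial.X (l, p.2))

theorem eval_matCurve (A B : Matrix (Fin m) (Fin m) k) (s : k) (f : MatRing k m n) :
    (matCurve A B f).eval (MvPolynomial.C s) = matAct (A + s • B) f := by
  have h : ((Polynomial.aeval (R := MatRing k m n) (MvPolynomial.C s)).restrictScalars k).comp
      (matCurve A B) =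
      (matAct (A + s • B) : MatRing k m n →ₐ[k] _) := by
    refine MvPolynomial.algHom_ext fun p => ?_
    rw [AlgHom.comp_apply, matCurve, MvPolynomial.aeval_X, matAct, MvPolynomial.aeval_X,
      AlgHom.restrictScalars_apply, Polynomial.coe_aeval_eq_eval]
    simp only [Polynomial.eval_add, Polynomial.eval_mul, Polynomial.eval_C, Polynomial.eval_X,
      Matrix.add_apply, Matrix.smul_apply, smul_eq_mul, map_add, map_mul, add_mul,
      Finset.sum_add_distrib, Finset.mul_sum, mul_assoc]
  have h1 := DFunLike.congr_fun h f
  rw [AlgHom.comp_apply, AlgHom.restrictScalars_apply, Polynomial.coe_aeval_eq_eval] at h1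
  exact h1

theorem coeff_zero_matCurve (A B : Matrix (Fin m) (Fin m) k) (f : MatRing k m n) :
    (matCurve A B f).coeff 0 = matAct A f := by
  rw [Polynomial.coeff_zero_eq_eval_zero]
  have := eval_matCurve A B 0 f
  rwa [map_zero, zero_smul, add_zero] at this

theorem matAct_one : (matAct 1 : MatRing k m n →ₐ[k] _) = AlgHom.id k _ := by
  refine MvPolynomial.algHom_ext fun p => ?_
  rw [matAct, MvPolynomial.aeval_X, Finset.sum_eq_single p.1]
  · simp
  · intro l _ hl
    simp [Matrix.one_apply_ne hl.symm]
  · simp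

/-- The polarization operators are the derivatives of the action of matrices at the identity. -/
theorem coeff_one_matCurve (i j : Fin m) (f : MatRing k m n) :
    (matCurve 1 (Matrix.single j i 1) f).coeff 1 = polarEnd i j f := by
  change _ = polar i j f
  induction f using MvPolynomial.induction_on with
  | C a =>
    have h1 : matCurve (n := n) (1 : Matrix (Fin m) (Fin m) k) (Matrix.single j i 1)
        (MvPolynomial.C a) = Polynomial.C (MvPolynomial.C a) := by
      rw [matCurve, MvPolynomial.algHom_C]
      rfl
    have h2 : polar (n := n) i j (MvPolynomial.C a) = 0 := by
      rw [← MvPolynomial.algebraMap_eq, Derivation.map_algebraMap]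
    rw [h1, h2, Polynomial.coeff_C_of_ne_zero one_ne_zero]
  | add f g hf hg => rw [map_add, Polynomial.coeff_add, hf, hg, map_add]
  | mul_X f p hf =>
    rw [map_mul, Polynomial.mul_coeff_one, hf, coeff_zero_matCurve, coeff_zero_matCurve, matAct_one,
      AlgHom.id_apply, AlgHom.id_apply, Derivation.leibniz, polar_X, smul_eq_mul, smul_eq_mul,
      mul_comm (polar i j f)]
    congr 2
    rw [matCurve, MvPolynomial.aeval_X]
    simp only [Polynomial.coeff_add, Polynomial.coeff_C_of_ne_zero one_ne_zero, zero_add,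
      Polynomial.coeff_X_mul, Polynomial.coeff_C_zero, Matrix.single_apply]
    split_ifs with h
    · rw [Finset.sum_eq_single i]
      · simp [h]
      · intro l _ hl
        simp [hl.symm]
      · simp
    · refine Finset.sum_eq_zero fun l _ => ?_
      rw [if_neg fun h' => h h'.1.symm, map_zero, zero_mul]

/-- The curve `s ↦ matAct (A + s B) x` in `R_m ⊗ V` is polynomial; its coefficients in degree zero
and, for `A = 1` and `B` a matrix unit, in degree one are known. -/
theorem exists_matCurve (A B : Matrix (Fin m) (Fin m) k) (x : MatRing k m n ⊗[k] V) :
    ∃ c : ℕ →₀ MatRing k m n ⊗[k] V,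
      (∀ s : k, LinearMap.rTensor V (matAct (A + s • B)).toLinearMap x =
        c.sum fun e y => s ^ e • y) ∧
      c 0 = LinearMap.rTensor V (matAct A).toLinearMap x ∧
      ∀ i j, A = 1 → B = Matrix.single j i 1 → c 1 = LinearMap.rTensor V (polarEnd i j) x := by
  induction x using TensorProduct.induction_on with
  | zero => exact ⟨0, by simp, by simp, by simp⟩
  | tmul f y =>
    refine ⟨Finsupp.onFinset (matCurve A B f).support
      (fun e => (matCurve A B f).coeff e ⊗ₜ y) fun e he => ?_, fun s => ?_, ?_, ?_⟩
    · rw [Polynomial.mem_support_iff]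
      rintro h
      rw [h, TensorProduct.zero_tmul] at he
      exact he rfl
    · rw [Finsupp.onFinset_sum _ (fun e => smul_zero _), LinearMap.rTensor_tmul,
        AlgHom.toLinearMap_apply, ← eval_matCurve, Polynomial.eval_eq_sum, Polynomial.sum,
        TensorProduct.sum_tmul]
      refine Finset.sum_congr rfl fun e _ => ?_
      rw [TensorProduct.smul_tmul', ← map_pow, mul_comm, MvPolynomial.smul_eq_C_mul]
    · rw [Finsupp.onFinset_apply, coeff_zero_matCurve]
      rfl
    · rintro i j rfl rfl
      rw [Finsupp.onFinset_apply, coeff_one_matCurve]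
      rfl
  | add x y hx hy =>
    obtain ⟨c, h1, h2, h3⟩ := hx
    obtain ⟨c', h1', h2', h3'⟩ := hy
    refine ⟨c + c', fun s => ?_, ?_, fun i j hA hB => ?_⟩
    · rw [map_add, h1, h1', Finsupp.sum_add_index' (fun e => smul_zero _)
        fun e y z => smul_add _ _ _]
    · rw [Finsupp.add_apply, h2, h2', map_add]
    · rw [Finsupp.add_apply, h3 i j hA hB, h3' i j hA hB, map_add]

/-- A subspace of `R_m ⊗ V` that is stable under `G_m`. -/
def IsGStable (τ : Representation k (Torus k n) V)
    (P : Submodule k (MatRing k m n ⊗[k] V)) : Prop :=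
  ∀ (g : GrpG k m n), ∀ x ∈ P, tensorAct τ g x ∈ P

variable [CharZero k] {τ : Representation k (Torus k n) V}
  {P : Submodule k (MatRing k m n ⊗[k] V)}

/-- A `GL_m`-stable subspace is stable under all matrices, since `GL_m` is dense. -/
theorem IsGStable.matAct_mem (hP : IsGStable τ P) (A : Matrix (Fin m) (Fin m) k)
    {x : MatRing k m n ⊗[k] V} (hx : x ∈ P) :
    LinearMap.rTensor V (matAct A).toLinearMap x ∈ P := by
  obtain ⟨c, h1, h2, -⟩ := exists_matCurve A 1 x
  rw [← h2]
  refine coeff_mem_of_infinite c (infinite_setOf_isUnit_add_smul_one A) (fun s hs => ?_) 0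
  obtain ⟨g, hg⟩ := hs
  rw [← h1, ← hg]
  have := hP (g⁻¹, 1) x hx
  rwa [tensorAct_eq_matAct, inv_inv] at this

theorem IsGStable.polarEnd_mem (hP : IsGStable τ P) (i j : Fin m)
    {x : MatRing k m n ⊗[k] V} (hx : x ∈ P) : LinearMap.rTensor V (polarEnd i j) x ∈ P := by
  obtain ⟨c, h1, -, h3⟩ := exists_matCurve 1 (Matrix.single j i 1) x
  rw [← h3 i j rfl rfl]
  refine coeff_mem_of_infinite c (S := Set.univ) Set.infinite_univ (fun s _ => ?_) 1
  rw [← h1]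
  exact hP.matAct_mem _ hx

theorem IsGStable.rowPerm_mem (hP : IsGStable τ P) (w : Equiv.Perm (Fin m))
    {x : MatRing k m n ⊗[k] V} (hx : x ∈ P) :
    LinearMap.rTensor V (rowPerm w).toLinearMap x ∈ P := by
  rw [rowPerm_eq_matAct]
  exact hP.matAct_mem _ hx

variable {ι : Type*} {v : Module.Basis ι k V} {β : ι → Fin n → ℤ}

theorem IsGStable.isWGraded (hP : IsGStable τ P) (hτ : ∀ t l, τ t (v l) = tchar (β l) t • v l) :
    IsWGraded (tbasis m n v) (twt m β) P :=
  isWGraded_of_stable hτ fun _ _ x hx => hP _ x hx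

omit [CharZero k] in
theorem IsGStable.inf {P Q : Submodule k (MatRing k m n ⊗[k] V)} (hP : IsGStable τ P)
    (hQ : IsGStable τ Q) : IsGStable τ (P ⊓ Q) :=
  fun g x hx => ⟨hP g x hx.1, hQ g x hx.2⟩

/-- The vectors of `T`-weight `b` in `R_m ⊗ V`. -/
def colPiece (m : ℕ) (v : Module.Basis ι k V) (β : ι → Fin n → ℤ) (b : Fin n → ℤ) :
    Submodule k (MatRing k m n ⊗[k] V) :=
  wpiece (tbasis m n v) (fun i => (twt m β i).2) b

omit [CharZero k] in
theorem tensorAct_torus_wproj (hτ : ∀ t l, τ t (v l) = tchar (β l) t • v l) (t : Torus k n)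
    (b : Fin n → ℤ) (x : MatRing k m n ⊗[k] V) :
    tensorAct τ (1, t) (wproj (tbasis m n v) (fun i => (twt m β i).2) b x) =
      tchar b t • wproj (tbasis m n v) (fun i => (twt m β i).2) b x := by
  have h : tensorAct τ (1, t) ∘ₗ wproj (tbasis m n v) (fun i => (twt m β i).2) b =
      tchar b t • wproj (tbasis m n v) (fun i => (twt m β i).2) b := by
    refine (tbasis m n v).ext fun i => ?_
    rw [LinearMap.comp_apply, LinearMap.smul_apply, wproj_basis]
    split_ifs with hi
    · have h1 := tensorAct_diagGL (m := m) τ hτ 1 t i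
      have h2 : (diagGL 1 : Matrix.GeneralLinearGroup (Fin m) k) = 1 := by
        rw [diagGL, map_one, map_one]
      rw [h2] at h1
      rw [h1, wchar_apply, tchar_apply, hi]
      simp
    · rw [map_zero, smul_zero]
  exact LinearMap.congr_fun h x

theorem mem_colPiece (hτ : ∀ t l, τ t (v l) = tchar (β l) t • v l) {b : Fin n → ℤ}
    {x : MatRing k m n ⊗[k] V} :
    x ∈ colPiece m v β b ↔ ∀ t, tensorAct τ (1, t) x = tchar b t • x := by
  classical
  refine ⟨?_, fun hx => ?_⟩
  · rintro ⟨x, rfl⟩ t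
    exact tensorAct_torus_wproj hτ t b x
  · rw [colPiece, mem_wpiece]
    obtain ⟨s, hs, hsum⟩ := exists_sum_wproj (tbasis m n v) (fun i => (twt m β i).2) x
    have h := eq_zero_of_sum_char_smul (k := k) (χ := tchar) tchar_injective (s := insert b s)
      (y := fun c => wproj (tbasis m n v) (fun i => (twt m β i).2) c x - if c = b then x else 0)
      (fun t => ?_) b (Finset.mem_insert_self _ _)
    · rw [if_pos rfl, sub_eq_zero] at h
      exact h
    · have h1 := hx t
      have h2 : x = ∑ c ∈ insert b s, wproj (tbasis m n v) (fun i => (twt m β i).2) c x := by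
        rw [← Finset.sum_subset (Finset.subset_insert b s) fun c _ hc => hs c hc, hsum]
      conv_lhs at h1 => rw [h2, map_sum]
      simp only [smul_sub, Finset.sum_sub_distrib, smul_ite, smul_zero]
      rw [Finset.sum_ite_eq', if_pos (Finset.mem_insert_self _ _), sub_eq_zero, ← h1]
      exact Finset.sum_congr rfl fun c _ => (tensorAct_torus_wproj hτ t c x).symm

theorem isGStable_colPiece (hτ : ∀ t l, τ t (v l) = tchar (β l) t • v l) (b : Fin n → ℤ) :
    IsGStable τ (colPiece m v β b) := by
  intro g x hx
  rw [mem_colPiece hτ] at hx ⊢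
  intro t
  have h : ((1, t) : GrpG k m n) * g = g * (1, t) := by
    ext1
    · simp
    · exact mul_comm _ _
  rw [← LinearMap.comp_apply, ← tensorAct_mul, h, tensorAct_mul, LinearMap.comp_apply, hx, map_smul]

end MatAct

/-! ### The `gl_m`-modules of fixed `T`-weight -/

section Subquotient

variable {k F : Type*} [Field k] [AddCommGroup F] [Module k F]

/-- The operators that preserve two subspaces. -/
def stabAlg (Y P : Submodule k F) : Subalgebra k (Module.End k F) where
  carrier := {X | (∀ x ∈ Y, X x ∈ Y) ∧ ∀ x ∈ P, X x ∈ P}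
  mul_mem' hX hX' := ⟨fun x hx => hX.1 _ (hX'.1 x hx), fun x hx => hX.2 _ (hX'.2 x hx)⟩
  add_mem' hX hX' := ⟨fun x hx => Y.add_mem (hX.1 x hx) (hX'.1 x hx),
    fun x hx => P.add_mem (hX.2 x hx) (hX'.2 x hx)⟩
  algebraMap_mem' c := ⟨fun _ hx => Y.smul_mem c hx, fun _ hx => P.smul_mem c hx⟩

instance (Y P : Submodule k F) : Ring (stabAlg Y P) := (stabAlg Y P).toRing

/-- The subquotient `Y / (Y ∩ P)`. -/
def Subquot (Y P : Submodule k F) : Type _ := Y ⧸ P.submoduleOf Y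

instance (Y P : Submodule k F) : AddCommGroup (Subquot Y P) :=
  inferInstanceAs (AddCommGroup (Y ⧸ P.submoduleOf Y))

instance (Y P : Submodule k F) : Module k (Subquot Y P) :=
  inferInstanceAs (Module k (Y ⧸ P.submoduleOf Y))

instance (Y P : Submodule k F) [FiniteDimensional k Y] : FiniteDimensional k (Subquot Y P) :=
  inferInstanceAs (FiniteDimensional k (Y ⧸ P.submoduleOf Y))

theorem nontrivial_subquot {Y P : Submodule k F} (h : ¬ Y ≤ P) : Nontrivial (Subquot Y P) := by
  change Nontrivial (Y ⧸ P.submoduleOf Y)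
  rw [Submodule.Quotient.nontrivial_iff]
  intro h'
  exact h (Submodule.submoduleOf_eq_top.1 h')

/-- The action on `Y / (Y ∩ P)` of the operators that preserve `Y` and `P`. -/
def redHom (Y P : Submodule k F) :
    stabAlg Y P →ₐ[k] Module.End k (Subquot Y P) where
  toFun X := (P.submoduleOf Y).mapQ (P.submoduleOf Y) (X.1.restrict X.2.1)
    fun _ hx => X.2.2 _ hx
  map_one' := Submodule.linearMap_qext _ rfl
  map_mul' _ _ := Submodule.linearMap_qext _ rfl
  map_zero' := Submodule.linearMap_qext _ rfl
  map_add' _ _ := Submodule.linearMap_qext _ rfl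
  commutes' _ := Submodule.linearMap_qext _ rfl

variable {Y P : Submodule k F}

theorem redHom_mk (X : stabAlg Y P) (y : Y) :
    redHom Y P X ((P.submoduleOf Y).mkQ y) = (P.submoduleOf Y).mkQ ⟨X.1 y, X.2.1 y y.2⟩ := rfl

theorem redHom_eq_zero {X : stabAlg Y P} (h : ∀ y ∈ Y, X.1 y ∈ P) : redHom Y P X = 0 := by
  refine Submodule.linearMap_qext _ (LinearMap.ext fun y => ?_)
  exact (Submodule.Quotient.mk_eq_zero _).2 (h y y.2)

theorem redHom_eq_one {X : stabAlg Y P} (h : ∀ y ∈ Y, X.1 y = y) : redHom Y P X = 1 := by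
  refine Submodule.linearMap_qext _ (LinearMap.ext fun y => ?_)
  exact congrArg (P.submoduleOf Y).mkQ (Subtype.ext (h y y.2))

/-- The trace of the operator induced on `Y / (Y ∩ P)` by a projection. -/
theorem trace_redHom [FiniteDimensional k Y] {X : stabAlg Y P} (hXX : ∀ x, X.1 (X.1 x) = X.1 x) :
    LinearMap.trace k _ (redHom Y P X) =
      ((Module.finrank k (Y ⊓ LinearMap.range X.1 : Submodule k F) : ℤ) -
        (Module.finrank k (P ⊓ Y ⊓ LinearMap.range X.1 : Submodule k F) : ℤ) : ℤ) := by
  have hX : X * X = X := Subtype.ext (LinearMap.ext hXX)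
  have hproj : LinearMap.IsProj (LinearMap.range (redHom Y P X)) (redHom Y P X) := by
    refine LinearMap.isProj_range_iff_isIdempotentElem _ |>.2 ?_
    rw [IsIdempotentElem, ← map_mul, hX]
  rw [hproj.trace]
  have h1 := finrank_map_add_finrank_inf_ker (P.submoduleOf Y).mkQ
    ((LinearMap.range X.1).submoduleOf Y)
  have h2 : ((LinearMap.range X.1).submoduleOf Y).map (P.submoduleOf Y).mkQ =
      LinearMap.range (redHom Y P X) := by
    refine le_antisymm ?_ ?_
    · rintro _ ⟨y, ⟨x, hx⟩, rfl⟩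
      refine ⟨(P.submoduleOf Y).mkQ y, ?_⟩
      rw [redHom_mk]
      congr 1
      refine Subtype.ext ?_
      change X.1 y = y
      change X.1 x = y at hx
      rw [← hx, hXX]
    · rintro _ ⟨x, rfl⟩
      obtain ⟨y, rfl⟩ := Submodule.mkQ_surjective _ x
      exact ⟨_, ⟨y, rfl⟩, (redHom_mk X y).symm⟩
  have h3 : ∀ S : Submodule k F, Module.finrank k (S.submoduleOf Y) =
      Module.finrank k (Y ⊓ S : Submodule k F) := fun S => by
    rw [← Submodule.finrank_map_subtype_eq Y, Submodule.submoduleOf, Submodule.map_comap_subtype]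
  have h4 : (LinearMap.range X.1).submoduleOf Y ⊓ P.submoduleOf Y =
      (P ⊓ LinearMap.range X.1).submoduleOf Y := by
    rw [inf_comm]; rfl
  rw [h2, Submodule.ker_mkQ, h4, h3, h3, ← inf_assoc, inf_comm Y P] at h1
  rw [← h1, Nat.cast_add, add_sub_cancel_right, Int.cast_natCast]
  rfl

variable {m : ℕ}

/-- Operators on `F` that preserve `Y` and `P` and satisfy the relations of a `GLModule` make
`Y / (Y ∩ P)` a `GLModule`. Only the decomposition into weight spaces refers to `Y`. -/
def glSubquot (Y P : Submodule k F) (E : Fin m → Fin m → stabAlg Y P)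
    (pr : (Fin m →₀ ℕ) → stabAlg Y P) (weights : Finset (Fin m →₀ ℕ))
    (perm : Equiv.Perm (Fin m) → stabAlg Y P)
    (comm : ∀ i j l q x, (E i j).1 ((E l q).1 x) - (E l q).1 ((E i j).1 x) =
      (if j = l then (E i q).1 x else 0) - (if q = i then (E l j).1 x else 0))
    (pr_mul_self : ∀ a x, (pr a).1 ((pr a).1 x) = (pr a).1 x)
    (pr_mul_of_ne : ∀ a b, a ≠ b → ∀ x, (pr a).1 ((pr b).1 x) = 0)
    (sum_pr : ∀ y ∈ Y, ∑ a ∈ weights, (pr a).1 y = y)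
    (E_mul_pr : ∀ i a x, (E i i).1 ((pr a).1 x) = (a i : k) • (pr a).1 x)
    (perm_mul_E : ∀ w i j x, (perm w).1 ((E i j).1 x) = (E (w i) (w j)).1 ((perm w).1 x))
    (perm_mul_inv : ∀ w x, (perm w).1 ((perm w⁻¹).1 x) = x) : GLModule k (Subquot Y P) m where
  E i j := redHom Y P (E i j)
  pr a := redHom Y P (pr a)
  weights := weights
  perm w := redHom Y P (perm w)
  comm i j l q := by
    have h : E i j * E l q - E l q * E i j =
        (if j = l then E i q else 0) - (if q = i then E l j else 0) := by
      refine Subtype.ext (LinearMap.ext fun x => (comm i j l q x).trans ?_)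
      split_ifs <;> rfl
    rw [← map_mul, ← map_mul, ← map_sub, h, map_sub, apply_ite (redHom Y P),
      apply_ite (redHom Y P), map_zero]
  pr_mul_self a := by
    rw [← map_mul]
    exact congrArg _ (Subtype.ext (LinearMap.ext (pr_mul_self a)))
  pr_mul_of_ne a a' ha := by
    rw [← map_mul, ← map_zero (redHom Y P)]
    exact congrArg _ (Subtype.ext (LinearMap.ext (pr_mul_of_ne a a' ha)))
  sum_pr := by
    rw [← map_sum]
    refine redHom_eq_one fun y hy => ?_
    rw [AddSubmonoidClass.coe_finsetSum, LinearMap.sum_apply]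
    exact sum_pr y hy
  E_mul_pr i a := by
    rw [← map_mul, ← map_smul]
    exact congrArg _ (Subtype.ext (LinearMap.ext (E_mul_pr i a)))
  perm_mul_E w i j := by
    rw [← map_mul, ← map_mul]
    exact congrArg _ (Subtype.ext (LinearMap.ext (perm_mul_E w i j)))
  perm_mul_inv w := by
    rw [← map_mul, ← map_one (redHom Y P)]
    exact congrArg _ (Subtype.ext (LinearMap.ext (perm_mul_inv w)))

theorem capelli_redHom_eq_zero (E : Fin m → Fin m → stabAlg Y P)
    (h : ∀ y ∈ Y, capelli (fun i j => (E i j).1) y ∈ P) :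
    capelli (fun i j => redHom Y P (E i j)) = 0 := by
  refine (capelli_map (redHom Y P).toRingHom E).symm.trans ?_
  refine redHom_eq_zero fun y hy => ?_
  have h2 := capelli_map (stabAlg Y P).val.toRingHom E
  change (stabAlg Y P).val.toRingHom (capelli E) y ∈ P
  rw [h2]
  exact h y hy

theorem capelli_rTensor (V : Type*) [AddCommGroup V] [Module k V]
    (E : Fin m → Fin m → Module.End k F) :
    capelli (fun i j => (LinearMap.rTensor V (E i j) : Module.End k (F ⊗[k] V))) =
      LinearMap.rTensor V (capelli E) :=
  (capelli_map (Module.End.rTensorAlgHom k F V).toRingHom E).symm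

end Subquotient

section WeightModule

variable {k : Type*} [Field k] [CharZero k] {m n : ℕ} {V ι : Type*} [AddCommGroup V] [Module k V]
  {v : Module.Basis ι k V} {β : ι → Fin n → ℤ} {τ : Representation k (Torus k n) V}

omit [CharZero k] in
theorem rowPerm_mul_polarEnd (w : Equiv.Perm (Fin m)) (i j : Fin m) :
    ((rowPerm w : MatRing k m n →ₐ[k] _).toLinearMap * polarEnd i j : Module.End k _) =
      polarEnd (w i) (w j) * (rowPerm w).toLinearMap := by
  refine LinearMap.ext fun f => ?_
  change rowPerm w (polar i j f) = polar (w i) (w j) (rowPerm w f)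
  induction f using MvPolynomial.induction_on with
  | C a =>
    rw [← MvPolynomial.algebraMap_eq, Derivation.map_algebraMap, AlgHom.commutes,
      Derivation.map_algebraMap, map_zero]
  | add f g hf hg => simp only [map_add, hf, hg]
  | mul_X f p hf =>
    obtain ⟨l, p⟩ := p
    have h1 : ∀ l, rowPerm w (MvPolynomial.X (l, p) : MatRing k m n) =
        MvPolynomial.X (w l, p) := fun l => by
      rw [rowPerm, MvPolynomial.rename_X]; rfl
    simp only [map_mul, Derivation.leibniz, smul_eq_mul, map_add, hf, h1, polar_X,
      EmbeddingLike.apply_eq_iff_eq]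
    split_ifs
    · rw [h1]
    · rw [map_zero]

omit [CharZero k] in
theorem rowPerm_mul_rowPerm (w w' : Equiv.Perm (Fin m)) :
    ((rowPerm w : MatRing k m n →ₐ[k] _).toLinearMap * (rowPerm w').toLinearMap : Module.End k _) =
      (rowPerm (w * w')).toLinearMap := by
  refine LinearMap.ext fun f => ?_
  change rowPerm w (rowPerm w' f) = rowPerm (w * w') f
  rw [rowPerm, rowPerm, rowPerm, MvPolynomial.rename_rename]
  rfl

omit [CharZero k] in
theorem rowPerm_one : (rowPerm 1 : MatRing k m n →ₐ[k] _) = AlgHom.id k _ := by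
  refine MvPolynomial.algHom_ext fun p => ?_
  rw [rowPerm, MvPolynomial.rename_X]
  rfl

omit [CharZero k] in
theorem polarEnd_diag_monomial (i : Fin m) (μ : Fin m × Fin n →₀ ℕ) :
    polarEnd i i (MvPolynomial.monomial μ (1 : k)) =
      ((∑ p, μ (i, p) : ℕ) : k) • MvPolynomial.monomial μ 1 := by
  rw [polarEnd_eq, LinearMap.sum_apply, Nat.cast_sum, Finset.sum_smul]
  refine Finset.sum_congr rfl fun p _ => ?_
  change (MvPolynomial.X (i, p) : MatRing k m n) * MvPolynomial.pderiv (i, p) _ = _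
  rw [MvPolynomial.X_mul_pderiv_monomial, Nat.cast_smul_eq_nsmul]

/-- The weight of the diagonal torus of `GL_m` that corresponds to a natural exponent vector,
together with a `T`-weight. -/
def natWt (a : Fin m →₀ ℕ) (b : Fin n → ℤ) : (Fin m → ℤ) × (Fin n → ℤ) := (fun i => (a i : ℤ), b)

theorem natWt_injective (b : Fin n → ℤ) : Function.Injective fun a : Fin m →₀ ℕ => natWt a b := by
  intro a a' h
  ext i
  exact Int.natCast_inj.1 (congrFun (congrArg Prod.fst h) i)

/-- The row degrees of `x^μ ⊗ v_l`. -/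
def rowDeg (i : (Fin m × Fin n →₀ ℕ) × ι) : Fin m →₀ ℕ :=
  Finsupp.equivFunOnFinite.symm fun a => ∑ p, i.1 (a, p)

theorem twt_eq_natWt (i : (Fin m × Fin n →₀ ℕ) × ι) :
    twt m β i = natWt (rowDeg i) (twt m β i).2 := by
  refine Prod.ext (funext fun a => ?_) rfl
  simp [twt, natWt, rowDeg]

omit [CharZero k] in
theorem wpiece_le_colPiece (w : (Fin m → ℤ) × (Fin n → ℤ)) :
    wpiece (tbasis m n v) (twt m β) w ≤ colPiece m v β w.2 := by
  intro x hx
  rw [colPiece, mem_wpiece]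
  rw [mem_wpiece] at hx
  have h : wproj (tbasis m n v) (fun i => (twt m β i).2) w.2 ∘ₗ wproj (tbasis m n v) (twt m β) w =
      wproj (tbasis m n v) (twt m β) w := by
    refine (tbasis m n v).ext fun i => ?_
    rw [LinearMap.comp_apply, wproj_basis]
    split_ifs with hi
    · rw [wproj_basis, if_pos (congrArg Prod.snd hi)]
    · rw [map_zero]
  rw [← hx]
  exact LinearMap.congr_fun h x

omit [CharZero k] in
theorem polarEnd_diag_wproj (i : Fin m) (a : Fin m →₀ ℕ) (b : Fin n → ℤ) :
    LinearMap.rTensor V (polarEnd i i) * wproj (tbasis m n v) (twt m β) (natWt a b) =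
      (a i : k) • wproj (tbasis m n v) (twt m β) (natWt a b) := by
  refine (tbasis m n v).ext fun x => ?_
  obtain ⟨μ, l⟩ := x
  rw [Module.End.mul_apply, LinearMap.smul_apply, wproj_basis]
  split_ifs with h
  · rw [tbasis_apply, LinearMap.rTensor_tmul, polarEnd_diag_monomial, TensorProduct.smul_tmul']
    congr 2
    rw [twt_eq_natWt] at h
    have h1 := congrFun (congrArg Prod.fst h) i
    have h2 : rowDeg (μ, l) i = a i := Int.natCast_inj.1 h1
    rw [← h2]
    rfl
  · rw [map_zero, smul_zero]

omit [CharZero k] in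
theorem sum_wproj_natWt [Finite ι] (b : Fin n → ℤ) :
    ∑ a ∈ (finite_twt_snd (m := m) (β := β) b).toFinset.image rowDeg,
      wproj (tbasis m n v) (twt m β) (natWt a b) =
    wproj (tbasis m n v) (fun i => (twt m β i).2) b := by
  refine (tbasis m n v).ext fun i => ?_
  rw [LinearMap.sum_apply]
  simp only [wproj_basis]
  split_ifs with h
  · rw [Finset.sum_eq_single (rowDeg i)]
    · rw [if_pos]
      rw [twt_eq_natWt, h]
    · intro a _ ha
      rw [if_neg]
      intro h'
      rw [twt_eq_natWt, h] at h'
      exact ha (natWt_injective b h').symm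
    · intro h'
      exact absurd (Finset.mem_image_of_mem rowDeg ((Set.Finite.mem_toFinset _).2 h)) h'
  · refine Finset.sum_eq_zero fun a _ => if_neg fun h' => h (congrArg Prod.snd h')

variable {Y P : Submodule k (MatRing k m n ⊗[k] V)}

omit [CharZero k] in
theorem rTensor_polarEnd_comm (i j l q : Fin m) (x : MatRing k m n ⊗[k] V) :
    LinearMap.rTensor V (polarEnd i j) (LinearMap.rTensor V (polarEnd l q) x) -
      LinearMap.rTensor V (polarEnd l q) (LinearMap.rTensor V (polarEnd i j) x) =
      (if j = l then LinearMap.rTensor V (polarEnd i q) x else 0) -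
        (if q = i then LinearMap.rTensor V (polarEnd l j) x else 0) := by
  have h1 := congrArg (LinearMap.rTensor V) (polarEnd_comm (k := k) (n := n) i j l q)
  rw [LinearMap.rTensor_sub, LinearMap.rTensor_sub, LinearMap.rTensor_mul, LinearMap.rTensor_mul,
    apply_ite (LinearMap.rTensor V), apply_ite (LinearMap.rTensor V), LinearMap.rTensor_zero] at h1
  refine (LinearMap.congr_fun h1 x).trans ?_
  rw [LinearMap.sub_apply]
  split_ifs <;> rfl

omit [CharZero k] in
theorem rTensor_rowPerm_mul_polarEnd (w : Equiv.Perm (Fin m)) (i j : Fin m)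
    (x : MatRing k m n ⊗[k] V) :
    LinearMap.rTensor V (rowPerm w).toLinearMap (LinearMap.rTensor V (polarEnd i j) x) =
      LinearMap.rTensor V (polarEnd (w i) (w j))
        (LinearMap.rTensor V (rowPerm w).toLinearMap x) := by
  have h1 := congrArg (LinearMap.rTensor V) (rowPerm_mul_polarEnd (k := k) (n := n) w i j)
  rw [LinearMap.rTensor_mul, LinearMap.rTensor_mul] at h1
  exact LinearMap.congr_fun h1 x

omit [CharZero k] in
theorem rTensor_rowPerm_mul_inv (w : Equiv.Perm (Fin m)) (x : MatRing k m n ⊗[k] V) :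
    LinearMap.rTensor V (rowPerm w).toLinearMap
      (LinearMap.rTensor V (rowPerm w⁻¹).toLinearMap x) = x := by
  have h1 := congrArg (LinearMap.rTensor V) (rowPerm_mul_rowPerm (k := k) (n := n) w w⁻¹)
  rw [LinearMap.rTensor_mul, mul_inv_cancel, rowPerm_one] at h1
  exact (LinearMap.congr_fun h1 x).trans (LinearMap.congr_fun (LinearMap.rTensor_id V _) x)

/-- The operators on `R_m ⊗ V` induced by the polarization operators, as operators that preserve
two given stable subspaces. -/
def stabPolar (hY : IsGStable τ Y) (hP : IsGStable τ P) (i j : Fin m) : stabAlg Y P :=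
  ⟨LinearMap.rTensor V (polarEnd i j), fun _ hx => hY.polarEnd_mem i j hx,
    fun _ hx => hP.polarEnd_mem i j hx⟩

/-- The projections to weight spaces as operators that preserve two given stable subspaces. -/
def stabProj (hτ : ∀ t l, τ t (v l) = tchar (β l) t • v l) (hY : IsGStable τ Y)
    (hP : IsGStable τ P) (w : (Fin m → ℤ) × (Fin n → ℤ)) : stabAlg Y P :=
  ⟨wproj (tbasis m n v) (twt m β) w, fun _ hx => hY.isWGraded hτ w _ hx,
    fun _ hx => hP.isWGraded hτ w _ hx⟩

/-- The row permutations as operators that preserve two given stable subspaces. -/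
def stabPerm (hY : IsGStable τ Y) (hP : IsGStable τ P) (w : Equiv.Perm (Fin m)) : stabAlg Y P :=
  ⟨LinearMap.rTensor V (rowPerm w).toLinearMap, fun _ hx => hY.rowPerm_mem w hx,
    fun _ hx => hP.rowPerm_mem w hx⟩

/-- The `gl_m`-module `Y / (Y ∩ P)`, where `Y` and `P` are stable and `Y` has `T`-weight `b`. -/
def weightModule [Finite ι] (hτ : ∀ t l, τ t (v l) = tchar (β l) t • v l) (hY : IsGStable τ Y)
    (hP : IsGStable τ P) (b : Fin n → ℤ) (hYb : Y ≤ colPiece m v β b) :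
    GLModule k (Subquot Y P) m :=
  glSubquot Y P (stabPolar hY hP) (fun a => stabProj hτ hY hP (natWt a b))
    ((finite_twt_snd (m := m) (β := β) b).toFinset.image rowDeg) (stabPerm hY hP)
    rTensor_polarEnd_comm (fun a x => wproj_wproj_self _ _ _ x)
    (fun a a' ha x => wproj_wproj_of_ne _ _ (fun h => ha (natWt_injective b h)) x)
    (fun y hy => by
      rw [← LinearMap.sum_apply]
      exact (LinearMap.congr_fun (sum_wproj_natWt b) y).trans ((mem_wpiece _ _).1 (hYb hy)))
    (fun i a x => LinearMap.congr_fun (polarEnd_diag_wproj i a b) x)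
    rTensor_rowPerm_mul_polarEnd rTensor_rowPerm_mul_inv

/-- By the Capelli identity, the Capelli element vanishes modulo the maximal minors. -/
theorem capelli_weightModule [Finite ι] (hτ : ∀ t l, τ t (v l) = tchar (β l) t • v l)
    (hY : IsGStable τ Y) (hP : IsGStable τ P) (b : Fin n → ℤ) (hYb : Y ≤ colPiece m v β b)
    (hJ : ∀ f ∈ minorIdeal k m n, ∀ x : MatRing k m n ⊗[k] V, f • x ∈ P) :
    capelli (weightModule hτ hY hP b hYb).E = 0 := by
  refine capelli_redHom_eq_zero (stabPolar hY hP) fun y hy => ?_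
  clear hy
  refine (congrArg (· ∈ P) (LinearMap.congr_fun (capelli_rTensor V polarEnd) y)).mpr ?_
  change LinearMap.rTensor V (capelli polarEnd) y ∈ P
  induction y using TensorProduct.induction_on with
  | zero => rw [map_zero]; exact P.zero_mem
  | tmul f x =>
    have := hJ _ (capelli_polarEnd_mem f) (1 ⊗ₜ x)
    rwa [TensorProduct.smul_tmul', smul_eq_mul, mul_one] at this
  | add x y hx hy => rw [map_add]; exact P.add_mem hx hy

/-- Modulo the maximal minors, stable subspaces are determined by the vectors of degree zero in the
last row. -/
theorem le_of_last_eq_zero {Q : Submodule k (MatRing k (m + 1) n ⊗[k] V)}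
    {P : Submodule k (MatRing k (m + 1) n ⊗[k] V)} [Finite ι]
    (hτ : ∀ t l, τ t (v l) = tchar (β l) t • v l)
    (hQ : IsGStable τ Q) (hP : IsGStable τ P)
    (hJ : ∀ f ∈ minorIdeal k (m + 1) n, ∀ x : MatRing k (m + 1) n ⊗[k] V, f • x ∈ P)
    (h : ∀ w : (Fin (m + 1) → ℤ) × (Fin n → ℤ), w.1 (Fin.last m) = 0 →
      ∀ x ∈ Q, x ∈ wpiece (tbasis (m + 1) n v) (twt (m + 1) β) w → x ∈ P) : Q ≤ P := by
  have key : ∀ b, Q ⊓ colPiece (m + 1) v β b ≤ P := by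
    intro b
    have hY := hQ.inf (isGStable_colPiece hτ b)
    by_contra hcon
    have := nontrivial_subquot hcon
    obtain ⟨a, ha, i, hi⟩ := (weightModule hτ hY hP b inf_le_right).exists_weight_of_capelli_eq_zero
      (capelli_weightModule hτ hY hP b inf_le_right hJ)
    refine ha (redHom_eq_zero fun y hy => ?_)
    refine h (natWt a b) ?_ _ (hQ.isWGraded hτ _ _ hy.1) ⟨y, rfl⟩
    have hil : i = Fin.last m := by
      refine Fin.ext ?_
      have := i.2
      have h2 : stair (m + 1) i = 0 := by omega
      rw [stair] at h2
      rw [Fin.val_last]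
      omega
    rw [hil] at hi
    have : a (Fin.last m) = 0 := by omega
    simp [natWt, this]
  intro x hx
  obtain ⟨s, -, hs⟩ := exists_sum_wproj (tbasis (m + 1) n v) (twt (m + 1) β) x
  rw [← hs]
  exact Submodule.sum_mem _ fun w _ =>
    key w.2 ⟨hQ.isWGraded hτ w x hx, wpiece_le_colPiece w ⟨x, rfl⟩⟩

theorem trace_weightModule_pr [Finite ι] (hτ : ∀ t l, τ t (v l) = tchar (β l) t • v l)
    (hY : IsGStable τ Y) (hP : IsGStable τ P) (b : Fin n → ℤ) (hYb : Y ≤ colPiece m v β b)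
    [FiniteDimensional k Y] (a : Fin m →₀ ℕ) :
    LinearMap.trace k _ ((weightModule hτ hY hP b hYb).pr a) =
      (((Module.finrank k (Y ⊓ wpiece (tbasis m n v) (twt m β) (natWt a b) : Submodule k _) : ℤ) -
        (Module.finrank k (P ⊓ Y ⊓ wpiece (tbasis m n v) (twt m β) (natWt a b) :
          Submodule k _) : ℤ) : ℤ) : k) :=
  trace_redHom (X := stabProj hτ hY hP (natWt a b)) fun x => wproj_wproj_self _ _ _ x

/-- The Hilbert function of a quotient of `R_m ⊗ V` killed by the maximal minors involves only
Schur polynomials of partitions with less than `m` parts. -/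
theorem exists_character [Finite ι] (hτ : ∀ t l, τ t (v l) = tchar (β l) t • v l)
    (hP : IsGStable τ P)
    (hJ : ∀ f ∈ minorIdeal k m n, ∀ x : MatRing k m n ⊗[k] V, f • x ∈ P) (b : Fin n → ℤ) :
    ∃ χ : MvPolynomial (Fin m) k,
      (∀ a, χ.coeff a = ((wdim (tbasis m n v) (twt m β) ⊤ (natWt a b) -
        wdim (tbasis m n v) (twt m β) P (natWt a b) : ℤ) : k)) ∧
      ∀ e : Fin m →₀ ℕ, (∀ i, 0 < e i) → (alternant k (stair m) * χ).coeff e = 0 := by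
  have hY := isGStable_colPiece (m := m) hτ b
  have : FiniteDimensional k (colPiece m v β b) := wpiece_finite _ _ (finite_twt_snd b)
  refine ⟨(weightModule hτ hY hP b le_rfl).trSeries 1, fun a => ?_, fun e he =>
    GLModule.coeff_alternant_mul_trSeries _
      (capelli_weightModule hτ hY hP b le_rfl hJ) he⟩
  rw [GLModule.coeff_trSeries, one_mul, trace_weightModule_pr, wdim, wdim]
  congr 2
  · have h1 : colPiece m v β b ⊓ wpiece (tbasis m n v) (twt m β) (natWt a b) =
        ⊤ ⊓ wpiece (tbasis m n v) (twt m β) (natWt a b) := by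
      rw [top_inf_eq]
      exact inf_eq_right.2 (wpiece_le_colPiece (natWt a b))
    exact congrArg (fun S : Submodule k _ => (Module.finrank k S : ℤ)) h1
  · have h1 : P ⊓ colPiece m v β b ⊓ wpiece (tbasis m n v) (twt m β) (natWt a b) =
        P ⊓ wpiece (tbasis m n v) (twt m β) (natWt a b) := by
      rw [inf_assoc]
      congr 1
      exact inf_eq_right.2 (wpiece_le_colPiece (natWt a b))
    exact congrArg (fun S : Submodule k _ => (Module.finrank k S : ℤ)) h1

/-- The Hilbert function of a stable subspace is symmetric in the row degrees. -/
theorem wdim_comp_perm [Finite ι]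
    (hP : IsGStable τ P) (s : Equiv.Perm (Fin m)) (w : (Fin m → ℤ) × (Fin n → ℤ)) :
    wdim (tbasis m n v) (twt m β) P (w.1 ∘ s, w.2) = wdim (tbasis m n v) (twt m β) P w := by
  -- permuting the rows by `s` maps the weight `(a ∘ s, b)` to the weight `(a, b)`
  have hwt : ∀ (s : Equiv.Perm (Fin m)) (w : (Fin m → ℤ) × (Fin n → ℤ)),
      ∀ x ∈ wpiece (tbasis m n v) (twt m β) (w.1 ∘ s, w.2),
        LinearMap.rTensor V (rowPerm s).toLinearMap x ∈ wpiece (tbasis m n v) (twt m β) w := by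
    rintro s w _ ⟨x, rfl⟩
    rw [mem_wpiece]
    have h : wproj (tbasis m n v) (twt m β) w ∘ₗ LinearMap.rTensor V (rowPerm s).toLinearMap ∘ₗ
        wproj (tbasis m n v) (twt m β) (w.1 ∘ s, w.2) =
        LinearMap.rTensor V (rowPerm s).toLinearMap ∘ₗ
        wproj (tbasis m n v) (twt m β) (w.1 ∘ s, w.2) := by
      refine (tbasis m n v).ext fun i => ?_
      obtain ⟨μ, l⟩ := i
      simp only [LinearMap.comp_apply]
      rw [wproj_basis]
      split_ifs with hi
      · have h1 : LinearMap.rTensor V (rowPerm s).toLinearMap (tbasis m n v (μ, l)) =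
            tbasis m n v (μ.mapDomain (Prod.map s id), l) := by
          rw [tbasis_apply, tbasis_apply, LinearMap.rTensor_tmul, AlgHom.toLinearMap_apply, rowPerm,
            MvPolynomial.rename_monomial]
        have h2 : ∀ a p, μ.mapDomain (Prod.map s id) (a, p) = μ (s.symm a, p) := fun a p => by
          have := Finsupp.mapDomain_apply (s.injective.prodMap Function.injective_id) μ
            (s.symm a, p)
          simpa using this
        rw [h1, wproj_basis, if_pos]
        refine Prod.ext (funext fun a => ?_) (funext fun p => ?_)
        · have h3 := congrFun (congrArg Prod.fst hi) (s.symm a)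
          simp only [twt, Function.comp_apply, Equiv.apply_symm_apply] at h3
          simp only [twt, h2, h3]
        · have h3 := congrFun (congrArg Prod.snd hi) p
          simp only [twt] at h3
          simp only [twt, h2, ← h3]
          congr 1
          exact Equiv.sum_comp s.symm fun a => (μ (a, p) : ℤ)
      · rw [map_zero, map_zero]
    exact LinearMap.congr_fun h x
  have hinj : ∀ s : Equiv.Perm (Fin m), Function.Injective
      (LinearMap.rTensor V (rowPerm s : MatRing k m n →ₐ[k] _).toLinearMap) := by
    intro s
    refine Function.LeftInverse.injective
      (g := LinearMap.rTensor V (rowPerm s⁻¹ : MatRing k m n →ₐ[k] _).toLinearMap) fun x => ?_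
    rw [← LinearMap.comp_apply, ← LinearMap.rTensor_comp]
    have := rowPerm_mul_rowPerm (k := k) (n := n) s⁻¹ s
    rw [inv_mul_cancel, rowPerm_one] at this
    rw [← Module.End.mul_eq_comp, this]
    exact LinearMap.congr_fun (LinearMap.rTensor_id _ _) x
  have hle : ∀ (s : Equiv.Perm (Fin m)) (w : (Fin m → ℤ) × (Fin n → ℤ)),
      wdim (tbasis m n v) (twt m β) P (w.1 ∘ s, w.2) ≤ wdim (tbasis m n v) (twt m β) P w := by
    intro s w
    have := wpiece_twt_finite (v := v) (β := β) w
    refine Int.ofNat_le.2 ?_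
    rw [LinearEquiv.finrank_eq (Submodule.equivMapOfInjective _ (hinj s) _)]
    refine Submodule.finrank_mono ?_
    rintro _ ⟨x, ⟨hx, hxw⟩, rfl⟩
    exact ⟨hP.rowPerm_mem s hx, hwt s w x hxw⟩
  refine le_antisymm (hle s w) ?_
  have := hle s⁻¹ (w.1 ∘ s, w.2)
  simpa [Function.comp_assoc] using this

end WeightModule

/-! ### The kernel of a stabilization -/

section Stabilization

variable {k : Type*} [Field k] {r n : ℕ} {V ι : Type*} [AddCommGroup V] [Module k V]

/-- The inclusion of `R_r ⊗ V` in `R_{r + 1} ⊗ V`. -/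
def incl (k V : Type*) [Field k] [AddCommGroup V] [Module k V] (r n : ℕ) :
    MatRing k r n ⊗[k] V →ₗ[k] MatRing k (r + 1) n ⊗[k] V :=
  LinearMap.rTensor V (addRow (k := k) (r := r) (n := n)).toLinearMap

/-- The restriction to the matrices with last row zero. -/
def restr (k V : Type*) [Field k] [AddCommGroup V] [Module k V] (r n : ℕ) :
    MatRing k (r + 1) n ⊗[k] V →ₗ[k] MatRing k r n ⊗[k] V :=
  LinearMap.rTensor V (zeroRow (k := k) (r := r) (n := n)).toLinearMap

theorem zeroRow_addRow (f : MatRing k r n) : zeroRow (addRow f) = f := by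
  have h : (zeroRow : MatRing k (r + 1) n →ₐ[k] MatRing k r n).comp addRow = AlgHom.id k _ := by
    refine MvPolynomial.algHom_ext fun p => ?_
    simp [addRow, zeroRow]
  exact DFunLike.congr_fun h f

theorem restr_incl (x : MatRing k r n ⊗[k] V) : restr k V r n (incl k V r n x) = x := by
  rw [restr, incl, ← LinearMap.comp_apply, ← LinearMap.rTensor_comp]
  have h : (zeroRow : MatRing k (r + 1) n →ₐ[k] MatRing k r n).toLinearMap ∘ₗ
      addRow.toLinearMap = LinearMap.id := LinearMap.ext zeroRow_addRow
  rw [h, LinearMap.rTensor_id, LinearMap.id_apply]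

theorem incl_injective : Function.Injective (incl k V r n) :=
  Function.LeftInverse.injective restr_incl

theorem restr_smul (f : MatRing k (r + 1) n) (x : MatRing k (r + 1) n ⊗[k] V) :
    restr k V r n (f • x) = zeroRow f • restr k V r n x := by
  induction x using TensorProduct.induction_on with
  | zero => simp
  | tmul g y => simp [restr, TensorProduct.smul_tmul']
  | add x y hx hy => rw [smul_add, map_add, hx, hy, map_add, smul_add]

theorem tensorAct_smul (τ : Representation k (Torus k n) V) (g : GrpG k r n) (f : MatRing k r n)
    (x : MatRing k r n ⊗[k] V) : tensorAct τ g (f • x) = coordAct g f • tensorAct τ g x := by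
  induction x using TensorProduct.induction_on with
  | zero => simp
  | tmul g y => simp [tensorAct, TensorProduct.smul_tmul']
  | add x y hx hy => rw [smul_add, map_add, hx, hy, map_add, smul_add]

theorem restr_tensorAct_torus (τ : Representation k (Torus k n) V) (t : Torus k n)
    (x : MatRing k (r + 1) n ⊗[k] V) :
    restr k V r n (tensorAct τ (1, t) x) = tensorAct τ (1, t) (restr k V r n x) := by
  induction x using TensorProduct.induction_on with
  | zero => simp
  | tmul g y => simp [restr, tensorAct, zeroRow_coordAct]
  | add x y hx hy => rw [map_add, map_add, hx, hy, map_add, map_add]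

/-- Acting by `g` and setting the last row of the matrix of variables to zero is the substitution
by the upper left block of `g⁻¹`. -/
theorem zeroRow_coordAct_addRow (g : Matrix.GeneralLinearGroup (Fin (r + 1)) k)
    (f : MatRing k r n) :
    zeroRow (coordAct ((g, 1) : GrpG k (r + 1) n) (addRow f)) =
      matAct ((g⁻¹).val.submatrix Fin.castSucc Fin.castSucc) f := by
  have h : (zeroRow : MatRing k (r + 1) n →ₐ[k] MatRing k r n).comp
      ((coordAct ((g, 1) : GrpG k (r + 1) n)).comp addRow) =
      matAct ((g⁻¹).val.submatrix Fin.castSucc Fin.castSucc) := by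
    refine MvPolynomial.algHom_ext fun p => ?_
    simp [coordAct, zeroRow, addRow, matAct, Fin.sum_univ_castSucc]
  exact DFunLike.congr_fun h f

theorem restr_tensorAct_incl (τ : Representation k (Torus k n) V)
    (g : Matrix.GeneralLinearGroup (Fin (r + 1)) k) (x : MatRing k r n ⊗[k] V) :
    restr k V r n (tensorAct τ (g, 1) (incl k V r n x)) = LinearMap.rTensor V
      (matAct ((g⁻¹).val.submatrix Fin.castSucc Fin.castSucc)).toLinearMap x := by
  induction x using TensorProduct.induction_on with
  | zero => simp
  | tmul g y => simp [restr, tensorAct, incl, zeroRow_coordAct_addRow]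
  | add x y hx hy => rw [map_add, map_add, map_add, hx, hy, map_add]

theorem zeroRow_coordAct_eq_zero (g : Matrix.GeneralLinearGroup (Fin (r + 1)) k)
    {f : MatRing k (r + 1) n} (hf : f ∈ minorIdeal k (r + 1) n) :
    zeroRow (coordAct ((g, 1) : GrpG k (r + 1) n) f) = 0 := by
  let ψ : MatRing k (r + 1) n →ₐ[k] MatRing k r n := zeroRow.comp (coordAct (g, 1))
  suffices h : minorIdeal k (r + 1) n ≤ RingHom.ker ψ from h hf
  rw [minorIdeal, Ideal.span_le]
  rintro _ ⟨c, rfl⟩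
  change ψ _ = 0
  rw [AlgHom.map_det]
  have h1 : ψ.mapMatrix (Matrix.of fun i j => (MvPolynomial.X (i, c j) : MatRing k (r + 1) n)) =
      ((g⁻¹).val.map MvPolynomial.C) * Matrix.of fun i j => zeroRow (MvPolynomial.X (i, c j)) := by
    ext1 i j
    simp [ψ, coordAct, Matrix.mul_apply, MvPolynomial.algHom_C]
  have h2 : (Matrix.of fun i j => (zeroRow (MvPolynomial.X (i, c j)) : MatRing k r n)).det = 0 :=
    Matrix.det_eq_zero_of_row_eq_zero (Fin.last r) fun j => by simp [zeroRow]
  rw [h1, Matrix.det_mul, h2, mul_zero]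

theorem coordAct_mem_minorIdeal (g : GrpG k r n) {f : MatRing k r n}
    (hf : f ∈ minorIdeal k r n) : coordAct g f ∈ minorIdeal k r n := by
  suffices h : minorIdeal k r n ≤ (minorIdeal k r n).comap (coordAct g) from h hf
  conv_lhs => rw [minorIdeal]
  rw [Ideal.span_le]
  rintro _ ⟨c, rfl⟩
  change coordAct g _ ∈ minorIdeal k r n
  rw [AlgHom.map_det]
  have h1 : (coordAct g).mapMatrix
      (Matrix.of fun i j => (MvPolynomial.X (i, c j) : MatRing k r n)) =
      ((g.1⁻¹).val.map MvPolynomial.C) * (Matrix.of fun i j => MvPolynomial.X (i, c j)) *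
        Matrix.diagonal fun j => MvPolynomial.C (g.2 (c j) : k) := by
    ext1 i j
    rw [Matrix.mul_diagonal, Matrix.mul_apply, Finset.sum_mul]
    simp only [coordAct, AlgHom.mapMatrix_apply, Matrix.map_apply, Matrix.of_apply,
      MvPolynomial.aeval_X, map_mul]
    exact Finset.sum_congr rfl fun l _ => by ring
  rw [h1, Matrix.det_mul, Matrix.det_mul]
  exact Ideal.mul_mem_right _ _ (Ideal.mul_mem_left _ _ (Ideal.subset_span ⟨c, rfl⟩))

variable (τ : Representation k (Torus k n) V)

/-- The vectors of `R_{r + 1} ⊗ V` all of whose translates by `GL_{r + 1}` restrict to elements of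
`N` on the matrices with last row zero. -/
def orbitKernel (N : Submodule (MatRing k r n) (MatRing k r n ⊗[k] V)) :
    Submodule (MatRing k (r + 1) n) (MatRing k (r + 1) n ⊗[k] V) where
  carrier := {x | ∀ g : Matrix.GeneralLinearGroup (Fin (r + 1)) k,
    restr k V r n (tensorAct τ (g, 1) x) ∈ N}
  add_mem' hx hy g := by rw [map_add, map_add]; exact N.add_mem (hx g) (hy g)
  zero_mem' g := by rw [map_zero, map_zero]; exact N.zero_mem
  smul_mem' f x hx g := by
    rw [tensorAct_smul, restr_smul]
    exact N.smul_mem _ (hx g)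

variable {τ} {N : Submodule (MatRing k r n) (MatRing k r n ⊗[k] V)}

theorem restr_mem_of_mem_orbitKernel {x : MatRing k (r + 1) n ⊗[k] V}
    (hx : x ∈ orbitKernel τ N) : restr k V r n x ∈ N := by
  have := hx 1
  rwa [show ((1, 1) : GrpG k (r + 1) n) = 1 from rfl, tensorAct_one, LinearMap.id_apply] at this

theorem isGStable_orbitKernel (hN : IsGStable τ (N.restrictScalars k)) :
    IsGStable τ ((orbitKernel τ N).restrictScalars k) := by
  intro h x hx g
  have h1 : ((g, 1) : GrpG k (r + 1) n) * h = (1, h.2) * (g * h.1, 1) := by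
    ext1 <;> simp
  have h2 : tensorAct τ (g, 1) (tensorAct τ h x) =
      tensorAct τ (1, h.2) (tensorAct τ (g * h.1, 1) x) := by
    rw [← LinearMap.comp_apply, ← tensorAct_mul, h1, tensorAct_mul, LinearMap.comp_apply]
  rw [h2, restr_tensorAct_torus]
  exact hN (1, h.2) _ (hx _)

theorem minorIdeal_smul_le_orbitKernel : minorIdeal k (r + 1) n • ⊤ ≤ orbitKernel τ N := by
  rw [Submodule.smul_le]
  intro f hf x _ g
  rw [tensorAct_smul, restr_smul, zeroRow_coordAct_eq_zero g hf, zero_smul]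
  exact N.zero_mem

theorem isGStable_extendSubmodule :
    IsGStable τ ((extendSubmodule τ N).restrictScalars k) := by
  intro g x hx
  change _ ∈ extendSubmodule τ N
  change x ∈ extendSubmodule τ N at hx
  rw [extendSubmodule, Submodule.mem_sInf] at hx ⊢
  exact fun P hP => hP.1 g x (hx P hP)

theorem incl_mem_extendSubmodule {x : MatRing k r n ⊗[k] V} (hx : x ∈ N) :
    incl k V r n x ∈ extendSubmodule τ N := by
  rw [extendSubmodule, Submodule.mem_sInf]
  exact fun P hP => hP.2 x hx

theorem isGStable_extendSubmodule_sup :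
    IsGStable τ ((extendSubmodule τ N ⊔ minorIdeal k (r + 1) n • ⊤).restrictScalars k) := by
  intro g x hx
  obtain ⟨y, hy, z, hz, rfl⟩ := Submodule.mem_sup.1 hx
  rw [map_add]
  refine Submodule.add_mem_sup (isGStable_extendSubmodule g y hy) ?_
  refine Submodule.smul_induction_on hz (fun f hf w _ => ?_) fun a b ha hb => ?_
  · rw [tensorAct_smul]
    exact Submodule.smul_mem_smul (coordAct_mem_minorIdeal g hf) trivial
  · rw [map_add]
    exact Submodule.add_mem _ ha hb

variable [CharZero k]

theorem incl_mem_orbitKernel (hN : IsGStable τ (N.restrictScalars k))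
    {x : MatRing k r n ⊗[k] V} (hx : x ∈ N) : incl k V r n x ∈ orbitKernel τ N := by
  intro g
  rw [restr_tensorAct_incl]
  exact hN.matAct_mem _ hx

variable {v : Module.Basis ι k V} {β : ι → Fin n → ℤ}

omit [CharZero k] in
theorem incl_restr {w : (Fin (r + 1) → ℤ) × (Fin n → ℤ)} (hw : w.1 (Fin.last r) = 0)
    {x : MatRing k (r + 1) n ⊗[k] V}
    (hx : x ∈ wpiece (tbasis (r + 1) n v) (twt (r + 1) β) w) :
    incl k V r n (restr k V r n x) = x := by
  rw [mem_wpiece] at hx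
  rw [← hx]
  have h : incl k V r n ∘ₗ restr k V r n ∘ₗ wproj (tbasis (r + 1) n v) (twt (r + 1) β) w =
      wproj (tbasis (r + 1) n v) (twt (r + 1) β) w := by
    refine (tbasis (r + 1) n v).ext fun i => ?_
    obtain ⟨μ, l⟩ := i
    rw [LinearMap.comp_apply, LinearMap.comp_apply, wproj_basis]
    split_ifs with hi
    · have hμ : ∀ p, μ (Fin.last r, p) = 0 := by
        intro p
        have h1 : ∑ q, (μ (Fin.last r, q) : ℤ) = 0 := by
          rw [← hw, ← hi]; rfl
        rw [Finset.sum_eq_zero_iff_of_nonneg fun _ _ => Int.natCast_nonneg _] at h1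
        exact Int.natCast_eq_zero.1 (h1 p (Finset.mem_univ p))
      rw [tbasis_apply, restr, LinearMap.rTensor_tmul, incl, LinearMap.rTensor_tmul]
      congr 1
      change addRow (zeroRow (MvPolynomial.monomial μ (1 : k))) = _
      rw [MvPolynomial.monomial_eq, map_one, one_mul, Finsupp.prod_fintype _ _ (by simp), map_prod,
        map_prod]
      refine Finset.prod_congr rfl fun p _ => ?_
      obtain ⟨i, p⟩ := p
      rw [map_pow, map_pow]
      refine Fin.lastCases ?_ (fun i => ?_) i
      · rw [hμ, pow_zero, pow_zero]
      · simp [zeroRow, addRow]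
    · rw [map_zero, map_zero]
  exact LinearMap.congr_fun h x

/-- The kernel `N_{r + 1} + J_{r + 1} ⊗ V` of a stabilization consists of the vectors all of whose
translates restrict to elements of `N`. -/
theorem extendSubmodule_sup_eq_orbitKernel [Finite ι]
    (hτ : ∀ t l, τ t (v l) = tchar (β l) t • v l) (hN : IsGStable τ (N.restrictScalars k)) :
    extendSubmodule τ N ⊔ minorIdeal k (r + 1) n • ⊤ = orbitKernel τ N := by
  refine le_antisymm (sup_le ?_ minorIdeal_smul_le_orbitKernel) ?_
  · exact sInf_le ⟨isGStable_orbitKernel hN, fun x hx => incl_mem_orbitKernel hN hx⟩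
  · refine le_of_last_eq_zero hτ (isGStable_orbitKernel hN) isGStable_extendSubmodule_sup
      (fun f hf x => Submodule.mem_sup_right (Submodule.smul_mem_smul hf trivial))
      fun w hw x hx hxw => Submodule.mem_sup_left ?_
    rw [← incl_restr hw hxw]
    exact incl_mem_extendSubmodule (restr_mem_of_mem_orbitKernel hx)

omit [CharZero k] in
theorem incl_wproj (w : (Fin r → ℤ) × (Fin n → ℤ)) (x : MatRing k r n ⊗[k] V) :
    incl k V r n (wproj (tbasis r n v) (twt r β) w x) =
      wproj (tbasis (r + 1) n v) (twt (r + 1) β) (Fin.snoc (α := fun _ => ℤ) w.1 0, w.2)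
        (incl k V r n x) := by
  have h : incl k V r n ∘ₗ wproj (tbasis r n v) (twt r β) w =
      wproj (tbasis (r + 1) n v) (twt (r + 1) β) (Fin.snoc (α := fun _ => ℤ) w.1 0, w.2) ∘ₗ
        incl k V r n := by
    refine (tbasis r n v).ext fun i => ?_
    obtain ⟨μ, l⟩ := i
    have hinj : Function.Injective fun p : Fin r × Fin n => (p.1.castSucc, p.2) := by
      rintro ⟨a, b⟩ ⟨c, d⟩ h
      simpa using h
    set ν := μ.mapDomain fun p : Fin r × Fin n => (p.1.castSucc, p.2) with hν
    have h1 : incl k V r n (tbasis r n v (μ, l)) = tbasis (r + 1) n v (ν, l) := by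
      rw [tbasis_apply, tbasis_apply, incl, LinearMap.rTensor_tmul,
        AlgHom.toLinearMap_apply, addRow,
        MvPolynomial.rename_monomial]
    have h2 : ∀ a p, ν (Fin.castSucc a, p) = μ (a, p) := fun a p =>
      Finsupp.mapDomain_apply hinj μ (a, p)
    have h3 : ∀ p, ν (Fin.last r, p) = 0 := fun p =>
      Finsupp.mapDomain_of_notMem_range _ _ (by rintro ⟨q, hq⟩; simp at hq)
    have h4 : twt (r + 1) β (ν, l) =
        (Fin.snoc (α := fun _ => ℤ) (twt r β (μ, l)).1 0, (twt r β (μ, l)).2) := by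
      refine Prod.ext (funext fun a => ?_) (funext fun p => ?_)
      · refine Fin.lastCases ?_ (fun a => ?_) a
        · simp [twt, h3]
        · simp [twt, h2]
      · simp [twt, Fin.sum_univ_castSucc, h2, h3]
    rw [LinearMap.comp_apply, LinearMap.comp_apply, h1, wproj_basis, wproj_basis, h4]
    have h5 : twt r β (μ, l) = w ↔ ((Fin.snoc (α := fun _ => ℤ) (twt r β (μ, l)).1 0,
        (twt r β (μ, l)).2) : (Fin (r + 1) → ℤ) × (Fin n → ℤ)) =
        (Fin.snoc (α := fun _ => ℤ) w.1 0, w.2) := by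
      refine ⟨fun h => by rw [h], fun h => ?_⟩
      rw [Prod.mk.injEq] at h
      exact Prod.ext (Fin.snoc_injective2 h.1).1 h.2
    by_cases h6 : twt r β (μ, l) = w
    · rw [if_pos h6, if_pos (h5.1 h6), h1]
    · rw [if_neg h6, if_neg fun h => h6 (h5.2 h), map_zero]
  exact LinearMap.congr_fun h x

omit [CharZero k] in
theorem wdim_snoc_zero {P : Submodule k (MatRing k r n ⊗[k] V)}
    {Q : Submodule k (MatRing k (r + 1) n ⊗[k] V)} (h1 : ∀ x ∈ P, incl k V r n x ∈ Q)
    (h2 : ∀ x ∈ Q, restr k V r n x ∈ P) (w : (Fin r → ℤ) × (Fin n → ℤ)) :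
    wdim (tbasis (r + 1) n v) (twt (r + 1) β) Q (Fin.snoc (α := fun _ => ℤ) w.1 0, w.2) =
      wdim (tbasis r n v) (twt r β) P w := by
  have h : (P ⊓ wpiece (tbasis r n v) (twt r β) w).map (incl k V r n) =
      Q ⊓ wpiece (tbasis (r + 1) n v) (twt (r + 1) β)
        (Fin.snoc (α := fun _ => ℤ) w.1 0, w.2) := by
    refine le_antisymm ?_ ?_
    · rintro _ ⟨x, ⟨hx, hxw⟩, rfl⟩
      refine ⟨h1 x hx, ?_⟩
      rw [SetLike.mem_coe, mem_wpiece] at hxw ⊢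
      rw [← incl_wproj, hxw]
    · rintro x ⟨hx, hxw⟩
      have h3 : incl k V r n (restr k V r n x) = x := incl_restr (by simp) hxw
      refine ⟨restr k V r n x, ⟨h2 x hx, ?_⟩, h3⟩
      rw [SetLike.mem_coe, mem_wpiece] at hxw ⊢
      refine incl_injective ?_
      rw [incl_wproj, h3, hxw]
  rw [wdim, wdim, ← h, ← LinearEquiv.finrank_eq (Submodule.equivMapOfInjective _ incl_injective _)]

omit [CharZero k] in
theorem wdim_eq_zero_of_neg {P : Submodule k (MatRing k r n ⊗[k] V)}
    {w : (Fin r → ℤ) × (Fin n → ℤ)} {i : Fin r} (hi : w.1 i < 0) :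
    wdim (tbasis r n v) (twt r β) P w = 0 := by
  have h : wproj (tbasis r n v) (twt r β) w = 0 := by
    refine (tbasis r n v).ext fun j => ?_
    rw [wproj_basis, if_neg, LinearMap.zero_apply]
    rintro rfl
    refine hi.not_ge ?_
    change (0 : ℤ) ≤ ∑ p, (j.1 (i, p) : ℤ)
    exact Finset.sum_nonneg fun p _ => Int.natCast_nonneg _
  rw [wdim, wpiece, h, LinearMap.range_zero, inf_bot_eq, finrank_bot, Nat.cast_zero]

end Stabilization

section OrbitClosure

variable {k : Type*} [Field k] {r n : ℕ}

/-- The ideal of `ρ(X)` consists of the functions all of whose translates restrict to functions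
vanishing on `X`. -/
theorem mem_vanishingIdeal_orbitClosure {X : Set (PrimeSpectrum (MatRing k r n))}
    {f : MatRing k (r + 1) n} :
    f ∈ PrimeSpectrum.vanishingIdeal (orbitClosure X) ↔
      ∀ g : Matrix.GeneralLinearGroup (Fin (r + 1)) k,
        zeroRow (coordAct ((g, 1) : GrpG k (r + 1) n) f) ∈ PrimeSpectrum.vanishingIdeal X := by
  rw [orbitClosure, PrimeSpectrum.vanishingIdeal_closure]
  simp only [PrimeSpectrum.mem_vanishingIdeal]
  constructor
  · intro h g x hx
    have h1 := h (specAct ((g⁻¹, 1) : GrpG k (r + 1) n) (PrimeSpectrum.comap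
      (zeroRow : MatRing k (r + 1) n →ₐ[k] MatRing k r n).toRingHom x))
      (Set.mem_iUnion.2 ⟨g⁻¹, _, ⟨x, hx, rfl⟩, rfl⟩)
    change zeroRow (coordAct (g⁻¹, (1 : Torus k n))⁻¹ f) ∈ x.asIdeal at h1
    rwa [Prod.inv_mk, inv_inv, inv_one] at h1
  · intro h y hy
    obtain ⟨g, z, ⟨x, hx, rfl⟩, rfl⟩ := by simpa only [Set.mem_iUnion] using hy
    have h1 := h g⁻¹ x hx
    change zeroRow (coordAct (g, (1 : Torus k n))⁻¹ f) ∈ x.asIdeal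
    rwa [Prod.inv_mk, inv_one]

end OrbitClosure

/-! ### The operator `ρ` in terms of alternants -/

section Alternants

variable (A : Type*) [CommRing A] {r n : ℕ}

/-- Laplace expansion along the last column. -/
theorem alternant_snoc (m : Fin r → ℕ) (k : ℕ) :
    alternant A (Fin.snoc (α := fun _ => ℕ) (fun j => m j + 1) k) =
      ∑ i : Fin (r + 1), (-1) ^ ((i : ℕ) + r) * MvPolynomial.X i ^ k *
        MvPolynomial.rename i.succAbove ((∏ j, MvPolynomial.X j) * alternant A m) := by
  rw [alternant, Matrix.det_succ_column _ (Fin.last r)]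
  refine Finset.sum_congr rfl fun i _ => ?_
  rw [Fin.val_last, Matrix.of_apply, Fin.snoc_last, map_mul, alternant, AlgHom.map_det, map_prod]
  congr 1
  have h : (Matrix.of fun i j => (MvPolynomial.X i : MvPolynomial (Fin (r + 1)) A) ^
      Fin.snoc (α := fun _ => ℕ) (fun j => m j + 1) k j).submatrix i.succAbove
        (Fin.last r).succAbove =
      Matrix.diagonal (fun a => MvPolynomial.X (i.succAbove a)) *
        (MvPolynomial.rename i.succAbove).mapMatrix
          (Matrix.of fun i j => (MvPolynomial.X i : MvPolynomial (Fin r) A) ^ m j) := by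
    ext1 a j
    simp [Matrix.diagonal_mul, pow_succ, mul_comm]
  rw [h, Matrix.det_mul, Matrix.det_diagonal]
  simp

theorem stair_succ_castSucc (j : Fin r) : stair (r + 1) j.castSucc = stair r j + 1 := by
  have := j.2
  simp only [stair, Fin.val_castSucc]
  omega

theorem stair_eq_snoc : stair (r + 1) = Fin.snoc (α := fun _ => ℕ) (fun j => stair r j + 1) 0 := by
  funext j
  refine Fin.lastCases ?_ (fun j => ?_) j
  · simp [stair]
  · rw [Fin.snoc_castSucc, stair_succ_castSucc]

theorem alternant_stair_succ :
    alternant A (stair (r + 1)) = ∑ i : Fin (r + 1), (-1) ^ ((i : ℕ) + r) *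
        MvPolynomial.rename i.succAbove ((∏ j, MvPolynomial.X j) * alternant A (stair r)) := by
  rw [stair_eq_snoc, alternant_snoc]
  simp

theorem stair_le_of_strictAnti {m : Fin r → ℕ} (hm : StrictAnti m) (j : Fin r) :
    stair r j ≤ m j := by
  rw [stair_eq_card_Ioi, ← Finset.card_image_of_injective (Finset.Ioi j) hm.injective]
  refine (Finset.card_le_card (t := Finset.range (m j)) fun x hx => ?_).trans
    (Finset.card_range _).le
  obtain ⟨l, hl, rfl⟩ := Finset.mem_image.1 hx
  exact Finset.mem_range.2 (hm (Finset.mem_Ioi.1 hl))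

theorem rename_alternant (m : Fin r → ℕ) (s : Equiv.Perm (Fin r)) :
    MvPolynomial.rename s (alternant A m) = (Equiv.Perm.sign s : ℤ) • alternant A m := by
  have h : (MvPolynomial.rename s).mapMatrix (Matrix.of fun i j =>
      (MvPolynomial.X i : MvPolynomial (Fin r) A) ^ m j) =
      (Matrix.of fun i j => (MvPolynomial.X i : MvPolynomial (Fin r) A) ^ m j).submatrix s id := by
    ext1 i j
    simp
  rw [alternant, AlgHom.map_det, h, Matrix.det_permute, zsmul_eq_mul]

variable {A}

theorem coeff_of_antisymm {f : MvPolynomial (Fin r) A}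
    (hf : ∀ s : Equiv.Perm (Fin r), MvPolynomial.rename s f = (Equiv.Perm.sign s : ℤ) • f)
    (s : Equiv.Perm (Fin r)) (e : Fin r → ℕ) :
    f.coeff (Finsupp.equivFunOnFinite.symm (e ∘ s)) =
      (Equiv.Perm.sign s : ℤ) • f.coeff (Finsupp.equivFunOnFinite.symm e) := by
  have h1 := MvPolynomial.coeff_rename_mapDomain s s.injective f
    (Finsupp.equivFunOnFinite.symm (e ∘ s))
  have h2 : Finsupp.mapDomain s (Finsupp.equivFunOnFinite.symm (e ∘ s)) =
      Finsupp.equivFunOnFinite.symm e := by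
    ext i
    simp
  rw [← h1, h2, hf, MvPolynomial.coeff_smul]

/-- A permutation relates at most one pair of strictly decreasing sequences. -/
theorem perm_eq_one_of_strictAnti {m m' : Fin r → ℕ} (hm : StrictAnti m) (hm' : StrictAnti m')
    {s : Equiv.Perm (Fin r)} (h : m = m' ∘ s) : s = 1 := by
  have hmono : StrictMono s := fun a b hab => by
    have := hm hab
    rw [h] at this
    exact hm'.lt_iff_gt.1 this
  have := Subsingleton.elim (StrictMono.orderIsoOfSurjective _ hmono s.surjective)
    (OrderIso.refl (Fin r))
  ext i
  have h2 := congrArg (fun e : Fin r ≃o Fin r => e i) this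
  simp at h2
  simp [h2]

/-- An antisymmetric polynomial is a combination of alternants, the coefficients being those of the
monomials with strictly decreasing exponents. -/
theorem sum_coeff_smul_alternant [IsAddTorsionFree A] {f : MvPolynomial (Fin r) A}
    (hf : ∀ s : Equiv.Perm (Fin r), MvPolynomial.rename s f = (Equiv.Perm.sign s : ℤ) • f) :
    (open scoped Classical in (MvPolynomial.basisMonomials (Fin r) A).constr A (fun m =>
      if StrictAnti m then alternant A m else 0) : MvPolynomial (Fin r) A →ₗ[A] _) f = f := by
  classical
  have hexp : (MvPolynomial.basisMonomials (Fin r) A).constr A (fun m =>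
      if StrictAnti m then alternant A m else 0) f =
      ∑ m ∈ f.support, f.coeff m • if StrictAnti m then alternant A m else 0 := by
    rw [Module.Basis.constr_apply]
    rfl
  rw [hexp]
  ext e
  have hcoeff : ∀ (m : Fin r →₀ ℕ), (alternant A m).coeff e = ∑ w : Equiv.Perm (Fin r),
      (Equiv.Perm.sign w : ℤ) • if ⇑m ∘ w = e then (1 : A) else 0 := by
    intro m
    rw [alternant_eq_sum, MvPolynomial.coeff_sum]
    refine Finset.sum_congr rfl fun w _ => ?_
    rw [MvPolynomial.coeff_smul, MvPolynomial.coeff_monomial]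
    congr 2
    rw [Equiv.symm_apply_eq]
    rfl
  by_cases he : Function.Injective e
  · -- `m₀` is the decreasing rearrangement of `e`
    obtain ⟨w, m₀, hm₀, hw⟩ : ∃ (w : Equiv.Perm (Fin r)) (m₀ : Fin r →₀ ℕ), StrictAnti m₀ ∧
        ⇑m₀ ∘ w = e := by
      have h1 := Tuple.monotone_sort fun i => OrderDual.toDual (e i)
      set w := Tuple.sort fun i => OrderDual.toDual (e i)
      refine ⟨w⁻¹, Finsupp.equivFunOnFinite.symm (e ∘ w), ?_, ?_⟩
      · have h2 : Antitone (e ∘ w) := fun a b hab => h1 hab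
        exact h2.strictAnti_of_injective (he.comp w.injective)
      · ext i
        simp
    have huniq : ∀ (m : Fin r →₀ ℕ) (w' : Equiv.Perm (Fin r)), StrictAnti m → ⇑m ∘ w' = e →
        m = m₀ ∧ w' = w := by
      intro m w' hm h
      have h1 : ⇑m = m₀ ∘ (w * w'⁻¹ : Equiv.Perm (Fin r)) := by
        ext i
        have := congrFun (h.trans hw.symm) (w'⁻¹ i)
        simpa using this
      have h2 := perm_eq_one_of_strictAnti hm hm₀ h1
      rw [h2] at h1
      exact ⟨DFunLike.coe_injective h1, (mul_inv_eq_one.1 h2).symm⟩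
    rw [MvPolynomial.coeff_sum]
    have hterm : ∀ m, (f.coeff m • if StrictAnti m then alternant A m else 0).coeff e =
        if m = m₀ then f.coeff m * (Equiv.Perm.sign w : ℤ) else 0 := by
      intro m
      rw [MvPolynomial.coeff_smul]
      by_cases hm : StrictAnti m
      · rw [if_pos hm, hcoeff]
        split_ifs with h
        · subst h
          rw [Finset.sum_eq_single w]
          · simp [hw]
          · intro w' _ hw'
            rw [if_neg fun h => hw' (huniq _ _ hm h).2, smul_zero]
          · simp
        · rw [Finset.sum_eq_zero, smul_zero]
          intro w' _
          rw [if_neg fun h' => h (huniq _ _ hm h').1, smul_zero]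
      · rw [if_neg hm, MvPolynomial.coeff_zero, smul_zero, if_neg]
        rintro rfl
        exact hm hm₀
    simp only [hterm]
    rw [Finset.sum_ite_eq']
    have h3 := coeff_of_antisymm hf w m₀
    rw [hw] at h3
    have h4 : Finsupp.equivFunOnFinite.symm (e : Fin r → ℕ) = e := by ext; simp
    have h5 : Finsupp.equivFunOnFinite.symm (m₀ : Fin r → ℕ) = m₀ := by ext; simp
    rw [h4, h5] at h3
    rw [h3]
    split_ifs with h
    · rw [zsmul_eq_mul, mul_comm]
    · rw [MvPolynomial.notMem_support_iff.1 h, smul_zero]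
  · -- both sides vanish if `e` has a repeated entry
    rw [Function.Injective] at he
    push Not at he
    obtain ⟨i, j, hij, hne⟩ := he
    have h1 : f.coeff e = 0 := by
      have h2 := coeff_of_antisymm hf (Equiv.swap i j) e
      have h3 : ⇑e ∘ Equiv.swap i j = e := by
        ext l
        rw [Function.comp_apply, Equiv.swap_apply_def]
        split_ifs with h h'
        · rw [h, hij]
        · rw [h', hij]
        · rfl
      have h4 : Finsupp.equivFunOnFinite.symm (e : Fin r → ℕ) = e := by ext; simp
      rw [h3, h4, Equiv.Perm.sign_swap hne] at h2
      simp only [Units.val_neg, Units.val_one, neg_smul, one_smul] at h2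
      exact self_eq_neg.1 h2
    rw [h1, MvPolynomial.coeff_sum]
    refine Finset.sum_eq_zero fun m _ => ?_
    rw [MvPolynomial.coeff_smul]
    split_ifs with hm
    · rw [hcoeff, Finset.sum_eq_zero, smul_zero]
      intro w _
      rw [if_neg, smul_zero]
      intro h
      rw [← h] at hij
      exact hne (w.injective (hm.injective hij))
    · rw [MvPolynomial.coeff_zero, smul_zero]

/-- Multiplied with the Weyl denominators, `ρ_k` is an antisymmetrization: on Schur polynomials this
is the Laplace expansion `alternant_snoc`. -/
theorem alternant_mul_rhoK [IsAddTorsionFree A] (k : ℕ) {K : MvPolynomial (Fin r) A}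
    (hK : K.IsSymmetric) :
    alternant A (stair (r + 1)) * rhoK A k K = ∑ i : Fin (r + 1), (-1) ^ ((i : ℕ) + r) *
      MvPolynomial.X i ^ k * MvPolynomial.rename i.succAbove
        ((∏ j, MvPolynomial.X j) * (alternant A (stair r) * K)) := by
  classical
  have hanti : ∀ s : Equiv.Perm (Fin r), MvPolynomial.rename s (alternant A (stair r) * K) =
      (Equiv.Perm.sign s : ℤ) • (alternant A (stair r) * K) := by
    intro s
    rw [map_mul, rename_alternant, hK s, smul_mul_assoc]
  -- as functions of `alternant A (stair r) * K`, both sides are linear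
  let T : MvPolynomial (Fin r) A →ₗ[A] MvPolynomial (Fin (r + 1)) A :=
    ∑ i : Fin (r + 1), LinearMap.mulLeft A ((-1) ^ ((i : ℕ) + r) * MvPolynomial.X i ^ k) ∘ₗ
      (MvPolynomial.rename i.succAbove).toLinearMap ∘ₗ LinearMap.mulLeft A (∏ j, MvPolynomial.X j)
  have hT : ∀ f, T f = ∑ i : Fin (r + 1), (-1) ^ ((i : ℕ) + r) * MvPolynomial.X i ^ k *
      MvPolynomial.rename i.succAbove ((∏ j, MvPolynomial.X j) * f) := by
    intro f
    simp [T, LinearMap.sum_apply, mul_assoc]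
  rw [← hT]
  conv_rhs => rw [← sum_coeff_smul_alternant hanti]
  rw [rhoK, LinearMap.comp_apply, LinearMap.mulLeft_apply, ← LinearMap.mulLeft_apply (R := A),
    ← LinearMap.comp_apply, ← LinearMap.comp_apply T]
  refine LinearMap.congr_fun ?_ _
  refine (MvPolynomial.basisMonomials (Fin r) A).ext fun m => ?_
  rw [LinearMap.comp_apply, LinearMap.comp_apply, Module.Basis.constr_basis,
    Module.Basis.constr_basis]
  split_ifs with hm
  · rw [hT, ← alternant_snoc, LinearMap.mulLeft_apply, alternant_stair_mul_schur]
    congr 1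
    funext j
    refine Fin.lastCases ?_ (fun j => ?_) j
    · simp [stair]
    · have := stair_le_of_strictAnti hm j
      rw [Fin.snoc_castSucc, Fin.snoc_castSucc, stair_succ_castSucc]
      omega
  · rw [map_zero, map_zero]

theorem sum_elemT_mul_pow {n : ℕ} (x : MvPolynomial (Fin r) (TRing n)) :
    ∑ k ∈ Finset.range (n + 1), MvPolynomial.C ((-1) ^ k * elemT n k) * x ^ k =
      ∏ j : Fin n, (1 - x * MvPolynomial.C (AddMonoidAlgebra.single (Pi.single j 1) 1)) := by
  have h : ∀ j : Fin n, 1 - x * MvPolynomial.C (AddMonoidAlgebra.single (Pi.single j 1) 1) =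
      1 + (-1) * x * MvPolynomial.C (AddMonoidAlgebra.single (Pi.single j 1) 1) := fun j => by ring
  simp only [h]
  rw [Finset.prod_one_add, Finset.sum_powerset, Finset.card_univ, Fintype.card_fin]
  refine Finset.sum_congr rfl fun k _ => ?_
  rw [elemT, MvPolynomial.esymm, map_sum, Finset.mul_sum, map_sum, Finset.sum_mul]
  refine Finset.sum_congr rfl fun t ht => ?_
  rw [Finset.prod_mul_distrib, Finset.prod_const, (Finset.mem_powersetCard.1 ht).2, mul_pow,
    map_prod]
  simp only [MvPolynomial.aeval_X, map_mul, map_pow, map_neg, map_one, map_prod]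
  ring

/-- Summing over `k`, the powers of `u_i` combine to the factor `∏_j (1 - u_i t_j)`. -/
theorem alternant_mul_rho {K : MvPolynomial (Fin r) (TRing n)} (hK : K.IsSymmetric) :
    alternant (TRing n) (stair (r + 1)) * rho n K = ∑ i : Fin (r + 1), (-1) ^ ((i : ℕ) + r) *
      (∏ j : Fin n, (1 - MvPolynomial.X i * MvPolynomial.C
        (AddMonoidAlgebra.single (Pi.single j 1) 1))) * MvPolynomial.rename i.succAbove
        ((∏ j, MvPolynomial.X j) * (alternant (TRing n) (stair r) * K)) := by
  have : IsAddTorsionFree (TRing n) := ⟨fun k hk x y h => AddMonoidAlgebra.coeff_inj.1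
    (nsmul_right_injective hk (congrArg AddMonoidAlgebra.coeff h))⟩
  rw [rho, LinearMap.sum_apply, Finset.mul_sum]
  simp only [LinearMap.smul_apply, mul_smul_comm, alternant_mul_rhoK _ hK, Finset.smul_sum,
    ← sum_elemT_mul_pow, Finset.mul_sum, Finset.sum_mul]
  rw [Finset.sum_comm]
  refine Finset.sum_congr rfl fun i _ => Finset.sum_congr rfl fun k _ => ?_
  rw [MvPolynomial.smul_eq_C_mul]
  ring

end Alternants

/-! ### Convolution with Laurent polynomials -/

section Laurent

variable {r m n : ℕ}

theorem conv_coeff {Γ : Type*} [AddCommGroup Γ] (X Y : AddMonoidAlgebra ℤ Γ) :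
    conv X ⇑Y.coeff = ⇑(X * Y).coeff := by
  induction X using AddMonoidAlgebra.induction_linear with
  | zero => rw [map_zero, zero_mul]; rfl
  | add x y hx hy => rw [map_add, LinearMap.add_apply, hx, hy, add_mul]; rfl
  | single g c =>
    ext w
    rw [conv_single, AddMonoidAlgebra.coeff_single_mul_apply, neg_add_eq_sub]

theorem conv_comm {Γ : Type*} [AddCommGroup Γ] (X Y : AddMonoidAlgebra ℤ Γ) (h : Γ → ℤ) :
    conv X (conv Y h) = conv Y (conv X h) := by
  rw [← Module.End.mul_apply, ← map_mul, mul_comm, map_mul, Module.End.mul_apply]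

theorem conv_mapDomain {Γ Γ' : Type*} [AddCommGroup Γ] [AddCommGroup Γ'] (θ : Γ →+ Γ')
    (D : AddMonoidAlgebra ℤ Γ) (H : Γ' → ℤ) (w : Γ') :
    conv (AddMonoidAlgebra.mapDomainRingHom ℤ θ D) H w =
      D.coeff.sum fun d c => c * H (w - θ d) := by
  rw [conv_apply, AddMonoidAlgebra.mapDomainRingHom_apply, AddMonoidAlgebra.coeff_mapDomain,
    Finsupp.sum_mapDomain_index (fun _ => zero_mul _) fun _ _ _ => add_mul _ _ _]

theorem natWt_add (a a' : Fin m →₀ ℕ) (b b' : Fin n → ℤ) :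
    natWt (a + a') (b + b') = natWt a b + natWt a' b' := by
  refine Prod.ext (funext fun i => ?_) rfl
  simp [natWt]

theorem toLaurent_C (x : TRing n) : toLaurent m n (MvPolynomial.C x) =
    AddMonoidAlgebra.mapDomainRingHom ℤ (AddMonoidHom.inr (Fin m → ℤ) (Fin n → ℤ)) x :=
  MvPolynomial.eval₂Hom_C _ _ _

theorem toLaurent_X (i : Fin m) : toLaurent m n (MvPolynomial.X i) =
    AddMonoidAlgebra.single (Pi.single i 1, 0) 1 :=
  MvPolynomial.eval₂Hom_X' _ _ _

theorem toLaurent_monomial (a : Fin m →₀ ℕ) (b : Fin n → ℤ) (z : ℤ) :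
    toLaurent m n (MvPolynomial.monomial a (AddMonoidAlgebra.single b z)) =
      AddMonoidAlgebra.single (natWt a b) z := by
  induction a using Finsupp.induction_linear generalizing b z with
  | zero =>
    have : MvPolynomial.monomial (0 : Fin m →₀ ℕ) (AddMonoidAlgebra.single b z : TRing n) =
      MvPolynomial.C (AddMonoidAlgebra.single b z) := rfl
    rw [this, toLaurent_C, AddMonoidAlgebra.mapDomainRingHom_apply,
      AddMonoidAlgebra.mapDomain_single]
    rfl
  | add f g hf hg =>
    have h1 : (AddMonoidAlgebra.single b z : TRing n) =
        AddMonoidAlgebra.single b z * AddMonoidAlgebra.single 0 1 := by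
      rw [AddMonoidAlgebra.single_mul_single, add_zero, mul_one]
    rw [h1, ← MvPolynomial.monomial_mul, map_mul, hf, hg, AddMonoidAlgebra.single_mul_single,
      ← natWt_add, add_zero, mul_one]
  | single i c =>
    rw [← MvPolynomial.C_mul_X_pow_eq_monomial, map_mul, map_pow, toLaurent_C, toLaurent_X,
      AddMonoidAlgebra.mapDomainRingHom_apply, AddMonoidAlgebra.mapDomain_single,
      AddMonoidAlgebra.single_pow, AddMonoidAlgebra.single_mul_single, one_pow, mul_one]
    congr 1
    refine Prod.ext (funext fun j => ?_) ?_
    · simp [natWt, Finsupp.single_apply, Pi.single_apply, eq_comm]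
    · simp [natWt]

theorem coeff_toLaurent (f : MvPolynomial (Fin m) (TRing n)) (a : Fin m →₀ ℕ) (b : Fin n → ℤ) :
    (toLaurent m n f).coeff (natWt a b) = (f.coeff a).coeff b := by
  induction f using MvPolynomial.induction_on' with
  | monomial a' x =>
    induction x using AddMonoidAlgebra.induction_linear with
    | zero => simp
    | add x y hx hy =>
      rw [map_add, map_add, MvPolynomial.coeff_add]
      simp only [AddMonoidAlgebra.coeff_add, Finsupp.add_apply, hx, hy]
    | single b' z =>
      rw [toLaurent_monomial, MvPolynomial.coeff_monomial, AddMonoidAlgebra.coeff_single,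
        Finsupp.single_apply]
      by_cases h : a' = a
      · subst h
        rw [if_pos rfl, AddMonoidAlgebra.coeff_single, Finsupp.single_apply]
        simp [natWt]
      · rw [if_neg h, if_neg]
        · rfl
        · intro h'
          refine h (natWt_injective b ?_)
          have h2 : b' = b := congrArg Prod.snd h'
          subst h2
          exact h'
  | add p q hp hq =>
    rw [map_add, MvPolynomial.coeff_add]
    simp only [AddMonoidAlgebra.coeff_add, Finsupp.add_apply, hp, hq]

theorem toLaurent_injective : Function.Injective (toLaurent m n) := by
  intro f g h
  ext a b
  rw [← coeff_toLaurent, ← coeff_toLaurent, h]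

/-- A function that vanishes on weights with a negative row degree. -/
def VanishesOnNeg (h : (Fin m → ℤ) × (Fin n → ℤ) → ℤ) : Prop := ∀ w i, w.1 i < 0 → h w = 0

theorem VanishesOnNeg.conv_toLaurent {h : (Fin m → ℤ) × (Fin n → ℤ) → ℤ} (hh : VanishesOnNeg h)
    (f : MvPolynomial (Fin m) (TRing n)) : VanishesOnNeg (conv (toLaurent m n f) h) := by
  induction f using MvPolynomial.induction_on with
  | C x =>
    intro w i hi
    rw [toLaurent_C, conv_mapDomain]
    refine Finset.sum_eq_zero fun d _ => ?_
    change _ * h _ = 0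
    rw [hh _ i, mul_zero]
    simpa using hi
  | add f g hf hg =>
    intro w i hi
    rw [map_add, map_add, LinearMap.add_apply, Pi.add_apply, hf w i hi, hg w i hi, add_zero]
  | mul_X f j hf =>
    intro w i hi
    rw [mul_comm, map_mul, map_mul, Module.End.mul_apply, toLaurent_X,
      conv_single, hf _ i, mul_zero]
    have : (0 : ℤ) ≤ (Pi.single j 1 : Fin m → ℤ) i := by
      rw [Pi.single_apply]; split_ifs <;> simp
    simp only [Prod.fst_sub, Pi.sub_apply]
    omega

theorem hilbDenom_eq_toLaurent : hilbDenom m n = toLaurent m n (∏ i : Fin m, ∏ j : Fin n,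
    (1 - MvPolynomial.X i * MvPolynomial.C (AddMonoidAlgebra.single (Pi.single j 1) 1))) := by
  simp only [map_prod, map_sub, map_one, map_mul, toLaurent_X, toLaurent_C,
    AddMonoidAlgebra.mapDomainRingHom_apply, AddMonoidAlgebra.mapDomain_single,
    AddMonoidAlgebra.single_mul_single, hilbDenom]
  simp

/-- The permutation of the row degrees. -/
def permWt (s : Equiv.Perm (Fin m)) :
    (Fin m → ℤ) × (Fin n → ℤ) →+ (Fin m → ℤ) × (Fin n → ℤ) where
  toFun w := (w.1 ∘ s, w.2)
  map_zero' := rfl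
  map_add' _ _ := rfl

theorem conv_hilbDenom_permWt {h : (Fin m → ℤ) × (Fin n → ℤ) → ℤ}
    (hs : ∀ s w, h (permWt s w) = h w) (s : Equiv.Perm (Fin m)) (w : (Fin m → ℤ) × (Fin n → ℤ)) :
    conv (hilbDenom m n) h (permWt s w) = conv (hilbDenom m n) h w := by
  have hD : AddMonoidAlgebra.mapDomainRingHom ℤ (permWt s) (hilbDenom m n) = hilbDenom m n := by
    rw [hilbDenom, map_prod, ← Equiv.prod_comp s]
    refine Finset.prod_congr rfl fun i _ => ?_
    rw [map_prod]
    refine Finset.prod_congr rfl fun j _ => ?_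
    rw [map_sub, map_one, AddMonoidAlgebra.mapDomainRingHom_apply,
      AddMonoidAlgebra.mapDomain_single]
    congr 3
    refine Prod.ext (funext fun l => ?_) rfl
    simp [permWt, Pi.single_apply]
  conv_lhs => rw [← hD]
  rw [conv_mapDomain, conv_apply]
  simp only [← map_sub, hs]

/-- A symmetric finitely supported function comes from a symmetric polynomial. -/
theorem exists_isSymmetric_toLaurent {c : (Fin m → ℤ) × (Fin n → ℤ) → ℤ}
    (hc : (Function.support c).Finite) (hneg : VanishesOnNeg c)
    (hs : ∀ s w, c (permWt s w) = c w) :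
    ∃ K : MvPolynomial (Fin m) (TRing n), K.IsSymmetric ∧ ⇑(toLaurent m n K).coeff = c := by
  classical
  let K : MvPolynomial (Fin m) (TRing n) := ∑ w ∈ hc.toFinset,
    MvPolynomial.monomial (Finsupp.equivFunOnFinite.symm fun i => (w.1 i).toNat)
      (AddMonoidAlgebra.single w.2 (c w))
  have hK : ⇑(toLaurent m n K).coeff = c := by
    have h1 : toLaurent m n K = ∑ w ∈ hc.toFinset, AddMonoidAlgebra.single w (c w) := by
      rw [map_sum]
      refine Finset.sum_congr rfl fun w hw => ?_
      rw [toLaurent_monomial]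
      congr 1
      refine Prod.ext (funext fun i => ?_) rfl
      have : 0 ≤ w.1 i := by
        by_contra h
        exact (Set.Finite.mem_toFinset hc).1 hw (hneg w i (not_le.1 h))
      simp [natWt, this]
    ext w
    rw [h1, AddMonoidAlgebra.coeff_sum, Finsupp.finsetSum_apply]
    simp only [AddMonoidAlgebra.coeff_single, Finsupp.single_apply]
    rw [Finset.sum_ite_eq']
    split_ifs with h
    · rfl
    · rw [Set.Finite.mem_toFinset, Function.mem_support, not_not] at h
      exact h.symm
  refine ⟨K, fun s => ?_, hK⟩
  ext a b
  have h1 := MvPolynomial.coeff_rename_mapDomain s s.injective K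
    (Finsupp.equivFunOnFinite.symm (a ∘ s))
  have h2 : Finsupp.mapDomain s (Finsupp.equivFunOnFinite.symm (a ∘ s)) = a := by
    ext i
    simp
  rw [h2] at h1
  rw [h1, ← coeff_toLaurent, ← coeff_toLaurent, hK, ← hs s (natWt a b)]
  rfl

/-- The inclusion of the weights with row degree zero in the row `i`. -/
def insRow (i : Fin (r + 1)) :
    (Fin r → ℤ) × (Fin n → ℤ) →+ (Fin (r + 1) → ℤ) × (Fin n → ℤ) where
  toFun w := (i.insertNth (α := fun _ => ℤ) 0 w.1, w.2)
  map_zero' := by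
    refine Prod.ext (funext fun j => ?_) rfl
    refine Fin.succAboveCases i ?_ (fun j => ?_) j <;> simp
  map_add' w w' := by
    refine Prod.ext (funext fun j => ?_) rfl
    refine Fin.succAboveCases i ?_ (fun j => ?_) j <;> simp

theorem insRow_fst_self (i : Fin (r + 1)) (w : (Fin r → ℤ) × (Fin n → ℤ)) :
    (insRow i w).1 i = 0 := by simp [insRow]

theorem insRow_fst_succAbove (i : Fin (r + 1)) (w : (Fin r → ℤ) × (Fin n → ℤ)) (j : Fin r) :
    (insRow i w).1 (i.succAbove j) = w.1 j := by simp [insRow]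

theorem insRow_removeNth {i : Fin (r + 1)} {w : (Fin (r + 1) → ℤ) × (Fin n → ℤ)}
    (hw : w.1 i = 0) : insRow i (i.removeNth w.1, w.2) = w := by
  refine Prod.ext (funext fun j => ?_) rfl
  refine Fin.succAboveCases i ?_ (fun j => ?_) j
  · rw [insRow_fst_self, hw]
  · rw [insRow_fst_succAbove]; rfl

theorem insRow_injective (i : Fin (r + 1)) : Function.Injective (insRow (n := n) i) := by
  intro w w' h
  refine Prod.ext (funext fun j => ?_) (congrArg Prod.snd h :)
  rw [← insRow_fst_succAbove i, h, insRow_fst_succAbove]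

/-- The substitution of the variables `u_j`, `j ≠ i`, in Laurent polynomials. -/
def insLaurent (i : Fin (r + 1)) : LaurentRing r n →+* LaurentRing (r + 1) n :=
  AddMonoidAlgebra.mapDomainRingHom ℤ (insRow i)

theorem insLaurent_toLaurent (i : Fin (r + 1)) (f : MvPolynomial (Fin r) (TRing n)) :
    insLaurent i (toLaurent r n f) =
      toLaurent (r + 1) n (MvPolynomial.rename i.succAbove f) := by
  have h : (insLaurent i).comp (toLaurent r n) =
      (toLaurent (r + 1) n).comp (MvPolynomial.rename i.succAbove).toRingHom := by
    refine MvPolynomial.ringHom_ext (fun x => ?_) fun j => ?_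
    · induction x using AddMonoidAlgebra.induction_linear with
      | zero => simp
      | add x y hx hy => simp only [map_add, hx, hy]
      | single b z =>
        simp only [RingHom.comp_apply, AlgHom.toRingHom_eq_coe, RingHom.coe_coe,
          MvPolynomial.rename_C, toLaurent_C, insLaurent, AddMonoidAlgebra.mapDomainRingHom_apply,
          AddMonoidAlgebra.mapDomain_single]
        congr 1
        refine Prod.ext (funext fun l => ?_) rfl
        change (insRow i ((0 : Fin r → ℤ), b)).1 l = 0
        refine Fin.succAboveCases i ?_ (fun l => ?_) l
        · rw [insRow_fst_self]
        · rw [insRow_fst_succAbove]; rfl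
    · simp only [RingHom.comp_apply, AlgHom.toRingHom_eq_coe, RingHom.coe_coe,
        MvPolynomial.rename_X, toLaurent_X, insLaurent, AddMonoidAlgebra.mapDomainRingHom_apply,
        AddMonoidAlgebra.mapDomain_single]
      congr 1
      refine Prod.ext (funext fun l => ?_) rfl
      refine Fin.succAboveCases i ?_ (fun l => ?_) l
      · rw [insRow_fst_self]
        simp
      · rw [insRow_fst_succAbove]
        simp [Pi.single_apply]
  exact DFunLike.congr_fun h f

theorem hilbDenom_succ (i : Fin (r + 1)) : hilbDenom (r + 1) n =
    toLaurent (r + 1) n (∏ j : Fin n, (1 - MvPolynomial.X i * MvPolynomial.C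
      (AddMonoidAlgebra.single (Pi.single j 1) 1))) * insLaurent i (hilbDenom r n) := by
  rw [hilbDenom_eq_toLaurent, hilbDenom_eq_toLaurent, insLaurent_toLaurent, ← map_mul,
    Fin.prod_univ_succAbove _ i]
  simp

/-- The extension of a function by zero from the weights with row degree zero in the row `i`. -/
def extRow (i : Fin (r + 1)) (h : (Fin r → ℤ) × (Fin n → ℤ) → ℤ) :
    (Fin (r + 1) → ℤ) × (Fin n → ℤ) → ℤ :=
  fun w => if w.1 i = 0 then h (i.removeNth w.1, w.2) else 0

theorem extRow_coeff (i : Fin (r + 1)) (Y : LaurentRing r n) :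
    extRow i ⇑Y.coeff = ⇑(insLaurent i Y).coeff := by
  ext w
  rw [insLaurent, AddMonoidAlgebra.mapDomainRingHom_apply, AddMonoidAlgebra.coeff_mapDomain, extRow]
  split_ifs with h
  · conv_rhs => rw [← insRow_removeNth h]
    exact (Finsupp.mapDomain_apply (insRow_injective i) _ _).symm
  · rw [Finsupp.mapDomain_of_notMem_range]
    rintro ⟨v, rfl⟩
    exact h (insRow_fst_self i v)

theorem conv_insLaurent_extRow (i : Fin (r + 1)) (D : LaurentRing r n)
    (h : (Fin r → ℤ) × (Fin n → ℤ) → ℤ) :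
    conv (insLaurent i D) (extRow i h) = extRow i (conv D h) := by
  ext w
  rw [insLaurent, conv_mapDomain, extRow]
  have h1 : ∀ d, (w - insRow i d).1 i = w.1 i := fun d => by
    rw [Prod.fst_sub, Pi.sub_apply, insRow_fst_self, sub_zero]
  have h2 : ∀ d, ((i.removeNth (w - insRow i d).1, (w - insRow i d).2) :
      (Fin r → ℤ) × (Fin n → ℤ)) = (i.removeNth w.1, w.2) - d := fun d => by
    refine Prod.ext (funext fun j => ?_) rfl
    simp only [Fin.removeNth, Prod.fst_sub, Pi.sub_apply, insRow_fst_succAbove]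
  simp only [extRow, h1, h2]
  split_ifs
  · rw [conv_apply]
  · simp

end Laurent

/-! ### Comparison of the Hilbert functions -/

section Comparison

variable {r n : ℕ}

/-- The product of the variables and the Weyl denominator. -/
def weylNum (r n : ℕ) : MvPolynomial (Fin r) (TRing n) :=
  (∏ j, MvPolynomial.X j) * alternant (TRing n) (stair r)

theorem toLaurent_prod_X (r n : ℕ) :
    toLaurent r n (∏ j, MvPolynomial.X j) = AddMonoidAlgebra.single (1, 0) 1 := by
  have h : (∏ j, MvPolynomial.X j : MvPolynomial (Fin r) (TRing n)) =
      MvPolynomial.monomial (Finsupp.equivFunOnFinite.symm 1) (AddMonoidAlgebra.single 0 1) := by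
    rw [MvPolynomial.monomial_eq, Finsupp.prod_fintype _ _ (by simp)]
    change _ = MvPolynomial.C 1 * _
    simp
  rw [h, toLaurent_monomial]
  congr 1

theorem toLaurent_alternant_stair_succ :
    toLaurent (r + 1) n (alternant (TRing n) (stair (r + 1))) = ∑ i : Fin (r + 1),
      (-1 : ℤ) ^ ((i : ℕ) + r) • insLaurent i (toLaurent r n (weylNum r n)) := by
  rw [alternant_stair_succ, map_sum]
  refine Finset.sum_congr rfl fun i _ => ?_
  rw [insLaurent_toLaurent, map_mul, map_pow, map_neg, map_one, weylNum, zsmul_eq_mul, Int.cast_pow,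
    Int.cast_neg, Int.cast_one]

/-- If `h` vanishes on negative row degrees, then so does the convolution with the terms of the Weyl
denominator; since these terms have positive degree in all rows except for the row `i`, it vanishes
also when some other row degree is zero. -/
theorem conv_insLaurent_weylNum_eq_zero {H : (Fin (r + 1) → ℤ) × (Fin n → ℤ) → ℤ}
    (hH : VanishesOnNeg H) (i l : Fin (r + 1)) {w : (Fin (r + 1) → ℤ) × (Fin n → ℤ)}
    (hl : w.1 l ≤ 0) (hi : w.1 i ≠ 0) :
    conv (insLaurent i (toLaurent r n (weylNum r n))) H w = 0 := by
  rw [weylNum, map_mul, map_mul, map_mul, Module.End.mul_apply,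
    insLaurent_toLaurent i (alternant _ _),
    toLaurent_prod_X, insLaurent, AddMonoidAlgebra.mapDomainRingHom_apply,
    AddMonoidAlgebra.mapDomain_single, conv_single, one_mul]
  refine hH.conv_toLaurent _ _ l ?_
  rw [Prod.fst_sub, Pi.sub_apply]
  by_cases h : l = i
  · subst h
    rw [insRow_fst_self]
    omega
  · obtain ⟨j, rfl⟩ := Fin.exists_succAbove_eq h
    rw [insRow_fst_succAbove]
    change w.1 _ - 1 < 0
    omega

theorem toLaurent_alternant (m n : ℕ) (a : Fin m → ℕ) :
    toLaurent m n (alternant (TRing n) a) = ∑ w : Equiv.Perm (Fin m), (Equiv.Perm.sign w : ℤ) •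
      AddMonoidAlgebra.single (natWt (Finsupp.equivFunOnFinite.symm (a ∘ w)) 0) 1 := by
  rw [alternant_eq_sum, map_sum]
  refine Finset.sum_congr rfl fun w _ => ?_
  rw [map_zsmul, AddMonoidAlgebra.one_def, toLaurent_monomial]

/-- The coefficients of the product of the Weyl denominator and a character, in terms of
convolutions. -/
theorem coeff_alternant_mul_eq_conv {k : Type*} [Field k] {m : ℕ}
    {H : (Fin m → ℤ) × (Fin n → ℤ) → ℤ} (hH : VanishesOnNeg H) (b : Fin n → ℤ)
    {χ : MvPolynomial (Fin m) k} (hχ : ∀ a, χ.coeff a = ((H (natWt a b) : ℤ) : k)) (d : Fin m → ℕ)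
    (e : Fin m →₀ ℕ) :
    (alternant k d * χ).coeff e =
      ((conv (toLaurent m n (alternant (TRing n) d)) H (natWt e b) : ℤ) : k) := by
  rw [toLaurent_alternant, alternant_eq_sum, Finset.sum_mul, MvPolynomial.coeff_sum, map_sum,
    LinearMap.sum_apply, Finset.sum_apply, Int.cast_sum]
  refine Finset.sum_congr rfl fun w _ => ?_
  rw [smul_mul_assoc, MvPolynomial.coeff_smul, map_zsmul, LinearMap.smul_apply, Pi.smul_apply,
    conv_single, one_mul, MvPolynomial.coeff_monomial_mul', zsmul_eq_mul, smul_eq_mul, Int.cast_mul]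
  congr 1
  set f : Fin m →₀ ℕ := Finsupp.equivFunOnFinite.symm (d ∘ w)
  split_ifs with h
  · rw [one_mul, hχ]
    congr 2
    have h1 : natWt e b = natWt (e - f) b + natWt f 0 := by
      rw [← natWt_add, add_zero, tsub_add_cancel_of_le h]
    rw [h1, add_sub_cancel_right]
  · obtain ⟨i, hi⟩ : ∃ i, e i < f i := by
      by_contra hcon
      push Not at hcon
      exact h hcon
    rw [hH _ i, Int.cast_zero]
    change (e i : ℤ) - (f i : ℤ) < 0
    omega

/-- The Hilbert functions of a module and of its stabilization determine each other up to the
Weyl denominators. -/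
theorem conv_alternant_eq_sum {k : Type*} [Field k] [CharZero k]
    {h : (Fin r → ℤ) × (Fin n → ℤ) → ℤ} {H : (Fin (r + 1) → ℤ) × (Fin n → ℤ) → ℤ}
    (hneg : VanishesOnNeg H) (hins : ∀ i w, H (insRow i w) = h w)
    (hχ : ∀ b, ∃ χ : MvPolynomial (Fin (r + 1)) k,
      (∀ a, χ.coeff a = ((H (natWt a b) : ℤ) : k)) ∧ ∀ e : Fin (r + 1) →₀ ℕ, (∀ i, 0 < e i) →
        (alternant k (stair (r + 1)) * χ).coeff e = 0) :
    conv (toLaurent (r + 1) n (alternant (TRing n) (stair (r + 1)))) H =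
      ∑ i : Fin (r + 1), (-1 : ℤ) ^ ((i : ℕ) + r) •
        extRow i (conv (toLaurent r n (weylNum r n)) h) := by
  have hsum : ∀ w, conv (toLaurent (r + 1) n (alternant (TRing n) (stair (r + 1)))) H w =
      ∑ i : Fin (r + 1), (-1) ^ ((i : ℕ) + r) *
        conv (insLaurent i (toLaurent r n (weylNum r n))) H w := by
    intro w
    rw [toLaurent_alternant_stair_succ, map_sum, LinearMap.sum_apply, Finset.sum_apply]
    refine Finset.sum_congr rfl fun i _ => ?_
    rw [map_zsmul, LinearMap.smul_apply, Pi.smul_apply, smul_eq_mul]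
  ext w
  rw [Finset.sum_apply]
  have hterm : ∀ i : Fin (r + 1), w.1 i = 0 →
      extRow i (conv (toLaurent r n (weylNum r n)) h) w =
        conv (insLaurent i (toLaurent r n (weylNum r n))) H w := by
    intro i hi
    rw [extRow, if_pos hi, insLaurent, conv_mapDomain, conv_apply]
    refine Finset.sum_congr rfl fun d _ => ?_
    conv_rhs => rw [← insRow_removeNth hi]
    simp only [← map_sub, hins]
  by_cases hpos : ∀ i, 0 < w.1 i
  · rw [Finset.sum_eq_zero]
    · obtain ⟨χ, hχ1, hχ2⟩ := hχ w.2
      have h1 := coeff_alternant_mul_eq_conv hneg w.2 hχ1 (stair (r + 1))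
        (Finsupp.equivFunOnFinite.symm fun i => (w.1 i).toNat)
      rw [hχ2] at h1
      · have h2 : natWt (Finsupp.equivFunOnFinite.symm fun i => (w.1 i).toNat) w.2 = w := by
          refine Prod.ext (funext fun i => ?_) rfl
          simp [natWt, (hpos i).le]
        rw [h2] at h1
        exact_mod_cast h1.symm
      · intro i
        simpa using hpos i
    · intro i _
      rw [Pi.smul_apply, extRow, if_neg (hpos i).ne', smul_zero]
  · push Not at hpos
    obtain ⟨l, hl⟩ := hpos
    rw [hsum]
    refine Finset.sum_congr rfl fun i _ => ?_
    rw [Pi.smul_apply, smul_eq_mul]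
    by_cases hi : w.1 i = 0
    · rw [hterm i hi]
    · rw [conv_insLaurent_weylNum_eq_zero hneg i l hl hi, extRow, if_neg hi, mul_zero]

theorem toLaurent_alternant_stair_ne_zero (m n : ℕ) :
    toLaurent m n (alternant (TRing n) (stair m)) ≠ 0 := by
  rw [Ne, map_eq_zero_iff _ toLaurent_injective, alternant_stair_eq_prod]
  refine Finset.prod_ne_zero_iff.2 fun p hp h => ?_
  exact (Finset.mem_filter.1 hp).2.ne (MvPolynomial.X_injective (sub_eq_zero.1 h))

/-- If the Hilbert functions are related as in `conv_alternant_eq_sum`, then the `K`-polynomials are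
related by the operator `ρ`. -/
theorem exists_toLaurent_rho {h : (Fin r → ℤ) × (Fin n → ℤ) → ℤ}
    {H : (Fin (r + 1) → ℤ) × (Fin n → ℤ) → ℤ} (hneg : VanishesOnNeg h)
    (hsym : ∀ s w, h (permWt s w) = h w)
    (hfin : (Function.support (conv (hilbDenom r n) h)).Finite)
    (hfin' : (Function.support (conv (hilbDenom (r + 1) n) H)).Finite)
    (hH : conv (toLaurent (r + 1) n (alternant (TRing n) (stair (r + 1)))) H =
      ∑ i : Fin (r + 1), (-1 : ℤ) ^ ((i : ℕ) + r) •
        extRow i (conv (toLaurent r n (weylNum r n)) h)) :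
    ∃ K : MvPolynomial (Fin r) (TRing n), K.IsSymmetric ∧
      ⇑(toLaurent r n K).coeff = conv (hilbDenom r n) h ∧
      ⇑(toLaurent (r + 1) n (rho n K)).coeff = conv (hilbDenom (r + 1) n) H := by
  obtain ⟨K, hK, hKh⟩ := exists_isSymmetric_toLaurent hfin
    (by rw [hilbDenom_eq_toLaurent]; exact hneg.conv_toLaurent _) (conv_hilbDenom_permWt hsym)
  refine ⟨K, hK, hKh, ?_⟩
  let K' : LaurentRing (r + 1) n := AddMonoidAlgebra.ofCoeff (Finsupp.ofSupportFinite _ hfin')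
  have hK' : ⇑K'.coeff = conv (hilbDenom (r + 1) n) H := rfl
  suffices h1 : toLaurent (r + 1) n (rho n K) = K' by rw [h1, hK']
  refine mul_left_cancel₀ (toLaurent_alternant_stair_ne_zero (r + 1) n) ?_
  rw [← AddMonoidAlgebra.coeff_inj]
  refine DFunLike.coe_injective ?_
  rw [← map_mul, alternant_mul_rho hK, ← conv_coeff, hK', conv_comm, hH, map_sum, map_sum]
  have hterm : ∀ i : Fin (r + 1), conv (hilbDenom (r + 1) n) ((-1 : ℤ) ^ ((i : ℕ) + r) •
      extRow i (conv (toLaurent r n (weylNum r n)) h)) =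
      ⇑((-1 : ℤ) ^ ((i : ℕ) + r) • (toLaurent (r + 1) n (∏ j : Fin n, (1 - MvPolynomial.X i *
        MvPolynomial.C (AddMonoidAlgebra.single (Pi.single j 1) 1))) *
        insLaurent i (toLaurent r n (weylNum r n * K)))).coeff := by
    intro i
    rw [map_zsmul, hilbDenom_succ i, map_mul, Module.End.mul_apply, conv_insLaurent_extRow,
      conv_comm, ← hKh, conv_coeff, extRow_coeff, conv_coeff, map_mul (toLaurent r n)]
    rfl
  simp only [hterm]
  rw [AddMonoidAlgebra.coeff_sum, Finsupp.coe_finsetSum]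
  refine Finset.sum_congr rfl fun i _ => ?_
  rw [insLaurent_toLaurent, map_mul, map_mul, map_pow, map_neg, map_one, weylNum, zsmul_eq_mul,
    Int.cast_pow, Int.cast_neg, Int.cast_one, mul_assoc, mul_assoc]

end Comparison

/-! ### `K`-polynomials of modules and of closed sets -/

section KPolynomial

variable {k : Type*} [Field k] [CharZero k] {r m n : ℕ} {V ι : Type*} [AddCommGroup V] [Module k V]
  {v : Module.Basis ι k V} {β : ι → Fin n → ℤ} {τ : Representation k (Torus k n) V}

/-- The Hilbert function of the quotient of `R_m ⊗ V` by a submodule. -/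
def hilb (v : Module.Basis ι k V) (β : ι → Fin n → ℤ)
    (N : Submodule (MatRing k m n) (MatRing k m n ⊗[k] V)) : (Fin m → ℤ) × (Fin n → ℤ) → ℤ :=
  wdim (tbasis m n v) (twt m β) ⊤ - wdim (tbasis m n v) (twt m β) (N.restrictScalars k)

omit [CharZero k] in
theorem vanishesOnNeg_hilb (N : Submodule (MatRing k m n) (MatRing k m n ⊗[k] V)) :
    VanishesOnNeg (hilb v β N) := fun w i hi => by
  rw [hilb, Pi.sub_apply, wdim_eq_zero_of_neg hi, wdim_eq_zero_of_neg hi, sub_zero]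

theorem hilb_permWt [Finite ι] {N : Submodule (MatRing k m n) (MatRing k m n ⊗[k] V)}
    (hN : IsGStable τ (N.restrictScalars k)) (s : Equiv.Perm (Fin m))
    (w : (Fin m → ℤ) × (Fin n → ℤ)) : hilb v β N (permWt s w) = hilb v β N w := by
  have h1 := wdim_comp_perm (v := v) (β := β) hN s w
  have h2 := wdim_comp_perm (v := v) (β := β) (τ := τ) (P := ⊤) (fun _ _ _ => trivial) s w
  exact congrArg₂ (fun a b : ℤ => a - b) h2 h1

theorem finite_support_conv_hilb [FiniteDimensional k V] [Finite ι]
    (hτ : ∀ t l, τ t (v l) = tchar (β l) t • v l)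
    {N : Submodule (MatRing k m n) (MatRing k m n ⊗[k] V)}
    (hN : IsGStable τ (N.restrictScalars k)) :
    (Function.support (conv (hilbDenom m n) (hilb v β N))).Finite := by
  have h := finite_support_conv (k := k) (B := tbasis m n v) (wt := twt m β) wpiece_twt_finite
    (fun p : Fin m × Fin n => (Pi.single p.1 1, Pi.single p.2 1)) hasDegree_varMul Finset.univ ⊤ N
    le_top (fun _ _ _ => trivial) (hN.isWGraded hτ) (fun j hj => absurd (Finset.mem_univ j) hj)
  rwa [Fintype.prod_prod_type] at h

/-- A permutation of the rows moves the row `i` to the last row. -/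
theorem exists_insRow_eq_permWt (i : Fin (r + 1)) : ∃ s : Equiv.Perm (Fin (r + 1)),
    ∀ w : (Fin r → ℤ) × (Fin n → ℤ),
      insRow i w = permWt s (Fin.snoc (α := fun _ => ℤ) w.1 0, w.2) := by
  refine ⟨(finSuccEquiv' i).trans (finSuccEquiv' (Fin.last r)).symm, fun w =>
    Prod.ext (funext fun j => ?_) rfl⟩
  refine Fin.succAboveCases i ?_ (fun j => ?_) j
  · rw [insRow_fst_self]
    simp [permWt]
  · rw [insRow_fst_succAbove]
    simp [permWt]

theorem hilb_orbitKernel_insRow [Finite ι]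
    {N : Submodule (MatRing k r n) (MatRing k r n ⊗[k] V)}
    (hN : IsGStable τ (N.restrictScalars k)) (i : Fin (r + 1)) (w : (Fin r → ℤ) × (Fin n → ℤ)) :
    hilb v β (orbitKernel τ N) (insRow i w) = hilb v β N w := by
  obtain ⟨s, hs⟩ := exists_insRow_eq_permWt (n := n) i
  rw [hs, hilb_permWt (isGStable_orbitKernel hN)]
  have h1 := wdim_snoc_zero (v := v) (β := β) (P := ⊤) (Q := ⊤) (fun _ _ => trivial)
    (fun _ _ => trivial) w
  have h2 := wdim_snoc_zero (v := v) (β := β) (P := N.restrictScalars k)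
    (Q := (orbitKernel τ N).restrictScalars k) (fun _ hx => incl_mem_orbitKernel hN hx)
    (fun _ hx => restr_mem_of_mem_orbitKernel hx) w
  exact congrArg₂ (fun a b : ℤ => a - b) h1 h2

omit [CharZero k] in
theorem IsEquivariantPresentation.isGStable_ker {M : Type*} [AddCommGroup M] [Module k M]
    [Module (MatRing k m n) M] [IsScalarTower k (MatRing k m n) M]
    {σ : Representation k (GrpG k m n) M} {φ : MatRing k m n ⊗[k] V →ₗ[MatRing k m n] M}
    (hφ : IsEquivariantPresentation τ σ φ) :
    IsGStable τ ((LinearMap.ker φ).restrictScalars k) := by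
  intro g x hx
  change φ _ = 0
  rw [hφ.equivariant, (show φ x = 0 from hx), map_zero]

/-- The `K`-polynomial of a module is the product of its Hilbert series with the denominator, if
this is a Laurent polynomial. -/
theorem isKPolynomial_of_coeff_eq [Finite ι] (hτ : ∀ t l, τ t (v l) = tchar (β l) t • v l)
    {M : Type*} [AddCommGroup M] [Module k M] [Module (MatRing k m n) M]
    [IsScalarTower k (MatRing k m n) M] {σ : Representation k (GrpG k m n) M}
    {φ : MatRing k m n ⊗[k] V →ₗ[MatRing k m n] M} (hφ : IsEquivariantPresentation τ σ φ)
    {K : LaurentRing m n}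
    (hK : ⇑K.coeff = conv (hilbDenom m n) (hilb v β (LinearMap.ker φ))) : IsKPolynomial σ K := by
  refine ⟨fun w => (gradedPiece_finite_and_finrank hτ hφ w).1, fun w => ?_⟩
  rw [hK, conv_apply]
  refine Finset.sum_congr rfl fun d _ => ?_
  simp only [(gradedPiece_finite_and_finrank hτ hφ (w - d)).2]
  rfl

/-- The `K`-polynomials of a module and of a stabilization exist and are related by `ρ`. -/
theorem exists_isKPolynomial_stabilization [FiniteDimensional k V] {M M' : Type*}
    [AddCommGroup M] [Module k M] [Module (MatRing k r n) M] [IsScalarTower k (MatRing k r n) M]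
    [AddCommGroup M'] [Module k M'] [Module (MatRing k (r + 1) n) M']
    [IsScalarTower k (MatRing k (r + 1) n) M'] {σ : Representation k (GrpG k r n) M}
    {σ' : Representation k (GrpG k (r + 1) n) M'}
    {φ : MatRing k r n ⊗[k] V →ₗ[MatRing k r n] M} (hτ : IsRationalTorusRep τ)
    (hφ : IsEquivariantPresentation τ σ φ) (hσ' : IsStabilization τ (LinearMap.ker φ) σ') :
    ∃ K : MvPolynomial (Fin r) (TRing n), K.IsSymmetric ∧
      IsKPolynomial σ (toLaurent r n K) ∧
      IsKPolynomial σ' (toLaurent (r + 1) n (rho n K)) := by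
  obtain ⟨s, v, β, hv⟩ := exists_weight_basis τ hτ
  have : Finite s := Module.Finite.finite_basis v
  obtain ⟨ψ, hψ, hker⟩ := hσ'
  have hN := hφ.isGStable_ker
  rw [extendSubmodule_sup_eq_orbitKernel hv hN] at hker
  have hQ : IsGStable τ ((LinearMap.ker ψ).restrictScalars k) := hψ.isGStable_ker
  obtain ⟨K, hK, h1, h2⟩ := exists_toLaurent_rho (h := hilb v β (LinearMap.ker φ))
    (H := hilb v β (LinearMap.ker ψ)) (vanishesOnNeg_hilb _) (hilb_permWt hN)
    (finite_support_conv_hilb hv hN) (finite_support_conv_hilb hv hQ)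
    (conv_alternant_eq_sum (k := k) (vanishesOnNeg_hilb _)
      (by rw [hker]; exact hilb_orbitKernel_insRow hN)
      (exists_character hv hQ fun f hf x => by
        change f • x ∈ LinearMap.ker ψ
        rw [hker]
        exact minorIdeal_smul_le_orbitKernel (Submodule.smul_mem_smul hf trivial)))
  exact ⟨K, hK, isKPolynomial_of_coeff_eq hv hφ h1, isKPolynomial_of_coeff_eq hv hψ h2⟩

end KPolynomial

section ClosedSets

variable {k : Type*} [Field k] {r m n : ℕ}

/-- The presentation of the coordinate ring of `X` as a quotient of `R_m ⊗ k`. -/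
def coordPresentation (X : Set (PrimeSpectrum (MatRing k m n))) :
    MatRing k m n ⊗[k] k →ₗ[MatRing k m n] MatRing k m n ⧸ PrimeSpectrum.vanishingIdeal X :=
  (Submodule.mkQ (PrimeSpectrum.vanishingIdeal X)) ∘ₗ
    (TensorProduct.AlgebraTensorModule.rid k (MatRing k m n) (MatRing k m n)).toLinearMap

theorem coordPresentation_apply (X : Set (PrimeSpectrum (MatRing k m n)))
    (x : MatRing k m n ⊗[k] k) :
    coordPresentation X x = Ideal.Quotient.mk _ (TensorProduct.rid k _ x) := rfl

theorem mem_ker_coordPresentation {X : Set (PrimeSpectrum (MatRing k m n))}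
    {x : MatRing k m n ⊗[k] k} : x ∈ LinearMap.ker (coordPresentation X) ↔
      TensorProduct.rid k _ x ∈ PrimeSpectrum.vanishingIdeal X := by
  rw [LinearMap.mem_ker, coordPresentation_apply, Ideal.Quotient.eq_zero_iff_mem]

theorem rid_tensorAct (g : GrpG k m n) (x : MatRing k m n ⊗[k] k) :
    TensorProduct.rid k _ (tensorAct (1 : Representation k (Torus k n) k) g x) =
      coordAct g (TensorProduct.rid k _ x) := by
  induction x using TensorProduct.induction_on with
  | zero => simp
  | tmul f c => simp [tensorAct]
  | add x y hx hy => rw [map_add, map_add, hx, hy, map_add, map_add]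

theorem rid_restr (x : MatRing k (r + 1) n ⊗[k] k) :
    TensorProduct.rid k _ (restr k k r n x) = zeroRow (TensorProduct.rid k _ x) := by
  induction x using TensorProduct.induction_on with
  | zero => simp
  | tmul f c => simp [restr]
  | add x y hx hy => rw [map_add, map_add, hx, hy, map_add, map_add]

theorem isEquivariantPresentation_coordPresentation {X : Set (PrimeSpectrum (MatRing k m n))}
    (hX : IsStableSet X) :
    IsEquivariantPresentation 1 (coordRep hX) (coordPresentation X) where
  surjective := (Submodule.mkQ_surjective _).comp (LinearEquiv.surjective _)
  equivariant g x := by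
    rw [coordPresentation_apply, rid_tensorAct]
    rfl

theorem isRationalTorusRep_one : IsRationalTorusRep (1 : Representation k (Torus k n) k) :=
  ⟨Finsupp.single 0 LinearMap.id, fun t => by
    rw [Finsupp.sum_single_index (by simp)]
    simp
    rfl⟩

/-- The coordinate ring of the closure of `GL_{r + 1} X` is a stabilization of that of `X`. -/
theorem isStabilization_coordRep [CharZero k] {X : Set (PrimeSpectrum (MatRing k r n))}
    (hX : IsStableSet X) :
    IsStabilization 1 (LinearMap.ker (coordPresentation X))
      (coordRep (isStableSet_orbitClosure hX)) := by
  have hp := isEquivariantPresentation_coordPresentation hX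
  refine ⟨coordPresentation (orbitClosure X), isEquivariantPresentation_coordPresentation _, ?_⟩
  obtain ⟨s, v, β, hv⟩ := exists_weight_basis (1 : Representation k (Torus k n) k)
    isRationalTorusRep_one
  have : Finite s := Module.Finite.finite_basis v
  rw [extendSubmodule_sup_eq_orbitKernel hv hp.isGStable_ker]
  ext x
  rw [mem_ker_coordPresentation, mem_vanishingIdeal_orbitClosure]
  refine forall_congr' fun g => ?_
  rw [mem_ker_coordPresentation, rid_restr, rid_tensorAct]

end ClosedSets

end RowStabilization

end

theorem proposition4p6 {k : Type*} [Field k] [CharZero k] (r n : ℕ) :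
    (∀ (V M M' : Type*)
        [AddCommGroup V] [Module k V] [FiniteDimensional k V]
        [AddCommGroup M] [Module k M] [Module (MatRing k r n) M]
        [IsScalarTower k (MatRing k r n) M]
        [AddCommGroup M'] [Module k M'] [Module (MatRing k (r + 1) n) M']
        [IsScalarTower k (MatRing k (r + 1) n) M']
        (τ : Representation k (Torus k n) V)
        (σ : Representation k (GrpG k r n) M)
        (σ' : Representation k (GrpG k (r + 1) n) M')
        (φ : MatRing k r n ⊗[k] V →ₗ[MatRing k r n] M),
        IsRationalTorusRep τ →
        IsEquivariantPresentation τ σ φ →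
        IsStabilization τ (LinearMap.ker φ) σ' →
        ∃ K : MvPolynomial (Fin r) (TRing n), K.IsSymmetric ∧
          IsKPolynomial σ (toLaurent r n K) ∧
          IsKPolynomial σ' (toLaurent (r + 1) n (rho n K))) ∧
    (∀ (X : Set (PrimeSpectrum (MatRing k r n))) (_ : IsClosed X) (hX : IsStableSet X),
        ∃ K : MvPolynomial (Fin r) (TRing n), K.IsSymmetric ∧
          IsKPolynomial (coordRep hX) (toLaurent r n K) ∧
          IsKPolynomial (coordRep (isStableSet_orbitClosure hX))
            (toLaurent (r + 1) n (rho n K))) := by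
  refine ⟨fun V M M' => ?_, fun X _ hX => ?_⟩
  · intros
    exact exists_isKPolynomial_stabilization ‹_› ‹_› ‹_›
  · exact exists_isKPolynomial_stabilization isRationalTorusRep_one
      (isEquivariantPresentation_coordPresentation hX) (isStabilization_coordRep hX)
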